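/- **Setting.** Consider $N\ge 1$ trains $i\in\mathbb T=\{1,\dots,N\}$; train $i$ has $M_i\ge 1$ carriages $(i,j)$, $j=1,\dots,M_i$. Let $m_{ij}>0$, $r_{ij},b,c_1,c_2,d_p\in\mathbb R$, let $S_{ij}$ be a real $n_{ij}\times n_{ij}$ matrix, $E_{ij}$ a real row vector of length $n_{ij}$, and $C_{ij}=E_{ij}/m_{ij}$. Put $$B^1_{ij}(v)=-\tfrac{\kappa_{ij}b}{m_{ij}}-(c_1+2c_2v)-r_{ij},\qquad \kappa_{ij}=1\text{ if }j\in\{1,M_i\},\ \kappa_{ij}=2\text{ otherwise},$$ $B^2_{ij}=0$ if $j=1$ and $b/m_{ij}$ otherwise, $B^3_{ij}=0$ if $j=M_i$ and $b/m_{ij}$ otherwise. The plant, with inputs $u_{ij}$ and faults $f_{ij}$, is $$\dot x_{ij}=v_{ij},\quad \dot v_{ij}=w_{ij},\quad \dot w_{ij}=B^1_{ij}(v_{ij})w_{ij}+B^2_{ij}w_{i(j-1)}+B^3_{ij}w_{i(j+1)}+C_{ij}f_{ij}+u_{ij},\quad \dot f_{ij}=S_{ij}f_{ij}.$$ (Terms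 with the index $j-1=0$ or $j+1=M_i+1$ have coefficient $0$.) The reference satisfies $\dot x_0=v_0$, $\dot v_0=w_0$, $\dot w_0=u_0$ on $[0,\infty)$, and the reference velocity $v_0$ is bounded. Quantities of carriage $(i-1,M_{i-1})$ with $i=1$ are those of the reference: $x_{(i-1)M_{i-1}}=x_0$, $v_{(i-1)M_{i-1}}=v_0$, $\hat w_{(i-1)M_{i-1}}=w_0$. Let $0<\gamma_2<d_s<\gamma_1$, $\sigma_1,\sigma_2>0$, $\rho_1=\gamma_1-d_s$, $\rho_2=d_s-\gamma_2$. **Observer.** With $D^1_{ij}(v)=-\frac{\kappa_{ij}b}{m_{ij}}v-(c_1v+c_2v^2)-r_{ij}v$, $D^2_{ij}(v)=B^2_{ij}v$, $D^3_{ij}(v)=B^3_{ij}v$, $$\dot{\hat x}_{ij}=\hat v_{ij}+\mu_{ij1},\quad \dot{\hat v}_{ij}=\hat w_{ij}+\mu_{ij2},\quad \dot{\hat f}_{ij}=S_{ij}\hat f_{ij}+\mu_{ij4},$$ $$\dot{\hat w}_{ij}=B^1_{ij}(v_{ij})\hat w_{ij}+B^2_{ij}\hat w_{i(j-1)}+B^3_{ij}\hat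 w_{i(j+1)}+C_{ij}\hat f_{ij}+u_{ij}+\mu_{ij3},$$ where $$\begin{aligned} \mu_{ij1}&=-k_{ij1}(\hat x_{ij}-x_{ij})+(v_{ij}-\hat v_{ij}),\qquad \mu_{ij4}=k_{ij4}(\hat v_{ij}-v_{ij}),\\ \mu_{ij2}&=D^1_{ij}(v_{ij})-D^1_{ij}(\hat v_{ij})+k_{ij2}(\hat v_{ij}-v_{ij})+D^2_{ij}(v_{i(j-1)})-D^2_{ij}(\hat v_{i(j-1)})+D^3_{ij}(v_{i(j+1)})-D^3_{ij}(\hat v_{i(j+1)}),\\ \mu_{ij3}&=B^1_{ij}(v_{ij})\mu_{ij2}+k_{ij3}(\hat v_{ij}-v_{ij})+(B^1_{ij}(\hat v_{ij})-B^1_{ij}(v_{ij}))(\hat w_{ij}+\mu_{ij2})+B^2_{ij}\mu_{i(j-1)2}+B^3_{ij}\mu_{i(j+1)2}. \end{aligned}$$ **Controllers of the non-head carriages** ($j\ge 2$). With $z_{ij1}=\hat x_{ij}-\hat x_{i(j-1)}+d_p$, $z_{ij2}=\hat v_{ij}-\alpha_{ij1}$, $z_{ij3}=\hat w_{ij}-\alpha_{ij2}$,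 define functions $\alpha_{ij1}$ of $(\hat x_{ij},\hat x_{i(j-1)},\hat v_{i(j-1)})$ and $\alpha_{ij2}$ of $(\hat x_{ij},\hat x_{i(j-1)},\hat v_{ij},\hat v_{i(j-1)},\hat w_{i(j-1)})$, and $\alpha_{ij3}$, by $$\begin{aligned} \alpha_{ij1}={}&\hat v_{i(j-1)}-(l_{ij1}+1)z_{ij1},\\ \alpha_{ij2}={}&-l_{ij2}z_{ij2}-z_{ij1}-\tfrac12z_{ij2}+\tfrac{\partial\alpha_{ij1}}{\partial\hat x_{ij}}\hat v_{ij}+\tfrac{\partial\alpha_{ij1}}{\partial\hat x_{i(j-1)}}\hat v_{i(j-1)}+\tfrac{\partial\alpha_{ij1}}{\partial\hat v_{i(j-1)}}\hat w_{i(j-1)}\\ &-\tfrac12\Big[\big(\tfrac{\partial\alpha_{ij1}}{\partial\hat x_{ij}}\big)^2+\big(\tfrac{\partial\alpha_{ij1}}{\partial\hat x_{i(j-1)}}\big)^2+\big(\tfrac{\partial\alpha_{ij1}}{\partial\hat v_{i(j-1)}}\big)^2\Big]z_{ij2},\\ \alpha_{ij3}={}&-l_{ij3}z_{ij3}-z_{ij2}+\tfrac{\partial\alpha_{ij2}}{\partial\hat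 x_{ij}}\dot{\hat x}_{ij}+\tfrac{\partial\alpha_{ij2}}{\partial\hat x_{i(j-1)}}\dot{\hat x}_{i(j-1)}+\tfrac{\partial\alpha_{ij2}}{\partial\hat v_{ij}}\dot{\hat v}_{ij}+\tfrac{\partial\alpha_{ij2}}{\partial\hat v_{i(j-1)}}\dot{\hat v}_{i(j-1)}+\tfrac{\partial\alpha_{ij2}}{\partial\hat w_{i(j-1)}}\dot{\hat w}_{i(j-1)}, \end{aligned}$$ the time derivatives being the right-hand sides of the observer. The input is $$u_{ij}=-[B^1_{ij}(v_{ij})\hat w_{ij}+B^2_{ij}\hat w_{i(j-1)}+B^3_{ij}\hat w_{i(j+1)}+C_{ij}\hat f_{ij}+\mu_{ij3}]+\alpha_{ij3}.$$ **Controllers of the head carriages** ($j=1$). Let $\epsilon_i=x_{(i-1)M_{i-1}}-x_{i1}$, $\tilde x_i=\epsilon_i-d_s$, $\tilde v_i=v_{(i-1)M_{i-1}}-v_{i1}$, $\tilde{\hat w}_i=\hat w_{(i-1)M_{i-1}}-\hat w_{i1}$, $\tilde q_i=\tilde v_i+\ell_{i1}\tilde x_i$, $\varrho_{1}=\sigma_1-\ell_{i1}\rho_2$,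 $\varrho_{2}=\sigma_2-\ell_{i1}\rho_1$ (depending on $i$), and $$\phi_i(\tilde x_i)=\ln\frac{\rho_1\rho_2+\rho_1\tilde x_i}{\rho_1\rho_2-\rho_2\tilde x_i},\qquad \psi_i(\tilde q_i)=\ln\frac{\varrho_1\varrho_2+\varrho_1\tilde q_i}{\varrho_1\varrho_2-\varrho_2\tilde q_i},$$ $$\beta_{i1}(\tilde x_i,\tilde v_i)=-\phi_i(\tilde x_i)\phi_i'(\tilde x_i)-\ell_{i2}\tilde q_i-\ell_{i3}\psi_i(\tilde q_i)\psi_i'(\tilde q_i),\qquad \beta_{i2}=\tilde{\hat w}_i+\ell_{i1}\tilde v_i-\beta_{i1}.$$ The input is $$\begin{aligned}u_{i1}={}&G_{i-1}-[B^1_{i1}(v_{i1})\hat w_{i1}+B^3_{i1}\hat w_{i2}+C_{i1}\hat f_{i1}+\mu_{i13}]+\ell_{i1}\tilde{\hat w}_i+\ell_{i1}^2\beta_{i2}\\&-\frac{\partial\beta_{i1}}{\partial\tilde x_i}\tilde v_i-\frac{\partial\beta_{i1}}{\partial\tilde v_i}\tilde{\hat w}_i+\Big[\frac{\partial\beta_{i1}}{\partial\tilde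 v_i}\Big]^2\beta_{i2}+\tilde q_i+\ell_{i4}\beta_{i2},\end{aligned}$$ where $G_0=u_0$ and, for $i\ge2$ and $(p,q)=(i-1,M_{i-1})$, $G_{i-1}=B^1_{pq}(v_{pq})\hat w_{pq}+B^2_{pq}\hat w_{p(q-1)}+C_{pq}\hat f_{pq}+u_{pq}+\mu_{pq3}$. **Theorem.** Suppose that $k_{ij1}>0$ and that the matrix $$\begin{bmatrix}0&1&0\\0&0&C_{ij}\\0&0&S_{ij}\end{bmatrix}+\begin{bmatrix}k_{ij2}\\k_{ij3}\\k_{ij4}\end{bmatrix}\begin{bmatrix}1&0&0\end{bmatrix}$$ is Hurwitz for every carriage $(i,j)$; that $l_{ij1},l_{ij2},l_{ij3}>0$ for every carriage with $j\ge 2$; and that, for every $i\in\mathbb T$, $0<\ell_{i1}<\min\{\sigma_2/\rho_1,\sigma_1/\rho_2\}$, $\ell_{i2}>2$, $\ell_{i3}>2+\ell_{i2}^2/2$ and $\ell_{i4}>1/2$. Then from every initial state (of plant and observer) with $$-\rho_2<\tilde x_i(0)<\rho_1,\qquad -\varrho_2<\tilde q_i(0)<\varrho_1\qquad(i\in\mathbb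 T)$$ the closed-loop system has a solution on $[0,\infty)$, and every solution of it on $[0,\infty)$ with such an initial state satisfies - **(R1)** $\lim_{t\to\infty}[x_{i(j-1)}(t)-x_{ij}(t)]=d_p$ and $\lim_{t\to\infty}[v_{i(j-1)}(t)-v_{ij}(t)]=0$ for all $i\in\mathbb T$, $2\le j\le M_i$; - **(R2)** $\gamma_2<\epsilon_i(t)<\gamma_1$ for all $t\ge0$, and $\lim_{t\to\infty}\epsilon_i(t)=d_s$, for all $i\in\mathbb T$; - **(R3)** $-\sigma_2<\tilde v_i(t)<\sigma_1$ for all $t\ge0$, and $\lim_{t\to\infty}\tilde v_i(t)=0$, for all $i\in\mathbb T$. -/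

import Mathlib

/-!
Cooperative fault-tolerant cruise control of `N` trains; train `i` (`1 ≤ i ≤ N`) has carriages
`1, …, M i`.  Quantities are indexed by `ℕ × ℕ`; only the indices of actual carriages matter, since
the coefficients of the missing neighbours `(i, 0)` and `(i, M i + 1)` vanish.
-/

noncomputable section

namespace TrainCruise

open Filter Topology
open scoped Matrix

/-! ### Data -/

/-- The plant data: number of trains `N`, numbers of carriages `M i`, fault dimensions `n i j`,
masses `m i j`, actuator constants `r i j`, coupler damping `b`, resistance coefficients `c₁`, `c₂`,
nominal carriage spacing `dp`, and the fault data `E i j` (a row vector), `S i j`. -/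
structure Plant where
  N : ℕ
  M : ℕ → ℕ
  n : ℕ → ℕ → ℕ
  m : ℕ → ℕ → ℝ
  r : ℕ → ℕ → ℝ
  b : ℝ
  c₁ : ℝ
  c₂ : ℝ
  dp : ℝ
  E : (i j : ℕ) → Fin (n i j) → ℝ
  S : (i j : ℕ) → Matrix (Fin (n i j)) (Fin (n i j)) ℝ

/-- The specification: the distance between trains has to stay in `(γ₂, γ₁)` and to converge to
`ds`, their velocity difference has to stay in `(-σ₂, σ₁)`. -/
structure Spec where
  γ₁ : ℝ
  γ₂ : ℝ
  ds : ℝ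
  σ₁ : ℝ
  σ₂ : ℝ

/-- The gains of the observer (`k₁, …, k₄`), of the controllers of the non-head carriages
(`l₁, l₂, l₃`) and of the head carriages (`ell₁, …, ell₄`). -/
structure Gains (P : Plant) where
  k₁ : ℕ → ℕ → ℝ
  k₂ : ℕ → ℕ → ℝ
  k₃ : ℕ → ℕ → ℝ
  k₄ : (i j : ℕ) → Fin (P.n i j) → ℝ
  l₁ : ℕ → ℕ → ℝ
  l₂ : ℕ → ℕ → ℝ
  l₃ : ℕ → ℕ → ℝ
  ell₁ : ℕ → ℝ
  ell₂ : ℕ → ℝ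
  ell₃ : ℕ → ℝ
  ell₄ : ℕ → ℝ

/-- The reference position, velocity, acceleration and input, as functions of time. -/
structure Reference where
  x : ℝ → ℝ
  v : ℝ → ℝ
  w : ℝ → ℝ
  u : ℝ → ℝ

/-- A state of plant (`x, v, w, f`) and observer (`xh, vh, wh, fh`). -/
structure State (P : Plant) where
  x : ℕ → ℕ → ℝ
  v : ℕ → ℕ → ℝ
  w : ℕ → ℕ → ℝ
  f : (i j : ℕ) → Fin (P.n i j) → ℝ
  xh : ℕ → ℕ → ℝ
  vh : ℕ → ℕ → ℝ
  wh : ℕ → ℕ → ℝ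
  fh : (i j : ℕ) → Fin (P.n i j) → ℝ

/-- `i` is the index of a train. -/
def Plant.IsTrain (P : Plant) (i : ℕ) : Prop := 1 ≤ i ∧ i ≤ P.N

/-- `(i, j)` is the index of a carriage. -/
def Plant.IsCarriage (P : Plant) (i j : ℕ) : Prop := P.IsTrain i ∧ 1 ≤ j ∧ j ≤ P.M i

/-- `ẋ₀ = v₀`, `v̇₀ = w₀`, `ẇ₀ = u₀` on `[0, ∞)`. -/
def Reference.IsTrajectory (R : Reference) : Prop :=
  ∀ t : ℝ, 0 ≤ t →
    HasDerivWithinAt R.x (R.v t) (Set.Ici 0) t ∧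
    HasDerivWithinAt R.v (R.w t) (Set.Ici 0) t ∧
    HasDerivWithinAt R.w (R.u t) (Set.Ici 0) t

/-! ### Coefficients of the plant -/

def Plant.C (P : Plant) (i j : ℕ) : Fin (P.n i j) → ℝ := fun k => P.E i j k / P.m i j

def Plant.B1 (P : Plant) (i j : ℕ) (v : ℝ) : ℝ :=
  if j = 1 ∨ j = P.M i then
    -(P.b / P.m i j) - (P.c₁ + 2 * P.c₂ * v) - P.r i j
  else
    -(2 * P.b / P.m i j) - (P.c₁ + 2 * P.c₂ * v) - P.r i j

def Plant.B2 (P : Plant) (i j : ℕ) : ℝ := if j = 1 then 0 else P.b / P.m i j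

def Plant.B3 (P : Plant) (i j : ℕ) : ℝ := if j = P.M i then 0 else P.b / P.m i j

/-- `D1 i j` is the antiderivative of `B1 i j` that vanishes at `0`. -/
def Plant.D1 (P : Plant) (i j : ℕ) (v : ℝ) : ℝ :=
  if j = 1 ∨ j = P.M i then
    -(P.b / P.m i j) * v - (P.c₁ * v + P.c₂ * v ^ 2) - P.r i j * v
  else
    -(2 * P.b / P.m i j) * v - (P.c₁ * v + P.c₂ * v ^ 2) - P.r i j * v

def Plant.D2 (P : Plant) (i j : ℕ) (v : ℝ) : ℝ := if j = 1 then 0 else P.b / P.m i j * v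

def Plant.D3 (P : Plant) (i j : ℕ) (v : ℝ) : ℝ := if j = P.M i then 0 else P.b / P.m i j * v

/-! ### The observer -/

section Observer

variable {P : Plant} (K : Gains P) (s : State P)

def mu1 (i j : ℕ) : ℝ :=
  -K.k₁ i j * (s.xh i j - s.x i j) + (s.v i j - s.vh i j)

def mu2 (i j : ℕ) : ℝ :=
  P.D1 i j (s.v i j) - P.D1 i j (s.vh i j) + K.k₂ i j * (s.vh i j - s.v i j)
    + (P.D2 i j (s.v i (j - 1)) - P.D2 i j (s.vh i (j - 1)))
    + (P.D3 i j (s.v i (j + 1)) - P.D3 i j (s.vh i (j + 1)))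

def mu3 (i j : ℕ) : ℝ :=
  P.B1 i j (s.v i j) * mu2 K s i j + K.k₃ i j * (s.vh i j - s.v i j)
    + (P.B1 i j (s.vh i j) - P.B1 i j (s.v i j)) * (s.wh i j + mu2 K s i j)
    + P.B2 i j * mu2 K s i (j - 1) + P.B3 i j * mu2 K s i (j + 1)

def mu4 (i j : ℕ) : Fin (P.n i j) → ℝ := (s.vh i j - s.v i j) • K.k₄ i j

/-- Right-hand side of the plant equation for `w i j`, with input `u = u i j`. -/
def wRhs (s : State P) (u : ℝ) (i j : ℕ) : ℝ :=
  P.B1 i j (s.v i j) * s.w i j + P.B2 i j * s.w i (j - 1) + P.B3 i j * s.w i (j + 1)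
    + P.C i j ⬝ᵥ s.f i j + u

/-- Right-hand sides of the observer equations. -/
def xhRhs (i j : ℕ) : ℝ := s.vh i j + mu1 K s i j

def vhRhs (i j : ℕ) : ℝ := s.wh i j + mu2 K s i j

def whRhs (u : ℝ) (i j : ℕ) : ℝ :=
  P.B1 i j (s.v i j) * s.wh i j + P.B2 i j * s.wh i (j - 1) + P.B3 i j * s.wh i (j + 1)
    + P.C i j ⬝ᵥ s.fh i j + u + mu3 K s i j

def fhRhs (i j : ℕ) : Fin (P.n i j) → ℝ := P.S i j *ᵥ s.fh i j + mu4 K s i j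

end Observer

/-- The matrix `A`; the three blocks of coordinates have sizes `1`, `1` and `n i j`. -/
def Plant.A (P : Plant) (i j : ℕ) :
    Matrix (Unit ⊕ Unit ⊕ Fin (P.n i j)) (Unit ⊕ Unit ⊕ Fin (P.n i j)) ℝ :=
  Matrix.of fun
    | .inl _, .inr (.inl _) => 1
    | .inr (.inl _), .inr (.inr k) => P.C i j k
    | .inr (.inr k), .inr (.inr k') => P.S i j k k'
    | _, _ => 0

/-- The column `(k₂, k₃, k₄)`. -/
def Gains.col {P : Plant} (K : Gains P) (i j : ℕ) :
    Matrix (Unit ⊕ Unit ⊕ Fin (P.n i j)) Unit ℝ :=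
  Matrix.of fun
    | .inl _, _ => K.k₂ i j
    | .inr (.inl _), _ => K.k₃ i j
    | .inr (.inr k), _ => K.k₄ i j k

/-- The output row `(1, 0, 0)`. -/
def Plant.out (P : Plant) (i j : ℕ) : Matrix Unit (Unit ⊕ Unit ⊕ Fin (P.n i j)) ℝ :=
  Matrix.of fun
    | _, .inl _ => 1
    | _, .inr _ => 0

/-- A real square matrix is Hurwitz if its complex eigenvalues have negative real part. -/
def IsHurwitz {ι : Type*} [Fintype ι] [DecidableEq ι] (A : Matrix ι ι ℝ) : Prop :=
  ∀ z ∈ spectrum ℂ (A.map (algebraMap ℝ ℂ)), z.re < 0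

/-! ### Controllers of the non-head carriages

The arguments `xj, vj, wj` stand for the estimates of carriage `(i, j)`, and `xp, vp, wp` for those
of its predecessor `(i, j - 1)`. -/

section Backstepping

variable {P : Plant} (K : Gains P) (i j : ℕ)

def z1 (P : Plant) (xj xp : ℝ) : ℝ := xj - xp + P.dp

def alpha1 (xj xp vp : ℝ) : ℝ := vp - (K.l₁ i j + 1) * z1 P xj xp

def z2 (xj xp vj vp : ℝ) : ℝ := vj - alpha1 K i j xj xp vp

def alpha2 (xj xp vj vp wp : ℝ) : ℝ :=
  -K.l₂ i j * z2 K i j xj xp vj vp - z1 P xj xp - 1 / 2 * z2 K i j xj xp vj vp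
    + deriv (fun y => alpha1 K i j y xp vp) xj * vj
    - 1 / 2 * (deriv (fun y => alpha1 K i j y xp vp) xj) ^ 2 * z2 K i j xj xp vj vp
    + deriv (fun y => alpha1 K i j xj y vp) xp * vp
    - 1 / 2 * (deriv (fun y => alpha1 K i j xj y vp) xp) ^ 2 * z2 K i j xj xp vj vp
    + deriv (fun y => alpha1 K i j xj xp y) vp * wp
    - 1 / 2 * (deriv (fun y => alpha1 K i j xj xp y) vp) ^ 2 * z2 K i j xj xp vj vp

def z3 (xj xp vj vp wj wp : ℝ) : ℝ := wj - alpha2 K i j xj xp vj vp wp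

/-- `up` is the input of the predecessor `(i, j - 1)`; the time derivatives of the estimates are
given by the observer. -/
def alpha3 (s : State P) (up : ℝ) : ℝ :=
  let xj := s.xh i j
  let vj := s.vh i j
  let wj := s.wh i j
  let xp := s.xh i (j - 1)
  let vp := s.vh i (j - 1)
  let wp := s.wh i (j - 1);
  -K.l₃ i j * z3 K i j xj xp vj vp wj wp - z2 K i j xj xp vj vp
    + deriv (fun y => alpha2 K i j y xp vj vp wp) xj * xhRhs K s i j
    + deriv (fun y => alpha2 K i j xj y vj vp wp) xp * xhRhs K s i (j - 1)
    + deriv (fun y => alpha2 K i j xj xp y vp wp) vj * vhRhs K s i j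
    + deriv (fun y => alpha2 K i j xj xp vj y wp) vp * vhRhs K s i (j - 1)
    + deriv (fun y => alpha2 K i j xj xp vj vp y) wp * whRhs K s up i (j - 1)

/-- The control input of a non-head carriage `(i, j)`, `j ≥ 2`. -/
def followerControl (s : State P) (up : ℝ) : ℝ :=
  -(P.B1 i j (s.v i j) * s.wh i j + P.B2 i j * s.wh i (j - 1) + P.B3 i j * s.wh i (j + 1)
      + P.C i j ⬝ᵥ s.fh i j + mu3 K s i j)
    + alpha3 K i j s up

end Backstepping

/-! ### Controllers of the head carriages -/

def Spec.ρ₁ (D : Spec) : ℝ := D.γ₁ - D.ds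

def Spec.ρ₂ (D : Spec) : ℝ := D.ds - D.γ₂

/-- The logarithmic error transformation for the interval `(-p₂, p₁)`. -/
def logBarrier (p₁ p₂ y : ℝ) : ℝ := Real.log ((p₁ * p₂ + p₁ * y) / (p₁ * p₂ - p₂ * y))

section Head

variable {P : Plant} (D : Spec) (K : Gains P) (R : Reference) (i : ℕ)

def varrho₁ : ℝ := -K.ell₁ i * D.ρ₂ + D.σ₁

def varrho₂ : ℝ := -K.ell₁ i * D.ρ₁ + D.σ₂

def phi (y : ℝ) : ℝ := logBarrier D.ρ₁ D.ρ₂ y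

def psi (q : ℝ) : ℝ := logBarrier (varrho₁ D K i) (varrho₂ D K i) q

def beta1 (xt vt : ℝ) : ℝ :=
  let qt := vt + K.ell₁ i * xt;
  -(phi D xt * deriv (phi D) xt) - K.ell₂ i * qt
    - K.ell₃ i * (psi D K i qt * deriv (psi D K i) qt)

def beta2 (xt vt wt : ℝ) : ℝ := wt + K.ell₁ i * vt - beta1 D K i xt vt

/-- Position, velocity and estimated acceleration, at time `t`, of the tail carriage of the train
in front of train `i`; the train in front of train `1` is the virtual reference train. -/
def xFront (s : State P) (t : ℝ) : ℝ := if i = 1 then R.x t else s.x (i - 1) (P.M (i - 1))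

def vFront (s : State P) (t : ℝ) : ℝ := if i = 1 then R.v t else s.v (i - 1) (P.M (i - 1))

def whFront (s : State P) (t : ℝ) : ℝ := if i = 1 then R.w t else s.wh (i - 1) (P.M (i - 1))

/-- Distance between train `i` and the train in front of it. -/
def gap (s : State P) (t : ℝ) : ℝ := xFront R i s t - s.x i 1

def xTilde (s : State P) (t : ℝ) : ℝ := gap R i s t - D.ds

def vTilde (s : State P) (t : ℝ) : ℝ := vFront R i s t - s.v i 1

def whTilde (s : State P) (t : ℝ) : ℝ := whFront R i s t - s.wh i 1

def qTilde (s : State P) (t : ℝ) : ℝ := vTilde R i s t + K.ell₁ i * xTilde D R i s t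

/-- The feedforward term `G` in the controller of the head of train `i`; `u` is the array of inputs
at time `t`, of which only the input of the tail carriage of train `i - 1` is used. -/
def feedforward (s : State P) (u : ℕ → ℕ → ℝ) (t : ℝ) : ℝ :=
  if i = 1 then R.u t
  else
    P.B1 (i - 1) (P.M (i - 1)) (s.v (i - 1) (P.M (i - 1))) * s.wh (i - 1) (P.M (i - 1))
      + P.B2 (i - 1) (P.M (i - 1)) * s.wh (i - 1) (P.M (i - 1) - 1)
      + P.C (i - 1) (P.M (i - 1)) ⬝ᵥ s.fh (i - 1) (P.M (i - 1))
      + u (i - 1) (P.M (i - 1)) + mu3 K s (i - 1) (P.M (i - 1))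

/-- The control input of the head carriage `(i, 1)`. -/
def headControl (s : State P) (u : ℕ → ℕ → ℝ) (t : ℝ) : ℝ :=
  let xt := xTilde D R i s t
  let vt := vTilde R i s t
  let wt := whTilde R i s t
  let b2 := beta2 D K i xt vt wt
  let dx := deriv (fun y => beta1 D K i y vt) xt
  let dv := deriv (fun y => beta1 D K i xt y) vt
  feedforward K R i s u t
    - (P.B1 i 1 (s.v i 1) * s.wh i 1 + P.B3 i 1 * s.wh i 2 + P.C i 1 ⬝ᵥ s.fh i 1 + mu3 K s i 1)
    + K.ell₁ i * wt + K.ell₁ i ^ 2 * b2 - dx * vt - dv * wt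
    + dv ^ 2 * b2 + qTilde D K R i s t + K.ell₄ i * b2

end Head

/-! ### The closed loop and the requirements -/

section ClosedLoop

variable {P : Plant} (D : Spec) (K : Gains P) (R : Reference)

/-- `s`, together with the input `u`, solves the closed-loop equations on `[0, ∞)`. -/
structure IsClosedLoopSolution (s : ℝ → State P) (u : ℝ → ℕ → ℕ → ℝ) : Prop where
  control : ∀ t : ℝ, 0 ≤ t → ∀ i j, P.IsCarriage i j →
    u t i j =
      if j = 1 then headControl D K R i (s t) (u t) t
      else followerControl K i j (s t) (u t i (j - 1))
  plant : ∀ t : ℝ, 0 ≤ t → ∀ i j, P.IsCarriage i j →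
    HasDerivWithinAt (fun τ => (s τ).x i j) ((s t).v i j) (Set.Ici 0) t ∧
    HasDerivWithinAt (fun τ => (s τ).v i j) ((s t).w i j) (Set.Ici 0) t ∧
    HasDerivWithinAt (fun τ => (s τ).w i j) (wRhs (s t) (u t i j) i j) (Set.Ici 0) t ∧
    HasDerivWithinAt (fun τ => (s τ).f i j) (P.S i j *ᵥ (s t).f i j) (Set.Ici 0) t
  observer : ∀ t : ℝ, 0 ≤ t → ∀ i j, P.IsCarriage i j →
    HasDerivWithinAt (fun τ => (s τ).xh i j) (xhRhs K (s t) i j) (Set.Ici 0) t ∧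
    HasDerivWithinAt (fun τ => (s τ).vh i j) (vhRhs K (s t) i j) (Set.Ici 0) t ∧
    HasDerivWithinAt (fun τ => (s τ).wh i j) (whRhs K (s t) (u t i j) i j) (Set.Ici 0) t ∧
    HasDerivWithinAt (fun τ => (s τ).fh i j) (fhRhs K (s t) i j) (Set.Ici 0) t

/-- The condition on the initial state. -/
def IsAdmissible (s₀ : State P) : Prop :=
  ∀ i, P.IsTrain i →
    (-D.ρ₂ < xTilde D R i s₀ 0 ∧ xTilde D R i s₀ 0 < D.ρ₁) ∧
    (-varrho₂ D K i < qTilde D K R i s₀ 0 ∧ qTilde D K R i s₀ 0 < varrho₁ D K i)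

/-- Adjacent carriages of a train converge to spacing `dp` and to equal velocities. -/
def RequirementOne (s : ℝ → State P) : Prop :=
  ∀ i j, P.IsCarriage i j → 2 ≤ j →
    Tendsto (fun t => (s t).x i (j - 1) - (s t).x i j) atTop (𝓝 P.dp) ∧
    Tendsto (fun t => (s t).v i (j - 1) - (s t).v i j) atTop (𝓝 0)

/-- The distance between adjacent trains stays in `(γ₂, γ₁)` and converges to `ds`. -/
def RequirementTwo (s : ℝ → State P) : Prop :=
  ∀ i, P.IsTrain i →
    (∀ t : ℝ, 0 ≤ t → D.γ₂ < gap R i (s t) t ∧ gap R i (s t) t < D.γ₁) ∧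
    Tendsto (fun t => gap R i (s t) t) atTop (𝓝 D.ds)

/-- The velocity difference of adjacent trains stays in `(-σ₂, σ₁)` and converges to `0`. -/
def RequirementThree (s : ℝ → State P) : Prop :=
  ∀ i, P.IsTrain i →
    (∀ t : ℝ, 0 ≤ t → -D.σ₂ < vTilde R i (s t) t ∧ vTilde R i (s t) t < D.σ₁) ∧
    Tendsto (fun t => vTilde R i (s t) t) atTop (𝓝 0)

end ClosedLoop

end TrainCruise

end

noncomputable section

namespace TrainCruise

open Filter Topology Set
open scoped Matrix

/-! ### Scalar differential inequalities -/

/-! The observer decouples the estimation errors from everything else. The position error obeys `ė =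
-k₁ e`. Correcting the acceleration error by the difference of `D1` and by the neighbours' velocity
errors gives `zeta`, and (velocity error, `zeta`, fault error) solves the constant linear system of
the given Hurwitz matrix, so it tends to zero whatever the inputs are. The acceleration error is
`zeta`, plus vanishing terms, plus a multiple of (velocity error) × (true velocity) (`accelErr_eq`).
It therefore vanishes as soon as the velocity is known to be bounded.

The inputs cancel all couplings in the equation for `wh`, so the platoon is a cascade in which each
carriage follows the one in front.

Non-head carriage: the backstepping variables form a stable chain, perturbed by vanishing terms and
by a vanishing coefficient times the state. This uses a bounded velocity of the predecessor, and a
sum of squares shows decay (`backstepping_tendsto_zero`).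

Head carriage: the errors solve a system whose disturbance `δ` is a difference of acceleration
errors, and `headEnergy` satisfies `E' ≤ -c E + δ²`. Its barrier `phi` confines `xTilde`. The
barrier `psi` of `qTilde` is not part of the energy, but `psi² / 2` grows at a bounded rate while
the energy is bounded, so `qTilde` cannot reach the ends of its interval in finite time. Confinement
needs `δ` bounded only on bounded time intervals, which breaks the apparent circle: confinement
bounds the head velocity by that of the carriage in front, bounded velocity gives `δ → 0`, and `δ →
0` gives convergence. Induction along the platoon completes the argument.

Existence follows the same cascade. The errors are computed beforehand from their linear equations.
Each carriage then solves an ODE driven by its predecessor: a linear one for a non-head carriage,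
and for a head one whose solutions stay in compact parts of the admissible region on bounded times
(`HeadGains.exists_compact`, `exists_global_solution`). -/

theorem tendsto_zero_of_deriv_le {y y' η : ℝ → ℝ} {c : ℝ} (hc : 0 < c)
    (hy : ∀ t, 0 ≤ t → HasDerivWithinAt y (y' t) (Ici 0) t)
    (hy0 : ∀ t, 0 ≤ t → 0 ≤ y t)
    (hle : ∀ᶠ t in atTop, y' t ≤ -c * y t + η t)
    (hη : Tendsto η atTop (𝓝 0)) : Tendsto y atTop (𝓝 0) := by
  rw [Metric.tendsto_atTop]
  intro ε hε
  have h1 : ∀ᶠ t in atTop, η t < c * (ε / 2) := hη.eventually_lt_const (by positivity)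
  obtain ⟨T, hT⟩ := (hle.and (h1.and (eventually_ge_atTop 1))).exists_forall_of_atTop
  have hT1 : 1 ≤ T := (hT T le_rfl).2.2
  -- Once `η < c * (ε / 2)`, the shifted function satisfies `(y - ε / 2)' ≤ -c * (y - ε / 2)`, and
  -- `exp (c * t)` is the integrating factor.
  have hanti : AntitoneOn (fun t => (y t - ε / 2) * Real.exp (c * t)) (Ici T) := by
    have hd : ∀ t ∈ Ici T, HasDerivWithinAt (fun t => (y t - ε / 2) * Real.exp (c * t))
        (y' t * Real.exp (c * t) + (y t - ε / 2) * (Real.exp (c * t) * (c * 1))) (Ici T) t := by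
      intro t ht
      have ht' : T ≤ t := ht
      have := (hy t (by linarith)).mono (show Ici T ⊆ Ici 0 from Ici_subset_Ici.2 (by linarith))
      exact (this.sub_const _).mul (((hasDerivAt_id t).const_mul c).exp.hasDerivWithinAt)
    refine antitoneOn_of_hasDerivWithinAt_nonpos (convex_Ici T)
      (fun t ht => (hd t ht).continuousWithinAt)
      (fun t ht => (hd t (interior_subset ht)).mono interior_subset) fun t ht => ?_
    have ht' : T ≤ t := interior_subset ht
    obtain ⟨ha, hb, -⟩ := hT t ht'
    have : y' t + c * (y t - ε / 2) ≤ 0 := by linarith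
    have := mul_nonpos_of_nonpos_of_nonneg this (Real.exp_pos (c * t)).le
    linarith
  have hlim : Tendsto (fun t => (y T - ε / 2) * Real.exp (c * T) * Real.exp (-(c * t)))
      atTop (𝓝 0) := by
    have : Tendsto (fun t : ℝ => Real.exp (-(c * t))) atTop (𝓝 0) :=
      Real.tendsto_exp_neg_atTop_nhds_zero.comp (tendsto_id.const_mul_atTop hc)
    simpa using this.const_mul ((y T - ε / 2) * Real.exp (c * T))
  obtain ⟨T', hT'⟩ := (hlim.eventually_lt_const (half_pos hε)).exists_forall_of_atTop
  refine ⟨max T T', fun t ht => ?_⟩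
  have htT : T ≤ t := (le_max_left _ _).trans ht
  have h2 := hT' t ((le_max_right _ _).trans ht)
  have h3 : (y t - ε / 2) * Real.exp (c * t) ≤ (y T - ε / 2) * Real.exp (c * T) :=
    hanti (mem_Ici.2 le_rfl) htT htT
  have h4 := mul_le_mul_of_nonneg_right h3 (Real.exp_pos (-(c * t))).le
  rw [mul_assoc, ← Real.exp_add, add_neg_cancel, Real.exp_zero, mul_one] at h4
  rw [Real.dist_eq, sub_zero, abs_of_nonneg (hy0 t (by linarith))]
  linarith

theorem tendsto_zero_of_sq {f : ℝ → ℝ} (h : Tendsto (fun t => f t ^ 2) atTop (𝓝 0)) :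
    Tendsto f atTop (𝓝 0) := by
  have := h.sqrt
  simp only [Real.sqrt_sq_eq_abs, Real.sqrt_zero] at this
  exact (tendsto_zero_iff_abs_tendsto_zero f).2 this

theorem le_add_mul_of_deriv_le {f f' : ℝ → ℝ} {τ C : ℝ}
    (hf : ∀ t ∈ Ico 0 τ, HasDerivWithinAt f (f' t) (Ici 0) t)
    (hle : ∀ t ∈ Ico 0 τ, f' t ≤ C) : ∀ t ∈ Ico 0 τ, f t ≤ f 0 + C * t := by
  intro t ht
  have hd : ∀ s ∈ Icc 0 t, HasDerivWithinAt f (f' s) (Ici 0) s := fun s hs =>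
    hf s ⟨hs.1, hs.2.trans_lt ht.2⟩
  refine image_le_of_deriv_right_le_deriv_boundary (f := f) (f' := f') (a := 0) (b := t)
    (B := fun s => f 0 + C * s) (B' := fun _ => C)
    (fun s hs => (hd s hs).continuousWithinAt.mono fun r hr => hr.1)
    (fun s hs => (hd s ⟨hs.1, hs.2.le⟩).mono (Ici_subset_Ici.2 hs.1)) (by simp)
    (by fun_prop) (fun s _ => ?_) (fun s hs => hle s ⟨hs.1, hs.2.trans ht.2⟩) ⟨ht.1, le_rfl⟩
  simpa using (((hasDerivAt_id s).const_mul C).const_add (f 0)).hasDerivWithinAt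

/-! ### Hurwitz matrices -/

/-- The function `|y|²` decays at rate `-2 Re z` up to a cross term in `y` and `g`; Young's
inequality with weight `-Re z` costs half of that rate and leaves `|g|² / (-Re z)`. -/
theorem tendsto_zero_of_deriv_eq_complex {y g : ℝ → ℂ} {z : ℂ} (hz : z.re < 0)
    (hy : ∀ t, 0 ≤ t → HasDerivWithinAt y (z * y t + g t) (Ici 0) t)
    (hg : Tendsto g atTop (𝓝 0)) : Tendsto y atTop (𝓝 0) := by
  have hre : ∀ t, 0 ≤ t → HasDerivWithinAt (fun t => (y t).re) (z * y t + g t).re (Ici 0) t :=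
    fun t ht => (Complex.reCLM.hasFDerivAt.comp_hasDerivWithinAt t (hy t ht))
  have him : ∀ t, 0 ≤ t → HasDerivWithinAt (fun t => (y t).im) (z * y t + g t).im (Ici 0) t :=
    fun t ht => (Complex.imCLM.hasFDerivAt.comp_hasDerivWithinAt t (hy t ht))
  have hN : Tendsto (fun t => (y t).re ^ 2 + (y t).im ^ 2) atTop (𝓝 0) := by
    refine tendsto_zero_of_deriv_le (c := -z.re) (by linarith)
      (η := fun t => ((g t).re ^ 2 + (g t).im ^ 2) / (-z.re))
      (fun t ht => ((hre t ht).pow 2).add ((him t ht).pow 2)) (fun t _ => by positivity)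
      (Eventually.of_forall fun t => ?_) ?_
    · have key : ∀ a b : ℝ, 2 * (a * b) ≤ -z.re * a ^ 2 + b ^ 2 / (-z.re) := by
        intro a b
        have hz' : 0 < -z.re := by linarith
        have hne : z.re ≠ 0 := hz.ne
        have : 0 ≤ (-z.re * a - b) ^ 2 / (-z.re) := by positivity
        have h2 : (-z.re * a - b) ^ 2 / (-z.re) =
            -z.re * a ^ 2 + b ^ 2 / (-z.re) - 2 * (a * b) := by
          field_simp
          ring
        linarith
      have h1 := key (y t).re (g t).re
      have h2 := key (y t).im (g t).im
      simp only [Complex.add_re, Complex.mul_re, Complex.add_im, Complex.mul_im]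
      rw [add_div]
      norm_num
      linarith
    · have h1 : Tendsto (fun t => (g t).re) atTop (𝓝 0) :=
        (Complex.continuous_re.tendsto' 0 0 rfl).comp hg
      have h2 : Tendsto (fun t => (g t).im) atTop (𝓝 0) :=
        (Complex.continuous_im.tendsto' 0 0 rfl).comp hg
      simpa using ((h1.pow 2).add (h2.pow 2)).div_const (-z.re)
  rw [tendsto_zero_iff_norm_tendsto_zero]
  have := hN.sqrt
  rw [Real.sqrt_zero] at this
  refine this.congr fun t => ?_
  rw [Complex.norm_def, Complex.normSq_apply, sq, sq]

/-- Factors are peeled off one at a time: `(A - z) e` solves the same system and is annihilated by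
the remaining product, so it tends to zero by induction, and each coordinate of `e` solves `ẏ = z y
+ g` with `g → 0`. Cayley–Hamilton supplies the vanishing product, so no Jordan form is needed. -/
theorem tendsto_zero_of_prod_eq_zero {ι : Type*} [Fintype ι] [DecidableEq ι] (A : Matrix ι ι ℂ)
    (l : List ℂ) (hl : ∀ z ∈ l, z.re < 0) :
    ∀ e : ℝ → ι → ℂ, (∀ t, 0 ≤ t → HasDerivWithinAt e (A *ᵥ e t) (Ici 0) t) →
      (∀ t, 0 ≤ t → (l.map fun z => A - z • (1 : Matrix ι ι ℂ)).prod *ᵥ e t = 0) →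
      Tendsto e atTop (𝓝 0) := by
  induction l with
  | nil =>
    intro e _ h
    refine tendsto_const_nhds.congr' ?_
    filter_upwards [eventually_ge_atTop 0] with t ht
    simpa using (h t ht).symm
  | cons z l ih =>
    intro e he h
    have hcomm : Commute (A - z • (1 : Matrix ι ι ℂ))
        (l.map fun z => A - z • (1 : Matrix ι ι ℂ)).prod := by
      refine Commute.list_prod_right _ _ fun B hB => ?_
      obtain ⟨w, -, rfl⟩ := List.mem_map.1 hB
      simp only [Commute, SemiconjBy, sub_mul, mul_sub, smul_mul_assoc, mul_smul_comm, one_mul,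
        mul_one, smul_sub]
      rw [smul_comm z w]
      abel
    have hg := ih (fun w hw => hl w (List.mem_cons_of_mem _ hw))
      (fun t => (A - z • (1 : Matrix ι ι ℂ)) *ᵥ e t) (fun t ht => ?_) (fun t ht => ?_)
    · rw [tendsto_pi_nhds] at hg ⊢
      intro k
      refine tendsto_zero_of_deriv_eq_complex (hl z List.mem_cons_self) (fun t ht => ?_) (hg k)
      refine (hasDerivWithinAt_pi.1 (he t ht) k).congr_deriv ?_
      simp [Matrix.sub_mulVec, Matrix.smul_mulVec]
    · have := (LinearMap.toContinuousLinearMap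
        ((Matrix.mulVecLin (A - z • (1 : Matrix ι ι ℂ))).restrictScalars
          ℝ)).hasFDerivAt.comp_hasDerivWithinAt t (he t ht)
      refine this.congr_deriv ?_
      simp [Matrix.sub_mulVec, Matrix.smul_mulVec, Matrix.mulVec_sub, Matrix.mulVec_smul]
    · rw [Matrix.mulVec_mulVec, ← hcomm.eq]
      simpa using h t ht

/-- Solutions of the linear system of `A` tend to `0` if `A` is Hurwitz. -/
theorem IsHurwitz.tendsto_zero {ι : Type*} [Fintype ι] [DecidableEq ι] {A : Matrix ι ι ℝ}
    (hA : IsHurwitz A) {e : ℝ → ι → ℝ}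
    (he : ∀ t, 0 ≤ t → HasDerivWithinAt e (A *ᵥ e t) (Ici 0) t) : Tendsto e atTop (𝓝 0) := by
  set B : Matrix ι ι ℂ := A.map (algebraMap ℝ ℂ) with hB
  have hsplit : B.charpoly =
      (B.charpoly.roots.toList.map fun z => Polynomial.X - Polynomial.C z).prod := by
    have h1 := (IsAlgClosed.splits B.charpoly).eq_prod_roots_of_monic B.charpoly_monic
    conv_lhs => rw [h1]
    conv_lhs => rw [← Multiset.coe_toList B.charpoly.roots]
    rw [Multiset.map_coe, Multiset.prod_coe]
  have hzero : (B.charpoly.roots.toList.map fun z => B - z • (1 : Matrix ι ι ℂ)).prod = 0 := by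
    have := B.aeval_self_charpoly
    rw [hsplit, map_list_prod, List.map_map] at this
    refine Eq.trans (congrArg List.prod (List.map_congr_left fun z _ => ?_)) this
    simp [Algebra.algebraMap_eq_smul_one]
  have hc := tendsto_zero_of_prod_eq_zero B B.charpoly.roots.toList (fun z hz => hA z ?_)
    (fun t k => (e t k : ℂ)) (fun t ht => ?_) (fun t _ => by rw [hzero, Matrix.zero_mulVec])
  · rw [tendsto_pi_nhds] at hc ⊢
    intro k
    exact (Complex.continuous_re.tendsto' 0 0 rfl).comp (hc k)
  · rw [Multiset.mem_toList, Polynomial.mem_roots B.charpoly_monic.ne_zero] at hz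
    exact Matrix.mem_spectrum_of_isRoot_charpoly hz
  · refine hasDerivWithinAt_pi.2 fun k => ?_
    refine ((hasDerivWithinAt_pi.1 (he t ht) k).ofReal_comp).congr_deriv ?_
    simp [hB, Matrix.mulVec, dotProduct]

theorem exists_linear_solution {ι : Type*} [Fintype ι] [DecidableEq ι] (A : Matrix ι ι ℝ)
    (e₀ : ι → ℝ) : ∃ e : ℝ → ι → ℝ, e 0 = e₀ ∧ ∀ t, HasDerivAt e (A *ᵥ e t) t := by
  let L : (ι → ℝ) →L[ℝ] (ι → ℝ) := LinearMap.toContinuousLinearMap (Matrix.mulVecLin A)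
  refine ⟨fun t => NormedSpace.exp (t • L) e₀, by simp, fun t => ?_⟩
  have h := (hasDerivAt_exp_smul_const' (𝕂 := ℝ) L t)
  exact (ContinuousLinearMap.apply ℝ (ι → ℝ) e₀).hasFDerivAt.comp_hasDerivAt t h

/-! ### Global existence from a priori bounds -/

/-- Bootstrapping: at a first exit time from `O` all earlier values lie in the closed set `C`, hence
so does the exit value, which is then still in `O`. An a priori bound thus need only be proved for
trajectories that have not yet left `O`. -/
theorem mem_of_mem_until {X : Type*} [TopologicalSpace X] {Y : ℝ → X} {C O : Set X} {T : ℝ}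
    (hC : IsClosed C) (hO : IsOpen O) (hCO : C ⊆ O)
    (hY : ContinuousOn Y (Icc 0 T)) (h0 : Y 0 ∈ O)
    (h : ∀ τ ∈ Ioc 0 T, (∀ t ∈ Ico 0 τ, Y t ∈ O) → ∀ t ∈ Ico 0 τ, Y t ∈ C) :
    ∀ t ∈ Icc 0 T, Y t ∈ O := by
  by_contra! hcon
  have hbad : IsCompact (Icc 0 T ∩ Y ⁻¹' Oᶜ) :=
    isCompact_Icc.of_isClosed_subset
      (hY.preimage_isClosed_of_isClosed isClosed_Icc hO.isClosed_compl) inter_subset_left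
  obtain ⟨t₁, ht₁, hY₁⟩ := hcon
  obtain ⟨τ, ⟨hτ, hτO⟩, hmin⟩ := hbad.exists_isLeast ⟨t₁, ht₁, hY₁⟩
  have hτ0 : 0 < τ := hτ.1.lt_of_ne (by rintro rfl; exact hτO h0)
  have hin : ∀ t ∈ Ico 0 τ, Y t ∈ C := h τ ⟨hτ0, hτ.2⟩ fun t ht => by
    by_contra hn
    exact (hmin ⟨⟨ht.1, ht.2.le.trans hτ.2⟩, hn⟩).not_gt ht.2
  refine hτO (hCO ?_)
  have hcont : ContinuousWithinAt Y (Ico 0 τ) τ :=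
    (hY τ hτ).mono fun t ht => ⟨ht.1, ht.2.le.trans hτ.2⟩
  have hcl : τ ∈ closure (Ico 0 τ) := by
    rw [closure_Ico hτ0.ne]; exact ⟨hτ0.le, le_rfl⟩
  have := hcont.mem_closure hcl hin
  rwa [hC.closure_eq] at this

section Existence

variable {E E' : Type*} [NormedAddCommGroup E] [NormedSpace ℝ E] [FiniteDimensional ℝ E]
  [NormedAddCommGroup E'] [NormedSpace ℝ E']

/-- Multiplication by a bump function that is `1` near `C` and vanishes outside a compact subset of
`U`. The truncated field is bounded and globally Lipschitz. -/
theorem exists_compactlySupported_eq_near {F : E → E'} {U C : Set E}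
    (hU : IsOpen U) (hF : ContDiffOn ℝ 1 F U) (hC : IsCompact C) (hCU : C ⊆ U) :
    ∃ G : E → E', ContDiff ℝ 1 G ∧ HasCompactSupport G ∧
      ∃ O, IsOpen O ∧ C ⊆ O ∧ O ⊆ U ∧ ∀ x ∈ O, G x = F x := by
  obtain ⟨L, hL, hCL, hLU⟩ := exists_compact_between hC hU hCU
  obtain ⟨χ, hχ1, hχ0, -⟩ := exists_contMDiffMap_one_nhds_of_subset_interior (n := 1)
    (modelWithCornersSelf ℝ E) hC.isClosed hCL
  have hχ : ContDiff ℝ 1 χ := χ.contMDiff.contDiff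
  have hsupp : tsupport (fun x => χ x • F x) ⊆ L := by
    refine closure_minimal (fun x hx => ?_) hL.isClosed
    by_contra hn
    exact hx (by simp [hχ0 x hn])
  obtain ⟨O, hO, hCO, hO1⟩ := eventually_nhdsSet_iff_exists.1 hχ1
  refine ⟨fun x => χ x • F x, contDiff_iff_contDiffAt.2 fun x => ?_,
    hL.of_isClosed_subset (isClosed_tsupport _) hsupp, O ∩ U, hO.inter hU,
    subset_inter hCO hCU, inter_subset_right, fun x hx => by simp [hO1 x hx.1]⟩
  by_cases hx : x ∈ U
  · exact hχ.contDiffAt.smul (hF.contDiffAt (hU.mem_nhds hx))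
  · have hx' : x ∈ (tsupport fun x => χ x • F x)ᶜ := fun h => hx (hLU (hsupp h))
    have hev : (fun x => χ x • F x) =ᶠ[𝓝 x] fun _ => 0 := by
      filter_upwards [(isClosed_tsupport _).isOpen_compl.mem_nhds hx'] with y hy
      exact image_eq_zero_of_notMem_tsupport (f := fun x => χ x • F x) hy
    exact contDiffAt_const.congr_of_eventuallyEq hev

theorem exists_solution_of_compactSupport {G : E' × E → E} (hG : ContDiff ℝ 1 G)
    (hGc : HasCompactSupport G) {p : ℝ → E'} {T : ℝ} (hT : 0 ≤ T)
    (hp : ContinuousOn p (Icc 0 T)) (y₀ : E) :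
    ∃ y : ℝ → E, y 0 = y₀ ∧
      ∀ t ∈ Icc 0 T, HasDerivWithinAt y (G (p t, y t)) (Icc 0 T) t := by
  obtain ⟨k, hk⟩ := ContDiff.lipschitzWith_of_hasCompactSupport hGc hG one_ne_zero
  obtain ⟨B, hB⟩ := hGc.exists_bound_of_continuous hG.continuous
  have hB0 : 0 ≤ B := (norm_nonneg _).trans (hB 0)
  -- A field bounded by `B` moves a point by at most `B * T`; with this radius one application of
  -- Picard–Lindelöf covers all of `[0, T]`.
  have hPL : IsPicardLindelof (fun t y => G (p t, y)) (tmin := 0) (tmax := T)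
      ⟨0, ⟨le_rfl, hT⟩⟩ y₀ ⟨B * T, by positivity⟩ 0 ⟨B, hB0⟩ k := by
    refine ⟨fun t _ => ?_, fun x _ => ?_, fun t _ x _ => hB _, ?_⟩
    · have := hk.comp (LipschitzWith.prodMk_left (β := E) (p t))
      rw [mul_one] at this
      exact this.lipschitzOnWith
    · exact hG.continuous.comp_continuousOn (hp.prodMk continuousOn_const)
    · simp [hT]
      rfl
  exact hPL.exists_eq_forall_mem_Icc_hasDerivWithinAt₀

/-- If the solutions of `ẏ = F (p t, y)` that start at `y₀` and run in the open set `U` stay, on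
bounded time intervals, in compact subsets of `U`, then there is a solution on `[0, ∞)`. -/
theorem exists_global_solution [FiniteDimensional ℝ E'] {F : E' × E → E} {U : Set E} (hU : IsOpen U)
    (hF : ContDiffOn ℝ 1 F (univ ×ˢ U)) {p : ℝ → E'} (hp : ContinuousOn p (Ici 0)) {y₀ : E}
    (hy₀ : y₀ ∈ U)
    (hK : ∀ T : ℝ, 0 < T → ∃ K ⊆ U, IsCompact K ∧ ∀ τ ∈ Ioc 0 T, ∀ y : ℝ → E, y 0 = y₀ →
      (∀ t ∈ Ico 0 τ, y t ∈ U ∧ HasDerivWithinAt y (F (p t, y t)) (Ici 0) t) →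
      ∀ t ∈ Ico 0 τ, y t ∈ K) :
    ∃ y : ℝ → E, y 0 = y₀ ∧
      ∀ t, 0 ≤ t → y t ∈ U ∧ HasDerivWithinAt y (F (p t, y t)) (Ici 0) t := by
  -- The last clause is uniqueness in the form needed for gluing. The length `n + 1` makes `t < ⌊t⌋₊
  -- + 1`, so that the piece with index `⌊t⌋₊` solves the equation around `t`.
  have hloc : ∀ n : ℕ, ∃ y : ℝ → E, y 0 = y₀ ∧
      (∀ t ∈ Ico (0 : ℝ) (n + 1), y t ∈ U ∧ HasDerivWithinAt y (F (p t, y t)) (Ici 0) t) ∧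
      ∀ z : ℝ → E, z 0 = y₀ → ∀ T' : ℝ, (n : ℝ) + 1 ≤ T' →
      (∀ t ∈ Ico (0 : ℝ) T', z t ∈ U ∧ HasDerivWithinAt z (F (p t, z t)) (Ici 0) t) →
      ∀ t ∈ Ico (0 : ℝ) (n + 1), z t = y t := by
    intro n
    set T : ℝ := n + 1 with hTdef
    have hT : 0 < T := by positivity
    have hpT : ContinuousOn p (Icc 0 T) := hp.mono fun t ht => ht.1
    obtain ⟨K, hKU, hKc, hKb⟩ := hK T hT
    have hCc : IsCompact ((Set.image p (Icc 0 T)) ×ˢ (insert y₀ K)) :=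
      (isCompact_Icc.image_of_continuousOn hpT).prod (hKc.insert y₀)
    obtain ⟨G, hG, hGc, O, hO, hCO, hOU, hGF⟩ := exists_compactlySupported_eq_near
      (isOpen_univ.prod hU) hF hCc (prod_mono (subset_univ _) (insert_subset hy₀ hKU))
    obtain ⟨y, hy0, hy⟩ := exists_solution_of_compactSupport hG hGc hT.le hpT y₀
    have hycont : ContinuousOn y (Icc 0 T) := fun t ht => (hy t ht).continuousWithinAt
    have hyd : ∀ t ∈ Ico 0 T, HasDerivWithinAt y (G (p t, y t)) (Ici 0) t := fun t ht =>
      (hy t ⟨ht.1, ht.2.le⟩).mono_of_mem_nhdsWithin (by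
        have := inter_mem_nhdsWithin (Ici (0 : ℝ)) (Iic_mem_nhds ht.2)
        rwa [Ici_inter_Iic] at this)
    -- The truncation is never felt: inside `O` the truncated solution solves the original equation,
    -- so the a priori bound keeps it in `K`.
    have hmem : ∀ t ∈ Icc 0 T, (p t, y t) ∈ O := by
      refine mem_of_mem_until hCc.isClosed hO hCO (hpT.prodMk hycont)
        (hCO ⟨mem_image_of_mem p ⟨le_rfl, hT.le⟩, by simp [hy0]⟩) fun τ hτ hin t ht => ?_
      refine ⟨mem_image_of_mem p ⟨ht.1, ht.2.le.trans hτ.2⟩, mem_insert_of_mem _ ?_⟩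
      refine hKb τ hτ y hy0 (fun s hs => ⟨(hOU (hin s hs)).2, ?_⟩) t ht
      rw [← hGF _ (hin s hs)]
      exact hyd s ⟨hs.1, hs.2.trans_le hτ.2⟩
    refine ⟨y, hy0, fun t ht => ?_, fun z hz0 T' hT' hz t ht => ?_⟩
    · have ht' := hmem t ⟨ht.1, ht.2.le⟩
      exact ⟨(hOU ht').2, by rw [← hGF _ ht']; exact hyd t ht⟩
    · obtain ⟨k, hk⟩ := ContDiff.lipschitzWith_of_hasCompactSupport hGc hG one_ne_zero
      have hzK := hKb T ⟨hT, le_rfl⟩ z hz0 fun s hs => hz s ⟨hs.1, hs.2.trans_le hT'⟩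
      have hsub : ∀ s ∈ Icc 0 t, s ∈ Ico 0 T := fun s hs => ⟨hs.1, hs.2.trans_lt ht.2⟩
      refine ODE_solution_unique_of_mem_Icc_right (v := fun t x => G (p t, x)) (K := k)
        (s := fun _ => univ) (a := 0) (b := t) (fun s _ => ?_)
        (fun s hs => (hz s ⟨hs.1, (hsub s hs).2.trans_le hT'⟩).2.continuousWithinAt.mono
          fun r hr => hr.1)
        (fun s hs => ?_) (fun _ _ => mem_univ _)
        (hycont.mono fun s hs => ⟨hs.1, (hsub s hs).2.le⟩)
        (fun s hs => (hyd s (hsub s ⟨hs.1, hs.2.le⟩)).mono (Ici_subset_Ici.2 hs.1))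
        (fun _ _ => mem_univ _) (hz0.trans hy0.symm) ⟨ht.1, le_rfl⟩
      · have := hk.comp (LipschitzWith.prodMk_left (β := E) (p s))
        rw [mul_one] at this
        exact this.lipschitzOnWith
      · have hs' := hsub s ⟨hs.1, hs.2.le⟩
        have hmemO : (p s, z s) ∈ O :=
          hCO ⟨mem_image_of_mem p ⟨hs'.1, hs'.2.le⟩, mem_insert_of_mem _ (hzK s hs')⟩
        rw [hGF _ hmemO]
        exact (hz s ⟨hs'.1, hs'.2.trans_le hT'⟩).2.mono (Ici_subset_Ici.2 hs.1)
  choose Y hY0 hY hYu using hloc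
  have hagree : ∀ (n m : ℕ), n ≤ m → ∀ t ∈ Ico (0 : ℝ) (n + 1), Y m t = Y n t := fun n m hnm =>
    hYu n (Y m) (hY0 m) (m + 1) (by gcongr) (hY m)
  have heq : ∀ n : ℕ, ∀ t ∈ Ico (0 : ℝ) (n + 1), Y ⌊t⌋₊ t = Y n t := by
    intro n t ht
    have hfl : ⌊t⌋₊ < n + 1 := (Nat.floor_lt ht.1).2 (by exact_mod_cast ht.2)
    exact (hagree ⌊t⌋₊ n (by omega) t ⟨ht.1, Nat.lt_floor_add_one t⟩).symm
  refine ⟨fun t => Y ⌊t⌋₊ t, by simp [hY0], fun t ht => ?_⟩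
  have htn : t ∈ Ico (0 : ℝ) (⌊t⌋₊ + 1) := ⟨ht, Nat.lt_floor_add_one t⟩
  refine ⟨(hY _ t htn).1, (hY _ t htn).2.congr_of_eventuallyEq ?_ rfl⟩
  filter_upwards [inter_mem_nhdsWithin (Ici (0 : ℝ)) (Iio_mem_nhds htn.2)] with s hs
  exact heq _ s ⟨hs.1, hs.2⟩

theorem exists_global_solution_of_linear_growth [FiniteDimensional ℝ E'] {F : E' × E → E}
    (hF : ContDiff ℝ 1 F)
    {p : ℝ → E'} (hp : ContinuousOn p (Ici 0))
    (hb : ∀ T : ℝ, 0 < T → ∃ c d : ℝ, 0 ≤ c ∧ 0 ≤ d ∧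
      ∀ t ∈ Icc 0 T, ∀ y, ‖F (p t, y)‖ ≤ c * ‖y‖ + d)
    (y₀ : E) :
    ∃ y : ℝ → E, y 0 = y₀ ∧ ∀ t, 0 ≤ t → HasDerivWithinAt y (F (p t, y t)) (Ici 0) t := by
  obtain ⟨y, hy0, hy⟩ := exists_global_solution isOpen_univ hF.contDiffOn hp (mem_univ y₀)
    fun T hT => by
      obtain ⟨c, d, hc, hd, hcd⟩ := hb T hT
      refine ⟨Metric.closedBall 0 (gronwallBound ‖y₀‖ c d T), subset_univ _,
        isCompact_closedBall _ _, fun τ hτ y hy0 hy t ht => ?_⟩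
      have := norm_le_gronwallBound_of_norm_deriv_right_le (f := y) (δ := ‖y₀‖) (K := c) (ε := d)
        (a := 0) (b := t) (f' := fun t => F (p t, y t))
        (fun s hs => (hy s ⟨hs.1, hs.2.trans_lt ht.2⟩).2.continuousWithinAt.mono fun r hr => hr.1)
        (fun s hs => (hy s ⟨hs.1, hs.2.trans ht.2⟩).2.mono (Ici_subset_Ici.2 hs.1))
        (by rw [hy0]) (fun s hs => hcd s ⟨hs.1, (hs.2.trans ht.2).le.trans hτ.2⟩ _) t ⟨ht.1, le_rfl⟩
      rw [mem_closedBall_zero_iff]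
      refine this.trans (gronwallBound_mono (norm_nonneg _) hd hc ?_)
      have := ht.2.le.trans hτ.2
      linarith
  exact ⟨y, hy0, fun t ht => (hy t ht).2⟩

end Existence

/-! ### The logarithmic barrier -/

section Barrier

variable {p₁ p₂ y : ℝ}

theorem logBarrier_eq (hp₁ : 0 < p₁) (hp₂ : 0 < p₂) (hy : y ∈ Ioo (-p₂) p₁) :
    logBarrier p₁ p₂ y = Real.log (p₂ + y) - Real.log p₂ - (Real.log (p₁ - y) - Real.log p₁) := by
  have h1 : 0 < p₂ + y := by linarith [hy.1]
  have h2 : 0 < p₁ - y := by linarith [hy.2]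
  rw [logBarrier, show p₁ * p₂ + p₁ * y = p₁ * (p₂ + y) by ring,
    show p₁ * p₂ - p₂ * y = p₂ * (p₁ - y) by ring, Real.log_div (by positivity) (by positivity),
    Real.log_mul hp₁.ne' h1.ne', Real.log_mul hp₂.ne' h2.ne']
  ring

theorem hasDerivAt_logBarrier (hp₁ : 0 < p₁) (hp₂ : 0 < p₂) (hy : y ∈ Ioo (-p₂) p₁) :
    HasDerivAt (logBarrier p₁ p₂) (1 / (p₂ + y) + 1 / (p₁ - y)) y := by
  have h1 : 0 < p₂ + y := by linarith [hy.1]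
  have h2 : 0 < p₁ - y := by linarith [hy.2]
  have := ((((hasDerivAt_id y).const_add p₂).log h1.ne').sub_const (Real.log p₂)).sub
    ((((hasDerivAt_id y).const_sub p₁).log h2.ne').sub_const (Real.log p₁))
  refine (this.congr_of_eventuallyEq ?_).congr_deriv (by simp; ring)
  filter_upwards [isOpen_Ioo.mem_nhds hy] with z hz
  simpa using logBarrier_eq hp₁ hp₂ hz

/-- Three derivatives are required: the head control contains partial derivatives of `beta1`, hence
second derivatives of the barriers, and the closed loop should be `C¹`. -/
theorem contDiffOn_logBarrier (hp₁ : 0 < p₁) (hp₂ : 0 < p₂) :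
    ContDiffOn ℝ 3 (logBarrier p₁ p₂) (Ioo (-p₂) p₁) := by
  have : ContDiffOn ℝ 3 (fun y => Real.log (p₂ + y) - Real.log p₂
      - (Real.log (p₁ - y) - Real.log p₁)) (Ioo (-p₂) p₁) := by
    refine ContDiffOn.sub
      (ContDiffOn.sub (ContDiffOn.log (by fun_prop) fun y hy => ?_) (by fun_prop))
      (ContDiffOn.sub (ContDiffOn.log (by fun_prop) fun y hy => ?_) (by fun_prop))
    · linarith [hy.1]
    · linarith [hy.2]
  exact this.congr fun y hy => logBarrier_eq hp₁ hp₂ hy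

/-- The derivative of `logBarrier ^ 2 / 2`. -/
def barrierForce (p₁ p₂ y : ℝ) : ℝ := logBarrier p₁ p₂ y * deriv (logBarrier p₁ p₂) y

theorem contDiffOn_barrierForce (hp₁ : 0 < p₁) (hp₂ : 0 < p₂) :
    ContDiffOn ℝ 2 (barrierForce p₁ p₂) (Ioo (-p₂) p₁) :=
  ((contDiffOn_logBarrier hp₁ hp₂).of_le (by norm_num)).mul
    ((contDiffOn_logBarrier hp₁ hp₂).deriv_of_isOpen isOpen_Ioo (by norm_num))

theorem contDiffOn_deriv_barrierForce (hp₁ : 0 < p₁) (hp₂ : 0 < p₂) :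
    ContDiffOn ℝ 1 (deriv (barrierForce p₁ p₂)) (Ioo (-p₂) p₁) :=
  (contDiffOn_barrierForce hp₁ hp₂).deriv_of_isOpen isOpen_Ioo (by norm_num)

theorem hasDerivAt_barrierForce (hp₁ : 0 < p₁) (hp₂ : 0 < p₂) (hy : y ∈ Ioo (-p₂) p₁) :
    HasDerivAt (barrierForce p₁ p₂) (deriv (barrierForce p₁ p₂) y) y :=
  ((((contDiffOn_barrierForce hp₁ hp₂).contDiffAt (isOpen_Ioo.mem_nhds hy)).differentiableAt
    (by norm_num))).hasDerivAt

theorem hasDerivAt_half_sq_logBarrier (hp₁ : 0 < p₁) (hp₂ : 0 < p₂) (hy : y ∈ Ioo (-p₂) p₁) :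
    HasDerivAt (fun y => logBarrier p₁ p₂ y ^ 2 / 2) (barrierForce p₁ p₂ y) y := by
  have h := hasDerivAt_logBarrier hp₁ hp₂ hy
  refine ((h.pow 2).div_const 2).congr_deriv ?_
  rw [barrierForce, h.deriv]
  ring

/-- Both bounds follow from `log t ≤ t - 1` and monotonicity of `log`. Negative arguments are
reduced to this case by the reflection `logBarrier_neg`. -/
theorem logBarrier_of_nonneg (hp₁ : 0 < p₁) (hp₂ : 0 < p₂) (hy : y ∈ Ioo (-p₂) p₁) (h0 : 0 ≤ y) :
    y / p₁ ≤ logBarrier p₁ p₂ y ∧ logBarrier p₁ p₂ y ≤ y / p₂ + y / (p₁ - y) := by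
  have h1 : 0 < p₂ + y := by linarith [hy.1]
  have h2 : 0 < p₁ - y := by linarith [hy.2]
  have a1 : Real.log (p₂ + y) - Real.log p₂ ≤ y / p₂ := by
    rw [← Real.log_div h1.ne' hp₂.ne']
    refine (Real.log_le_sub_one_of_pos (by positivity)).trans_eq ?_
    field_simp; ring
  have a2 : 0 ≤ Real.log (p₂ + y) - Real.log p₂ :=
    sub_nonneg.2 (Real.log_le_log hp₂ (by linarith))
  have a3 : Real.log p₁ - Real.log (p₁ - y) ≤ y / (p₁ - y) := by
    rw [← Real.log_div hp₁.ne' h2.ne']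
    refine (Real.log_le_sub_one_of_pos (by positivity)).trans_eq ?_
    field_simp; ring
  have a4 : Real.log (p₁ - y) - Real.log p₁ ≤ -(y / p₁) := by
    rw [← Real.log_div h2.ne' hp₁.ne']
    refine (Real.log_le_sub_one_of_pos (by positivity)).trans_eq ?_
    field_simp; ring
  rw [logBarrier_eq hp₁ hp₂ hy]
  constructor <;> linarith

theorem logBarrier_neg (hp₁ : 0 < p₁) (hp₂ : 0 < p₂) (hy : y ∈ Ioo (-p₂) p₁) :
    logBarrier p₂ p₁ (-y) = -logBarrier p₁ p₂ y := by
  rw [logBarrier_eq hp₁ hp₂ hy, logBarrier_eq hp₂ hp₁ ⟨by linarith [hy.2], by linarith [hy.1]⟩]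
  ring_nf

theorem sq_le_sq_logBarrier (hp₁ : 0 < p₁) (hp₂ : 0 < p₂) (hy : y ∈ Ioo (-p₂) p₁) :
    y ^ 2 ≤ (p₁ + p₂) ^ 2 * logBarrier p₁ p₂ y ^ 2 := by
  have key : ∀ {p₁ p₂ y : ℝ}, 0 < p₁ → 0 < p₂ → y ∈ Ioo (-p₂) p₁ → 0 ≤ y →
      y ^ 2 ≤ (p₁ + p₂) ^ 2 * logBarrier p₁ p₂ y ^ 2 := by
    intro p₁ p₂ y hp₁ hp₂ hy h0
    have h := (logBarrier_of_nonneg hp₁ hp₂ hy h0).1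
    rw [div_le_iff₀ hp₁] at h
    have hB : 0 ≤ logBarrier p₁ p₂ y := by
      by_contra! hn
      nlinarith
    rw [← mul_pow]
    exact pow_le_pow_left₀ h0 (by nlinarith) 2
  rcases le_total 0 y with h0 | h0
  · exact key hp₁ hp₂ hy h0
  · have := key hp₂ hp₁ (y := -y) ⟨by linarith [hy.2], by linarith [hy.1]⟩ (by linarith)
    rwa [logBarrier_neg hp₁ hp₂ hy, neg_sq, neg_sq, add_comm p₂] at this

theorem logBarrier_mul_nonneg (hp₁ : 0 < p₁) (hp₂ : 0 < p₂) (hy : y ∈ Ioo (-p₂) p₁) :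
    0 ≤ logBarrier p₁ p₂ y * y := by
  rcases le_total 0 y with h0 | h0
  · exact mul_nonneg ((div_nonneg h0 hp₁.le).trans (logBarrier_of_nonneg hp₁ hp₂ hy h0).1) h0
  · have := (logBarrier_of_nonneg hp₂ hp₁ (y := -y) ⟨by linarith [hy.2], by linarith [hy.1]⟩
      (by linarith)).1
    rw [logBarrier_neg hp₁ hp₂ hy] at this
    have h2 : 0 ≤ -y / p₂ := div_nonneg (by linarith) hp₂.le
    exact mul_nonneg_of_nonpos_of_nonpos (by linarith) h0

theorem barrierForce_mul_nonneg (hp₁ : 0 < p₁) (hp₂ : 0 < p₂) (hy : y ∈ Ioo (-p₂) p₁) :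
    0 ≤ barrierForce p₁ p₂ y * y := by
  have h1 : 0 < p₂ + y := by linarith [hy.1]
  have h2 : 0 < p₁ - y := by linarith [hy.2]
  rw [barrierForce, (hasDerivAt_logBarrier hp₁ hp₂ hy).deriv, mul_right_comm]
  exact mul_nonneg (logBarrier_mul_nonneg hp₁ hp₂ hy) (by positivity)

/-- This converts the damping produced by the barrier into decay of the barrier itself. For `y ≥ 0`
the slope term is `y / (p₂ + y) + y / (p₁ - y)`, while the barrier is at most `y / p₂ + y / (p₁ -
y)`; the singular parts agree, and `p₂ + y ≤ p₁ + p₂` handles the regular ones. -/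
theorem barrierForce_mul_ge (hp₁ : 0 < p₁) (hp₂ : 0 < p₂) (hy : y ∈ Ioo (-p₂) p₁) :
    min p₁ p₂ / (p₁ + p₂) * logBarrier p₁ p₂ y ^ 2 ≤ barrierForce p₁ p₂ y * y := by
  have key : ∀ {p₁ p₂ y : ℝ}, 0 < p₁ → 0 < p₂ → y ∈ Ioo (-p₂) p₁ → 0 ≤ y →
      min p₁ p₂ / (p₁ + p₂) * logBarrier p₁ p₂ y ≤ y * (1 / (p₂ + y) + 1 / (p₁ - y)) := by
    intro p₁ p₂ y hp₁ hp₂ hy h0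
    have h1 : 0 < p₂ + y := by linarith [hy.1]
    have h2 : 0 < p₁ - y := by linarith [hy.2]
    have hm : 0 < min p₁ p₂ := lt_min hp₁ hp₂
    calc min p₁ p₂ / (p₁ + p₂) * logBarrier p₁ p₂ y
        ≤ min p₁ p₂ / (p₁ + p₂) * (y / p₂ + y / (p₁ - y)) := by
          gcongr
          exact (logBarrier_of_nonneg hp₁ hp₂ hy h0).2
      _ = min p₁ p₂ / (p₁ + p₂) * (y / p₂) + min p₁ p₂ / (p₁ + p₂) * (y / (p₁ - y)) := by ring
      _ ≤ p₂ / (p₁ + p₂) * (y / p₂) + 1 * (y / (p₁ - y)) := by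
          have hle : min p₁ p₂ / (p₁ + p₂) ≤ 1 := by
            rw [div_le_one (by positivity)]
            linarith [min_le_left p₁ p₂]
          gcongr
          exact min_le_right _ _
      _ = y / (p₁ + p₂) + y / (p₁ - y) := by field_simp
      _ ≤ y / (p₂ + y) + y / (p₁ - y) := by
          have : y / (p₁ + p₂) ≤ y / (p₂ + y) :=
            div_le_div_of_nonneg_left h0 h1 (by linarith [hy.2])
          linarith
      _ = y * (1 / (p₂ + y) + 1 / (p₁ - y)) := by ring
  rw [barrierForce, (hasDerivAt_logBarrier hp₁ hp₂ hy).deriv, sq]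
  rcases le_total 0 y with h0 | h0
  · have hB := (div_nonneg h0 hp₁.le).trans (logBarrier_of_nonneg hp₁ hp₂ hy h0).1
    have := mul_le_mul_of_nonneg_left (key hp₁ hp₂ hy h0) hB
    linarith
  · have hy' : -y ∈ Ioo (-p₁) p₂ := ⟨by linarith [hy.2], by linarith [hy.1]⟩
    have h0' : 0 ≤ -y := by linarith
    have hB := (div_nonneg h0' hp₂.le).trans (logBarrier_of_nonneg hp₂ hp₁ hy' h0').1
    have := mul_le_mul_of_nonneg_left (key hp₂ hp₁ hy' h0') hB
    rw [logBarrier_neg hp₁ hp₂ hy, min_comm, add_comm p₂ p₁, sub_neg_eq_add,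
      ← sub_eq_add_neg] at this
    linarith

theorem mem_Icc_of_sq_logBarrier_le (hp₁ : 0 < p₁) (hp₂ : 0 < p₂) (A : ℝ) :
    ∃ η > 0, ∀ y ∈ Ioo (-p₂) p₁, logBarrier p₁ p₂ y ^ 2 ≤ A →
      y ∈ Icc (-p₂ + η) (p₁ - η) := by
  have key : ∀ {p₁ p₂ : ℝ}, 0 < p₁ → 0 < p₂ → ∃ η > 0, ∀ y ∈ Ioo (-p₂) p₁,
      logBarrier p₁ p₂ y ^ 2 ≤ A → y ≤ p₁ - η := by
    intro p₁ p₂ hp₁ hp₂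
    -- For `y ≥ 0`, `log p₁ - log (p₁ - y)` is at most the barrier, which is at most `|A| + 1`;
    -- exponentiating gives the second entry of the minimum. The first entry covers `y ≤ 0`.
    refine ⟨min p₁ (p₁ * Real.exp (-(|A| + 1))), by positivity, fun y hy hA => ?_⟩
    have h1 : 0 < p₂ + y := by linarith [hy.1]
    have h2 : 0 < p₁ - y := by linarith [hy.2]
    rcases le_total y 0 with h0 | h0
    · linarith [min_le_left p₁ (p₁ * Real.exp (-(|A| + 1)))]
    · have hB : logBarrier p₁ p₂ y ≤ |A| + 1 := by
        nlinarith [le_abs_self A, sq_nonneg (logBarrier p₁ p₂ y - 1), abs_nonneg A]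
      rw [logBarrier_eq hp₁ hp₂ hy] at hB
      have a2 : 0 ≤ Real.log (p₂ + y) - Real.log p₂ :=
        sub_nonneg.2 (Real.log_le_log hp₂ (by linarith))
      have hlog : Real.log (p₁ * Real.exp (-(|A| + 1))) ≤ Real.log (p₁ - y) := by
        rw [Real.log_mul hp₁.ne' (Real.exp_pos _).ne', Real.log_exp]
        linarith
      have := (Real.log_le_log_iff (by positivity) h2).1 hlog
      linarith [min_le_right p₁ (p₁ * Real.exp (-(|A| + 1)))]
  obtain ⟨η₁, hη₁, h₁⟩ := key hp₁ hp₂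
  obtain ⟨η₂, hη₂, h₂⟩ := key hp₂ hp₁
  refine ⟨min η₁ η₂, lt_min hη₁ hη₂, fun y hy hA => ⟨?_, ?_⟩⟩
  · have := h₂ (-y) ⟨by linarith [hy.2], by linarith [hy.1]⟩
      (by rwa [logBarrier_neg hp₁ hp₂ hy, neg_sq])
    linarith [min_le_right η₁ η₂]
  · linarith [h₁ y hy hA, min_le_left η₁ η₂]

end Barrier

/-! ### The error system of a head carriage -/

section HeadSystem

variable {P : Plant} {D : Spec} {K : Gains P} {i : ℕ}

/-- The conditions on the specification and the gains of the head of train `i`. -/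
structure HeadGains (D : Spec) (K : Gains P) (i : ℕ) : Prop where
  rho₁ : 0 < D.ρ₁
  rho₂ : 0 < D.ρ₂
  varrho₁ : 0 < varrho₁ D K i
  varrho₂ : 0 < varrho₂ D K i
  ell₁ : 0 < K.ell₁ i
  ell₂ : 1 ≤ K.ell₂ i
  ell₃ : 0 < K.ell₃ i
  ell₄ : 1 / 2 ≤ K.ell₄ i

/-- The set of `(xTilde, vTilde, whTilde)` that satisfy the constraints. -/
def headRegion (D : Spec) (K : Gains P) (i : ℕ) : Set (ℝ × ℝ × ℝ) :=
  {y | y.1 ∈ Ioo (-D.ρ₂) D.ρ₁ ∧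
    y.2.1 + K.ell₁ i * y.1 ∈ Ioo (-varrho₂ D K i) (varrho₁ D K i)}

theorem isOpen_headRegion : IsOpen (headRegion D K i) := by
  have h1 : Continuous fun y : ℝ × ℝ × ℝ => y.1 := by fun_prop
  have h2 : Continuous fun y : ℝ × ℝ × ℝ => y.2.1 + K.ell₁ i * y.1 := by fun_prop
  exact (isOpen_Ioo.preimage h1).inter (isOpen_Ioo.preimage h2)

/-- Since `v = q - ℓ₁ x`, the shifts `ℓ₁ ρ₂` and `ℓ₁ ρ₁` built into `varrho₁` and `varrho₂` are
exactly what `x` can contribute. -/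
theorem HeadGains.velocity_mem (H : HeadGains D K i) {x v w : ℝ}
    (h : (x, v, w) ∈ headRegion D K i) :
    -D.σ₂ < v ∧ v < D.σ₁ := by
  obtain ⟨⟨h1, h2⟩, h3, h4⟩ := h
  simp only [TrainCruise.varrho₁, TrainCruise.varrho₂] at h1 h2 h3 h4
  have h5 := mul_pos H.ell₁ (sub_pos.2 h1)
  have h6 := mul_pos H.ell₁ (sub_pos.2 h2)
  constructor <;> linarith

theorem beta1_eq (x v : ℝ) : beta1 D K i x v = -barrierForce D.ρ₁ D.ρ₂ x
    - K.ell₂ i * (v + K.ell₁ i * x)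
    - K.ell₃ i * barrierForce (varrho₁ D K i) (varrho₂ D K i) (v + K.ell₁ i * x) := rfl

/-- The slope of `barrierForce` at the filtered velocity error. -/
def qSlope (D : Spec) (K : Gains P) (i : ℕ) (x v : ℝ) : ℝ :=
  deriv (barrierForce (varrho₁ D K i) (varrho₂ D K i)) (v + K.ell₁ i * x)

theorem HeadGains.hasDerivWithinAt_beta1 (H : HeadGains D K i) {X V : ℝ → ℝ} {x' v' t w : ℝ}
    {s : Set ℝ} (h : (X t, V t, w) ∈ headRegion D K i) (hX : HasDerivWithinAt X x' s t)
    (hV : HasDerivWithinAt V v' s t) :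
    HasDerivWithinAt (fun τ => beta1 D K i (X τ) (V τ))
      (-(deriv (barrierForce D.ρ₁ D.ρ₂) (X t) * x') - K.ell₂ i * (v' + K.ell₁ i * x')
        - K.ell₃ i * (qSlope D K i (X t) (V t) * (v' + K.ell₁ i * x'))) s t := by
  have hq := hV.add (hX.const_mul (K.ell₁ i))
  have h1 := (hasDerivAt_barrierForce H.rho₁ H.rho₂ h.1).comp_hasDerivWithinAt t hX
  have h2 := (hasDerivAt_barrierForce H.varrho₁ H.varrho₂ h.2).comp_hasDerivWithinAt t hq
  exact (h1.neg.sub (hq.const_mul _)).sub (h2.const_mul _)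

theorem HeadGains.deriv_beta1_left (H : HeadGains D K i) {x v w : ℝ}
    (h : (x, v, w) ∈ headRegion D K i) :
    deriv (fun y => beta1 D K i y v) x =
      -deriv (barrierForce D.ρ₁ D.ρ₂) x - K.ell₂ i * K.ell₁ i
        - K.ell₃ i * (qSlope D K i x v * K.ell₁ i) := by
  have := H.hasDerivWithinAt_beta1 (X := fun y => y) (V := fun _ => v) (s := univ) (t := x) (w := w)
    h (hasDerivWithinAt_id _ _) (hasDerivWithinAt_const _ _ _)
  rw [hasDerivWithinAt_univ] at this
  rw [this.deriv]
  ring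

theorem HeadGains.deriv_beta1_right (H : HeadGains D K i) {x v w : ℝ}
    (h : (x, v, w) ∈ headRegion D K i) :
    deriv (fun y => beta1 D K i x y) v = -K.ell₂ i - K.ell₃ i * qSlope D K i x v := by
  have := H.hasDerivWithinAt_beta1 (X := fun _ => x) (V := fun y => y) (s := univ) (t := v) (w := w)
    h (hasDerivWithinAt_const _ _ _) (hasDerivWithinAt_id _ _)
  rw [hasDerivWithinAt_univ] at this
  rw [this.deriv]
  ring

/-- The derivative of `whTilde` along the closed loop. -/
def headRhs (D : Spec) (K : Gains P) (i : ℕ) (xt vt wt : ℝ) : ℝ :=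
  let b2 := beta2 D K i xt vt wt
  let dx := deriv (fun y => beta1 D K i y vt) xt
  let dv := deriv (fun y => beta1 D K i xt y) vt;
  -(K.ell₁ i * wt + K.ell₁ i ^ 2 * b2 - dx * vt - dv * wt + dv ^ 2 * b2 + (vt + K.ell₁ i * xt)
    + K.ell₄ i * b2)

/-- `(xTilde, vTilde, whTilde)` solves the error system with disturbance `δ`, at time `t`. -/
structure IsHeadTrajectoryAt (D : Spec) (K : Gains P) (i : ℕ) (X V W δ : ℝ → ℝ) (t : ℝ) : Prop where
  x : HasDerivWithinAt X (V t) (Ici 0) t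
  v : HasDerivWithinAt V (W t + δ t) (Ici 0) t
  w : HasDerivWithinAt W (headRhs D K i (X t) (V t) (W t)) (Ici 0) t

/-- The Lyapunov function of the head error system. -/
def headEnergy (D : Spec) (K : Gains P) (i : ℕ) (x v w : ℝ) : ℝ :=
  phi D x ^ 2 / 2 + (v + K.ell₁ i * x) ^ 2 / 2 + beta2 D K i x v w ^ 2 / 2

/-- The decay rate of `headEnergy`. -/
def headRate (D : Spec) (K : Gains P) (i : ℕ) : ℝ :=
  min (2 * (K.ell₁ i * (min D.ρ₁ D.ρ₂ / (D.ρ₁ + D.ρ₂)))) 1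

theorem HeadGains.headRate_pos (H : HeadGains D K i) : 0 < headRate D K i := by
  have h1 := H.rho₁
  have h2 := H.rho₂
  have h3 := H.ell₁
  have h4 : 0 < min D.ρ₁ D.ρ₂ := lt_min h1 h2
  unfold headRate
  exact lt_min (by positivity) one_pos

theorem headEnergy_nonneg (x v w : ℝ) : 0 ≤ headEnergy D K i x v w := by
  unfold headEnergy; positivity

/-- With `f`, `g` the barrier forces of `x` and `q`, and `b = beta2`, one has `v = q - ℓ₁ x` and `w
+ ℓ₁ v = b - f - ℓ₂ q - ℓ₃ g`. The products `f q` and `q b` cancel between the three summands, and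
`ℓ₃ g q ≥ 0` is dropped. The disturbance enters through `q`, `ℓ₁ b` and `(∂beta1/∂v) b`; the control
terms with `ℓ₁²` and `(∂beta1/∂v)²` absorb the last two by Young's inequality, at a total cost of
`δ²`. -/
theorem HeadGains.hasDerivWithinAt_energy (H : HeadGains D K i) {X V W δ : ℝ → ℝ} {t : ℝ}
    (h : (X t, V t, W t) ∈ headRegion D K i) (hd : IsHeadTrajectoryAt D K i X V W δ t) :
    ∃ e', HasDerivWithinAt (fun τ => headEnergy D K i (X τ) (V τ) (W τ)) e' (Ici 0) t ∧
      e' ≤ -headRate D K i * headEnergy D K i (X t) (V t) (W t) + δ t ^ 2 := by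
  have hq := hd.v.add (hd.x.const_mul (K.ell₁ i))
  have h1 := (hasDerivAt_half_sq_logBarrier H.rho₁ H.rho₂ h.1).comp_hasDerivWithinAt t hd.x
  have h2 := (hq.pow 2).div_const 2
  have h3 := (((hd.w.add (hd.v.const_mul (K.ell₁ i))).sub
    (H.hasDerivWithinAt_beta1 h hd.x hd.v)).pow 2).div_const 2
  refine ⟨_, (h1.add h2).add h3, ?_⟩
  have e1 := barrierForce_mul_ge H.rho₁ H.rho₂ h.1
  have e2 := barrierForce_mul_nonneg H.varrho₁ H.varrho₂ h.2
  simp only [Pi.add_apply, Pi.sub_apply, headRhs, H.deriv_beta1_left h, H.deriv_beta1_right h,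
    Nat.cast_ofNat, Nat.add_one_sub_one, pow_one]
  change _ ≤ -headRate D K i * (logBarrier D.ρ₁ D.ρ₂ (X t) ^ 2 / 2 + _ + _) + _
  have hb : W t + K.ell₁ i * V t - beta1 D K i (X t) (V t) = beta2 D K i (X t) (V t) (W t) := rfl
  have hβ := beta1_eq (D := D) (K := K) (i := i) (X t) (V t)
  have hW : W t = beta2 D K i (X t) (V t) (W t) - K.ell₁ i * V t + beta1 D K i (X t) (V t) := by
    linarith
  rw [hβ] at hW
  rw [hb]
  have r1 : headRate D K i ≤ 2 * (K.ell₁ i * (min D.ρ₁ D.ρ₂ / (D.ρ₁ + D.ρ₂))) := min_le_left _ _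
  have r2 : headRate D K i ≤ 1 := min_le_right _ _
  have hl1 := H.ell₁
  have hl2 := H.ell₂
  have hl3 := H.ell₃
  have hl4 := H.ell₄
  generalize beta2 D K i (X t) (V t) (W t) = b at *
  generalize qSlope D K i (X t) (V t) = q2 at *
  generalize deriv (barrierForce D.ρ₁ D.ρ₂) (X t) = f2 at *
  generalize hx : X t = x at *
  generalize V t = v at *
  generalize δ t = d at *
  generalize W t = w at *
  obtain ⟨q, rfl⟩ : ∃ q, v = q - K.ell₁ i * x := ⟨v + K.ell₁ i * x, by ring⟩
  simp only [sub_add_cancel] at e2 hW ⊢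
  generalize barrierForce D.ρ₁ D.ρ₂ x = f at *
  generalize barrierForce (TrainCruise.varrho₁ D K i) (TrainCruise.varrho₂ D K i) q = g at *
  generalize logBarrier D.ρ₁ D.ρ₂ x = ph at *
  generalize min D.ρ₁ D.ρ₂ / (D.ρ₁ + D.ρ₂) = c0 at *
  generalize headRate D K i = c at *
  generalize K.ell₁ i = l1 at *
  generalize K.ell₂ i = l2 at *
  generalize K.ell₃ i = l3 at *
  generalize K.ell₄ i = l4 at *
  subst hW
  have A1 : c * (ph ^ 2 / 2) ≤ l1 * (f * x) := by
    have := mul_le_mul_of_nonneg_right r1 (show 0 ≤ ph ^ 2 / 2 by positivity)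
    have := mul_le_mul_of_nonneg_left e1 hl1.le
    linarith
  have A2 : c * (q ^ 2 / 2) ≤ (l2 - 1 / 2) * q ^ 2 := by
    nlinarith [mul_le_mul_of_nonneg_right r2 (sq_nonneg q), sq_nonneg q]
  have A3 : c * (b ^ 2 / 2) ≤ l4 * b ^ 2 := by
    nlinarith [mul_le_mul_of_nonneg_right r2 (sq_nonneg b), sq_nonneg b]
  have A4 : 0 ≤ l3 * (g * q) := mul_nonneg hl3.le e2
  -- This is `-∂beta1/∂v`, whose square multiplies `beta2` in the control.
  set m := l2 + l3 * q2 with hm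
  have A5 : q * d ≤ q ^ 2 / 2 + d ^ 2 / 2 := by linarith [sq_nonneg (q - d)]
  have A6 : b * l1 * d ≤ l1 ^ 2 * b ^ 2 + d ^ 2 / 4 := by linarith [sq_nonneg (l1 * b - d / 2)]
  have A7 : b * m * d ≤ m ^ 2 * b ^ 2 + d ^ 2 / 4 := by linarith [sq_nonneg (m * b - d / 2)]
  have hl3q : l3 * q2 = m - l2 := by linarith
  have hrw : ∀ z : ℝ, l3 * (q2 * z) = (m - l2) * z := fun z => by rw [← mul_assoc, hl3q]
  simp only [hrw, hl3q]
  linarith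

/-- The barrier of the filtered velocity error grows at a bounded rate. -/
theorem HeadGains.hasDerivWithinAt_psi (H : HeadGains D K i) {X V W δ : ℝ → ℝ} {t a : ℝ}
    (h : (X t, V t, W t) ∈ headRegion D K i) (hd : IsHeadTrajectoryAt D K i X V W δ t)
    (ha : |beta2 D K i (X t) (V t) (W t) + δ t - barrierForce D.ρ₁ D.ρ₂ (X t)
      - K.ell₂ i * (V t + K.ell₁ i * X t)| ≤ a) :
    ∃ e', HasDerivWithinAt (fun τ => psi D K i (V τ + K.ell₁ i * X τ) ^ 2 / 2) e' (Ici 0) t ∧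
      e' ≤ a ^ 2 / (4 * K.ell₃ i) := by
  have hq := hd.v.add (hd.x.const_mul (K.ell₁ i))
  have h1 := (hasDerivAt_half_sq_logBarrier H.varrho₁ H.varrho₂ h.2).comp_hasDerivWithinAt t hq
  refine ⟨_, h1, ?_⟩
  have hl3 := H.ell₃
  have hsq := sq_le_sq' (abs_le.1 ha).1 (abs_le.1 ha).2
  have hW : W t + δ t + K.ell₁ i * V t =
      beta2 D K i (X t) (V t) (W t) + δ t - barrierForce D.ρ₁ D.ρ₂ (X t)
        - K.ell₂ i * (V t + K.ell₁ i * X t)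
        - K.ell₃ i * barrierForce (TrainCruise.varrho₁ D K i) (TrainCruise.varrho₂ D K i)
          (V t + K.ell₁ i * X t) := by
    rw [beta2, beta1_eq]; ring
  change barrierForce (TrainCruise.varrho₁ D K i) (TrainCruise.varrho₂ D K i)
          (V t + K.ell₁ i * X t) * _ ≤ _
  rw [hW]
  generalize beta2 D K i (X t) (V t) (W t) + δ t - barrierForce D.ρ₁ D.ρ₂ (X t)
        - K.ell₂ i * (V t + K.ell₁ i * X t) = z at *
  generalize barrierForce (TrainCruise.varrho₁ D K i) (TrainCruise.varrho₂ D K i)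
          (V t + K.ell₁ i * X t) = g at *
  rw [le_div_iff₀ (by positivity)]
  -- Completing the square: `g * (z - ℓ₃ g) ≤ z² / (4 ℓ₃)`, so the barrier term dominates however
  -- large `g` is.
  nlinarith [sq_nonneg (2 * K.ell₃ i * g - z)]

theorem HeadGains.continuousOn_beta1 (H : HeadGains D K i) :
    ContinuousOn (fun y : ℝ × ℝ × ℝ => beta1 D K i y.1 y.2.1) (headRegion D K i) := by
  simp only [beta1_eq]
  refine ((ContinuousOn.neg ?_).sub (by fun_prop)).sub (ContinuousOn.mul (by fun_prop) ?_)
  · exact (contDiffOn_barrierForce H.rho₁ H.rho₂).continuousOn.comp (by fun_prop) fun y hy => hy.1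
  · exact (contDiffOn_barrierForce H.varrho₁ H.varrho₂).continuousOn.comp (by fun_prop)
      fun y hy => hy.2

/-- Trajectories of the head error system with bounded disturbance stay in a compact part of the
admissible region as long as they stay in that region. -/
theorem HeadGains.exists_compact (H : HeadGains D K i) (x₀ v₀ w₀ d T : ℝ) :
    ∃ S ⊆ headRegion D K i, IsCompact S ∧ ∀ τ ∈ Ioc 0 T, ∀ X V W δ : ℝ → ℝ,
      X 0 = x₀ → V 0 = v₀ → W 0 = w₀ →
      (∀ t ∈ Ico 0 τ, (X t, V t, W t) ∈ headRegion D K i ∧ |δ t| ≤ d ∧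
        IsHeadTrajectoryAt D K i X V W δ t) →
      ∀ t ∈ Ico 0 τ, (X t, V t, W t) ∈ S := by
  -- Bound for the energy up to time `T`: its decay is discarded and only the growth `δ² ≤ d²` is
  -- kept. It confines `x` away from the ends of its interval and bounds `q` and `beta2` by `√(2
  -- A)`.
  set A := headEnergy D K i x₀ v₀ w₀ + d ^ 2 * T with hA
  obtain ⟨η, hη, hφ⟩ := mem_Icc_of_sq_logBarrier_le H.rho₁ H.rho₂ (2 * A)
  have hIx : Icc (-D.ρ₂ + η) (D.ρ₁ - η) ⊆ Ioo (-D.ρ₂) D.ρ₁ := fun x hx =>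
    ⟨by linarith [hx.1], by linarith [hx.2]⟩
  obtain ⟨G, hG⟩ := isCompact_Icc.exists_bound_of_continuousOn
    ((contDiffOn_barrierForce H.rho₁ H.rho₂).continuousOn.mono hIx)
  set B := √(2 * A) with hB
  -- Bound for the drift `beta2 + δ - f - ℓ₂ q` in the equation of `q`; it yields the bound `A'` for
  -- `psi² / 2`.
  set a := B + d + G + K.ell₂ i * B with ha
  set A' := psi D K i (v₀ + K.ell₁ i * x₀) ^ 2 / 2 + a ^ 2 / (4 * K.ell₃ i) * T with hA'
  obtain ⟨η', hη', hψ⟩ := mem_Icc_of_sq_logBarrier_le H.varrho₁ H.varrho₂ (2 * A')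
  set S₀ : Set (ℝ × ℝ × ℝ) := Icc (-D.ρ₂ + η) (D.ρ₁ - η) ×ˢ
    (Icc (-TrainCruise.varrho₂ D K i + η') (TrainCruise.varrho₁ D K i - η') ×ˢ Icc (-B) B) with hS₀
  have hsub : ∀ y ∈ S₀, (y.1, y.2.1 - K.ell₁ i * y.1, (0 : ℝ)) ∈ headRegion D K i := by
    intro y hy
    refine ⟨hIx hy.1, ?_⟩
    simp only [sub_add_cancel]
    exact ⟨by linarith [hy.2.1.1], by linarith [hy.2.1.2]⟩
  -- The bounds form a box in the coordinates `(x, q, beta2)`; this map returns to `(x, v, w)`.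
  set f : ℝ × ℝ × ℝ → ℝ × ℝ × ℝ := fun y => (y.1, y.2.1 - K.ell₁ i * y.1,
    y.2.2 - K.ell₁ i * (y.2.1 - K.ell₁ i * y.1)
      + beta1 D K i y.1 (y.2.1 - K.ell₁ i * y.1)) with hf
  have hfc : ContinuousOn f S₀ := by
    have := H.continuousOn_beta1.comp (f := fun y : ℝ × ℝ × ℝ =>
      (y.1, y.2.1 - K.ell₁ i * y.1, (0 : ℝ))) (s := S₀) (by fun_prop) hsub
    refine ContinuousOn.prodMk (by fun_prop) (ContinuousOn.prodMk (by fun_prop) ?_)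
    exact ContinuousOn.add (by fun_prop) this
  refine ⟨Set.image f S₀, ?_,
    (isCompact_Icc.prod (isCompact_Icc.prod isCompact_Icc)).image_of_continuousOn hfc, ?_⟩
  · rintro _ ⟨y, hy, rfl⟩
    exact hsub y hy
  intro τ hτ X V W δ hX0 hV0 hW0 hd t ht
  have hd2 : ∀ s ∈ Ico 0 τ, δ s ^ 2 ≤ d ^ 2 := fun s hs =>
    sq_le_sq' (abs_le.1 (hd s hs).2.1).1 (abs_le.1 (hd s hs).2.1).2
  have hen : ∀ s ∈ Ico 0 τ, headEnergy D K i (X s) (V s) (W s) ≤ A := by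
    intro s hs
    choose! e' he' hle using fun s hs => H.hasDerivWithinAt_energy (hd s hs).1 (hd s hs).2.2
    have := le_add_mul_of_deriv_le he' (C := d ^ 2) (fun r hr => (hle r hr).trans (by
      have := mul_nonneg H.headRate_pos.le
        (headEnergy_nonneg (D := D) (K := K) (i := i) (X r) (V r) (W r))
      linarith [hd2 r hr])) s hs
    rw [hX0, hV0, hW0] at this
    have h2 : d ^ 2 * s ≤ d ^ 2 * T := by
      gcongr
      exact hs.2.le.trans hτ.2
    linarith
  have hparts : ∀ s ∈ Ico 0 τ, X s ∈ Icc (-D.ρ₂ + η) (D.ρ₁ - η) ∧ |V s + K.ell₁ i * X s| ≤ B ∧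
      |beta2 D K i (X s) (V s) (W s)| ≤ B := by
    intro s hs
    have h := hen s hs
    simp only [headEnergy] at h
    refine ⟨hφ _ (hd s hs).1.1 ?_, Real.abs_le_sqrt ?_, Real.abs_le_sqrt ?_⟩
    · change phi D (X s) ^ 2 ≤ _
      nlinarith [sq_nonneg (V s + K.ell₁ i * X s), sq_nonneg (beta2 D K i (X s) (V s) (W s))]
    · nlinarith [sq_nonneg (phi D (X s)), sq_nonneg (beta2 D K i (X s) (V s) (W s))]
    · nlinarith [sq_nonneg (V s + K.ell₁ i * X s), sq_nonneg (phi D (X s))]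
  have hψt : psi D K i (V t + K.ell₁ i * X t) ^ 2 / 2 ≤ A' := by
    have hab : ∀ s ∈ Ico 0 τ, |beta2 D K i (X s) (V s) (W s) + δ s - barrierForce D.ρ₁ D.ρ₂ (X s)
        - K.ell₂ i * (V s + K.ell₁ i * X s)| ≤ a := by
      intro s hs
      obtain ⟨h1, h2, h3⟩ := hparts s hs
      have h4 := hG _ h1
      have h5 := (hd s hs).2.1
      rw [Real.norm_eq_abs] at h4
      have h6 : |K.ell₂ i * (V s + K.ell₁ i * X s)| ≤ K.ell₂ i * B := by
        rw [abs_mul, abs_of_pos (one_pos.trans_le H.ell₂)]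
        exact mul_le_mul_of_nonneg_left h2 (zero_le_one.trans H.ell₂)
      rw [abs_le] at *
      constructor <;> linarith [h3.1, h3.2, h4.1, h4.2, h5.1, h5.2, h6.1, h6.2]
    choose! e' he' hle using fun s hs =>
      H.hasDerivWithinAt_psi (hd s hs).1 (hd s hs).2.2 (hab s hs)
    have := le_add_mul_of_deriv_le he' hle t ht
    rw [hX0, hV0] at this
    have hl3 := H.ell₃
    have h2 : a ^ 2 / (4 * K.ell₃ i) * t ≤ a ^ 2 / (4 * K.ell₃ i) * T := by
      gcongr
      exact ht.2.le.trans hτ.2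
    linarith
  obtain ⟨h1, h2, h3⟩ := hparts t ht
  refine ⟨(X t, V t + K.ell₁ i * X t, beta2 D K i (X t) (V t) (W t)), ⟨h1, ?_, abs_le.1 h3⟩, ?_⟩
  · refine hψ _ (hd t ht).1.2 ?_
    change psi D K i (V t + K.ell₁ i * X t) ^ 2 ≤ _
    linarith
  · simp only [hf, add_sub_cancel_right, beta2, Prod.mk.injEq, true_and]
    ring

end HeadSystem

/-! ### Invariance, convergence and global existence for the head error system -/

section HeadSystem

variable {P : Plant} {D : Spec} {K : Gains P} {i : ℕ}

theorem HeadGains.forall_mem_headRegion (H : HeadGains D K i) {X V W δ : ℝ → ℝ}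
    (h0 : (X 0, V 0, W 0) ∈ headRegion D K i) (hδ : ContinuousOn δ (Ici 0))
    (hd : ∀ t, 0 ≤ t → IsHeadTrajectoryAt D K i X V W δ t) :
    ∀ t, 0 ≤ t → (X t, V t, W t) ∈ headRegion D K i := by
  intro T hT
  have hsub : Icc 0 T ⊆ Ici (0 : ℝ) := fun t ht => ht.1
  obtain ⟨d, hdb⟩ := isCompact_Icc.exists_bound_of_continuousOn (hδ.mono hsub)
  obtain ⟨S, hSU, hSc, hS⟩ := H.exists_compact (X 0) (V 0) (W 0) d T
  refine mem_of_mem_until (Y := fun t => (X t, V t, W t)) hSc.isClosed isOpen_headRegion hSU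
    (fun t ht => ?_) h0 (fun τ hτ hin t ht => ?_) T ⟨hT, le_rfl⟩
  · have := hd t ht.1
    exact (this.x.continuousWithinAt.mono hsub).prodMk
      ((this.v.continuousWithinAt.mono hsub).prodMk (this.w.continuousWithinAt.mono hsub))
  · exact hS τ hτ X V W δ rfl rfl rfl (fun s hs => ⟨hin s hs,
      hdb s ⟨hs.1, hs.2.le.trans hτ.2⟩, hd s hs.1⟩) t ht

theorem HeadGains.tendsto_zero (H : HeadGains D K i) {X V W δ : ℝ → ℝ}
    (hmem : ∀ t, 0 ≤ t → (X t, V t, W t) ∈ headRegion D K i)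
    (hd : ∀ t, 0 ≤ t → IsHeadTrajectoryAt D K i X V W δ t) (hδ : Tendsto δ atTop (𝓝 0)) :
    Tendsto X atTop (𝓝 0) ∧ Tendsto V atTop (𝓝 0) := by
  choose! e' he' hle using fun t ht => H.hasDerivWithinAt_energy (hmem t ht) (hd t ht)
  have hE : Tendsto (fun t => headEnergy D K i (X t) (V t) (W t)) atTop (𝓝 0) := by
    refine tendsto_zero_of_deriv_le H.headRate_pos he' (fun t _ => headEnergy_nonneg _ _ _)
      ((eventually_ge_atTop 0).mono hle) ?_
    simpa using hδ.pow 2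
  have hX2 : Tendsto (fun t => X t ^ 2) atTop (𝓝 0) := by
    refine squeeze_zero' (Eventually.of_forall fun t => sq_nonneg _)
      (g := fun t => (D.ρ₁ + D.ρ₂) ^ 2 * (2 * headEnergy D K i (X t) (V t) (W t))) ?_
      (by simpa using (hE.const_mul 2).const_mul ((D.ρ₁ + D.ρ₂) ^ 2))
    filter_upwards [eventually_ge_atTop 0] with t ht
    refine (sq_le_sq_logBarrier H.rho₁ H.rho₂ (hmem t ht).1).trans ?_
    refine mul_le_mul_of_nonneg_left ?_ (sq_nonneg _)
    change phi D (X t) ^ 2 ≤ _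
    simp only [headEnergy]
    linarith [sq_nonneg (V t + K.ell₁ i * X t), sq_nonneg (beta2 D K i (X t) (V t) (W t))]
  have hQ2 : Tendsto (fun t => (V t + K.ell₁ i * X t) ^ 2) atTop (𝓝 0) := by
    refine squeeze_zero (fun t => sq_nonneg _)
      (g := fun t => 2 * headEnergy D K i (X t) (V t) (W t)) (fun t => ?_)
      (by simpa using hE.const_mul 2)
    simp only [headEnergy]
    linarith [sq_nonneg (phi D (X t)), sq_nonneg (beta2 D K i (X t) (V t) (W t))]
  have hX : Tendsto X atTop (𝓝 0) := tendsto_zero_of_sq hX2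
  have hQ : Tendsto (fun t => V t + K.ell₁ i * X t) atTop (𝓝 0) :=
    tendsto_zero_of_sq hQ2
  refine ⟨hX, ?_⟩
  simpa using hQ.sub (hX.const_mul (K.ell₁ i))

theorem HeadGains.contDiffOn_headRhs (H : HeadGains D K i) :
    ContDiffOn ℝ 1 (fun y : ℝ × ℝ × ℝ => headRhs D K i y.1 y.2.1 y.2.2) (headRegion D K i) := by
  have hf := (contDiffOn_barrierForce H.rho₁ H.rho₂).of_le (m := 1) (by norm_num)
  have hf' := contDiffOn_deriv_barrierForce H.rho₁ H.rho₂
  have hg := (contDiffOn_barrierForce H.varrho₁ H.varrho₂).of_le (m := 1) (by norm_num)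
  have hg' := contDiffOn_deriv_barrierForce H.varrho₁ H.varrho₂
  have c1 : ContDiffOn ℝ 1 (fun y : ℝ × ℝ × ℝ => barrierForce D.ρ₁ D.ρ₂ y.1) (headRegion D K i) :=
    hf.comp (by fun_prop) fun y hy => hy.1
  have c2 : ContDiffOn ℝ 1 (fun y : ℝ × ℝ × ℝ => deriv (barrierForce D.ρ₁ D.ρ₂) y.1)
    (headRegion D K i) := hf'.comp (by fun_prop) fun y hy => hy.1
  have c3 : ContDiffOn ℝ 1 (fun y : ℝ × ℝ × ℝ => barrierForce (TrainCruise.varrho₁ D K i)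
      (TrainCruise.varrho₂ D K i) (y.2.1 + K.ell₁ i * y.1)) (headRegion D K i) :=
    hg.comp (f := fun y : ℝ × ℝ × ℝ => y.2.1 + K.ell₁ i * y.1) (by fun_prop) fun y hy => hy.2
  have c4 : ContDiffOn ℝ 1 (fun y : ℝ × ℝ × ℝ => qSlope D K i y.1 y.2.1) (headRegion D K i) :=
    hg'.comp (f := fun y : ℝ × ℝ × ℝ => y.2.1 + K.ell₁ i * y.1) (by fun_prop) fun y hy => hy.2
  have b1 : ContDiffOn ℝ 1 (fun y : ℝ × ℝ × ℝ => beta1 D K i y.1 y.2.1) (headRegion D K i) := by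
    simp only [beta1_eq]
    fun_prop
  have b2 : ContDiffOn ℝ 1 (fun y : ℝ × ℝ × ℝ => beta2 D K i y.1 y.2.1 y.2.2)
      (headRegion D K i) := by
    simp only [beta2]
    fun_prop
  have dx : ContDiffOn ℝ 1 (fun y : ℝ × ℝ × ℝ => deriv (fun z => beta1 D K i z y.2.1) y.1)
      (headRegion D K i) :=
    ContDiffOn.congr (by fun_prop) fun y hy => H.deriv_beta1_left (w := y.2.2) hy
  have dv : ContDiffOn ℝ 1 (fun y : ℝ × ℝ × ℝ => deriv (fun z => beta1 D K i y.1 z) y.2.1)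
      (headRegion D K i) :=
    ContDiffOn.congr (by fun_prop) fun y hy => H.deriv_beta1_right (w := y.2.2) hy
  simp only [headRhs]
  fun_prop

/-- The disturbance is affine in `V` because acceleration errors are affine in the velocity. It is
bounded on bounded times, since `V` is confined by the constraints themselves. -/
theorem HeadGains.exists_trajectory (H : HeadGains D K i) {g h : ℝ → ℝ}
    (hg : ContinuousOn g (Ici 0)) (hh : ContinuousOn h (Ici 0)) {x₀ v₀ w₀ : ℝ}
    (h0 : (x₀, v₀, w₀) ∈ headRegion D K i) :
    ∃ X V W : ℝ → ℝ, X 0 = x₀ ∧ V 0 = v₀ ∧ W 0 = w₀ ∧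
      ∀ t, 0 ≤ t → IsHeadTrajectoryAt D K i X V W (fun t => g t + h t * V t) t := by
  let F : (ℝ × ℝ) × (ℝ × ℝ × ℝ) → ℝ × ℝ × ℝ := fun q =>
    (q.2.2.1, q.2.2.2 + (q.1.1 + q.1.2 * q.2.2.1), headRhs D K i q.2.1 q.2.2.1 q.2.2.2)
  have hF : ContDiffOn ℝ 1 F (univ ×ˢ headRegion D K i) := by
    have := H.contDiffOn_headRhs.comp (f := fun q : (ℝ × ℝ) × (ℝ × ℝ × ℝ) => q.2)
      (s := univ ×ˢ headRegion D K i) (by fun_prop) fun q hq => hq.2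
    exact ContDiffOn.prodMk (by fun_prop) (ContDiffOn.prodMk (by fun_prop) this)
  have hcomp : ∀ (y : ℝ → ℝ × ℝ × ℝ) (t : ℝ),
      HasDerivWithinAt y (F ((g t, h t), y t)) (Ici 0) t →
      IsHeadTrajectoryAt D K i (fun t => (y t).1) (fun t => (y t).2.1) (fun t => (y t).2.2)
        (fun t => g t + h t * (y t).2.1) t := by
    intro y t hy
    have h1 := (ContinuousLinearMap.fst ℝ ℝ (ℝ × ℝ)).hasFDerivAt.comp_hasDerivWithinAt t hy
    have h2 := (ContinuousLinearMap.snd ℝ ℝ (ℝ × ℝ)).hasFDerivAt.comp_hasDerivWithinAt t hy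
    exact ⟨h1, (ContinuousLinearMap.fst ℝ ℝ ℝ).hasFDerivAt.comp_hasDerivWithinAt t h2,
      (ContinuousLinearMap.snd ℝ ℝ ℝ).hasFDerivAt.comp_hasDerivWithinAt t h2⟩
  obtain ⟨y, hy0, hy⟩ := exists_global_solution isOpen_headRegion hF
    (p := fun t => (g t, h t)) (hg.prodMk hh) h0 fun T hT => by
      have hsub : Icc 0 T ⊆ Ici (0 : ℝ) := fun t ht => ht.1
      obtain ⟨cg, hcg⟩ := isCompact_Icc.exists_bound_of_continuousOn (hg.mono hsub)
      obtain ⟨ch, hch⟩ := isCompact_Icc.exists_bound_of_continuousOn (hh.mono hsub)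
      obtain ⟨S, hSU, hSc, hS⟩ := H.exists_compact x₀ v₀ w₀ (cg + ch * (|D.σ₁| + |D.σ₂|)) T
      refine ⟨S, hSU, hSc, fun τ hτ y hy0 hy t ht => ?_⟩
      refine hS τ hτ (fun t => (y t).1) (fun t => (y t).2.1) (fun t => (y t).2.2)
        (fun t => g t + h t * (y t).2.1) (by simp [hy0]) (by simp [hy0]) (by simp [hy0])
        (fun s hs => ⟨(hy s hs).1, ?_, hcomp y s (hy s hs).2⟩) t ht
      have hv := H.velocity_mem (hy s hs).1
      have hs' : s ∈ Icc 0 T := ⟨hs.1, hs.2.le.trans hτ.2⟩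
      have hvb : |(y s).2.1| ≤ |D.σ₁| + |D.σ₂| := by
        rw [abs_le]
        constructor <;> linarith [hv.1, hv.2, le_abs_self D.σ₁, le_abs_self D.σ₂,
          abs_nonneg D.σ₁, abs_nonneg D.σ₂]
      have h1 := hcg s hs'
      have h2 := hch s hs'
      rw [Real.norm_eq_abs] at h1 h2
      calc |g s + h s * (y s).2.1| ≤ |g s| + |h s * (y s).2.1| := abs_add_le _ _
        _ = |g s| + |h s| * |(y s).2.1| := by rw [abs_mul]
        _ ≤ cg + ch * (|D.σ₁| + |D.σ₂|) := by
          have := (abs_nonneg _).trans h2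
          gcongr
  exact ⟨fun t => (y t).1, fun t => (y t).2.1, fun t => (y t).2.2, by simp [hy0], by simp [hy0],
    by simp [hy0], fun t ht => hcomp y t (hy t ht).2⟩

end HeadSystem

/-! ### The observer error -/

section Coefficients

variable (P : Plant) (i j : ℕ)

theorem Plant.D2_eq (v : ℝ) : P.D2 i j v = P.B2 i j * v := by
  unfold Plant.D2 Plant.B2; split_ifs <;> simp

theorem Plant.D3_eq (v : ℝ) : P.D3 i j v = P.B3 i j * v := by
  unfold Plant.D3 Plant.B3; split_ifs <;> simp

theorem Plant.B1_eq (v : ℝ) : P.B1 i j v = P.B1 i j 0 - 2 * P.c₂ * v := by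
  unfold Plant.B1; split_ifs <;> ring

theorem Plant.D1_sub (v e : ℝ) :
    P.D1 i j v - P.D1 i j (v + e) = -(e * P.B1 i j v) + P.c₂ * e ^ 2 := by
  unfold Plant.D1 Plant.B1; split_ifs <;> ring

theorem Plant.hasDerivAt_D1 (v : ℝ) : HasDerivAt (P.D1 i j) (P.B1 i j v) v := by
  have hlin : ∀ k : ℝ, HasDerivAt (fun v : ℝ => k * v - (P.c₁ * v + P.c₂ * v ^ 2) - P.r i j * v)
      (k - (P.c₁ + 2 * P.c₂ * v) - P.r i j) v := by
    intro k
    have h := hasDerivAt_id v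
    refine (((h.const_mul k).sub ((h.const_mul P.c₁).add ((h.pow 2).const_mul P.c₂))).sub
      (h.const_mul (P.r i j))).congr_deriv ?_
    simp
    ring
  unfold Plant.D1 Plant.B1
  split_ifs
  · exact hlin _
  · exact hlin _

end Coefficients

section Observer

variable {P : Plant} (K : Gains P)

/-- The velocity estimation error. -/
def velErr (s : State P) (i j : ℕ) : ℝ := s.vh i j - s.v i j

/-- The acceleration estimation error, corrected so that `(velErr, zeta, fh - f)` solves a linear
system with constant coefficients. -/
def zeta (s : State P) (i j : ℕ) : ℝ :=
  s.wh i j - s.w i j + (P.D1 i j (s.v i j) - P.D1 i j (s.vh i j))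
    - P.B2 i j * velErr s i (j - 1) - P.B3 i j * velErr s i (j + 1)

theorem mu2_eq (s : State P) (i j : ℕ) :
    mu2 K s i j = zeta s i j - (s.wh i j - s.w i j) + K.k₂ i j * velErr s i j := by
  simp only [mu2, zeta, velErr, Plant.D2_eq, Plant.D3_eq]
  ring

theorem xhRhs_eq (s : State P) (i j : ℕ) :
    xhRhs K s i j = s.v i j - K.k₁ i j * (s.xh i j - s.x i j) := by
  simp only [xhRhs, mu1]
  ring

theorem vhRhs_eq (s : State P) (i j : ℕ) :
    vhRhs K s i j = s.w i j + (zeta s i j + K.k₂ i j * velErr s i j) := by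
  rw [vhRhs, mu2_eq]
  ring

/-- The derivative of `zeta`, in terms of the right-hand sides of plant and observer. -/
theorem zetaRhs_eq (s : State P) (u : ℝ) (i j : ℕ) :
    whRhs K s u i j - wRhs s u i j + (P.B1 i j (s.v i j) * s.w i j
        - P.B1 i j (s.vh i j) * vhRhs K s i j)
      - P.B2 i j * (vhRhs K s i (j - 1) - s.w i (j - 1))
      - P.B3 i j * (vhRhs K s i (j + 1) - s.w i (j + 1)) =
    P.C i j ⬝ᵥ (s.fh i j - s.f i j) + K.k₃ i j * velErr s i j := by
  simp only [whRhs, wRhs, vhRhs, mu3, velErr, dotProduct_sub]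
  ring

theorem errorMatrix_mulVec (i j : ℕ) (a b : ℝ) (g : Fin (P.n i j) → ℝ) :
    (P.A i j + K.col i j * P.out i j) *ᵥ Sum.elim (fun _ => a) (Sum.elim (fun _ => b) g) =
      Sum.elim (fun _ => b + K.k₂ i j * a) (Sum.elim (fun _ => P.C i j ⬝ᵥ g + K.k₃ i j * a)
        (P.S i j *ᵥ g + a • K.k₄ i j)) := by
  ext (k | k | k) <;>
  simp [Matrix.mulVec, dotProduct, Plant.A, Gains.col, Plant.out, Matrix.mul_apply, mul_comm] <;>
  exact add_comm _ _

end Observer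

/-! ### Decay of the estimation errors along closed-loop solutions -/

section Solution

variable {P : Plant} {D : Spec} {K : Gains P} {R : Reference} {s : ℝ → State P}
  {u : ℝ → ℕ → ℕ → ℝ} {i j : ℕ}

theorem Plant.B2_eq_zero_or (hc : P.IsCarriage i j) : P.B2 i j = 0 ∨ P.IsCarriage i (j - 1) := by
  by_cases h : j = 1
  · exact Or.inl (by simp [Plant.B2, h])
  · obtain ⟨h1, h2, h3⟩ := hc
    exact Or.inr ⟨h1, by omega, by omega⟩

theorem Plant.B3_eq_zero_or (hc : P.IsCarriage i j) : P.B3 i j = 0 ∨ P.IsCarriage i (j + 1) := by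
  by_cases h : j = P.M i
  · exact Or.inl (by simp [Plant.B3, h])
  · obtain ⟨h1, h2, h3⟩ := hc
    exact Or.inr ⟨h1, by omega, by omega⟩

/-- Serves the missing neighbours of head and tail: nothing is known about their derivatives, but
their coefficient vanishes. -/
theorem hasDerivWithinAt_const_mul_of_eq_zero_or {b : ℝ} {Q : Prop} {f : ℝ → ℝ} {f' t : ℝ}
    {S : Set ℝ} (h : b = 0 ∨ Q) (hf : Q → HasDerivWithinAt f f' S t) :
    HasDerivWithinAt (fun τ => b * f τ) (b * f') S t := by
  rcases h with rfl | h
  · simpa using hasDerivWithinAt_const t S (0 : ℝ)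
  · exact (hf h).const_mul b

theorem tendsto_const_mul_of_eq_zero_or {b : ℝ} {Q : Prop} {f : ℝ → ℝ} (h : b = 0 ∨ Q)
    (hf : Q → Tendsto f atTop (𝓝 0)) : Tendsto (fun τ => b * f τ) atTop (𝓝 0) := by
  rcases h with rfl | h
  · simp
  · simpa using (hf h).const_mul b

theorem IsClosedLoopSolution.hasDerivWithinAt_velErr (hs : IsClosedLoopSolution D K R s u)
    (hc : P.IsCarriage i j) {t : ℝ} (ht : 0 ≤ t) :
    HasDerivWithinAt (fun τ => velErr (s τ) i j) (vhRhs K (s t) i j - (s t).w i j) (Ici 0) t :=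
  (hs.observer t ht i j hc).2.1.sub (hs.plant t ht i j hc).2.1

theorem IsClosedLoopSolution.hasDerivWithinAt_zeta (hs : IsClosedLoopSolution D K R s u)
    (hc : P.IsCarriage i j) {t : ℝ} (ht : 0 ≤ t) :
    HasDerivWithinAt (fun τ => zeta (s τ) i j)
      (P.C i j ⬝ᵥ ((s t).fh i j - (s t).f i j) + K.k₃ i j * velErr (s t) i j) (Ici 0) t := by
  obtain ⟨-, hv, hw, -⟩ := hs.plant t ht i j hc
  obtain ⟨-, hvh, hwh, -⟩ := hs.observer t ht i j hc
  have h2 := hasDerivWithinAt_const_mul_of_eq_zero_or (Plant.B2_eq_zero_or hc)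
    fun h => hs.hasDerivWithinAt_velErr h ht
  have h3 := hasDerivWithinAt_const_mul_of_eq_zero_or (Plant.B3_eq_zero_or hc)
    fun h => hs.hasDerivWithinAt_velErr h ht
  rw [← zetaRhs_eq K (s t) (u t i j)]
  exact (((hwh.sub hw).add (((P.hasDerivAt_D1 i j _).comp_hasDerivWithinAt t hv).sub
    ((P.hasDerivAt_D1 i j _).comp_hasDerivWithinAt t hvh))).sub h2).sub h3

theorem IsClosedLoopSolution.tendsto_posErr (hs : IsClosedLoopSolution D K R s u)
    (hc : P.IsCarriage i j) (hk : 0 < K.k₁ i j) :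
    Tendsto (fun t => (s t).xh i j - (s t).x i j) atTop (𝓝 0) := by
  refine tendsto_zero_of_sq (tendsto_zero_of_deriv_le (c := 2 * K.k₁ i j) (η := fun _ => 0)
    (by linarith) (fun t ht => (((hs.observer t ht i j hc).1.sub (hs.plant t ht i j hc).1).pow 2))
    (fun t _ => sq_nonneg _) (Eventually.of_forall fun t => le_of_eq ?_) tendsto_const_nhds)
  simp only [xhRhs_eq, Pi.sub_apply]
  push_cast
  ring

theorem IsClosedLoopSolution.tendsto_err (hs : IsClosedLoopSolution D K R s u)
    (hc : P.IsCarriage i j) (hK : IsHurwitz (P.A i j + K.col i j * P.out i j)) :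
    Tendsto (fun t => velErr (s t) i j) atTop (𝓝 0) ∧
      Tendsto (fun t => zeta (s t) i j) atTop (𝓝 0) := by
  have := hK.tendsto_zero (e := fun t => Sum.elim (fun _ => velErr (s t) i j)
    (Sum.elim (fun _ => zeta (s t) i j) ((s t).fh i j - (s t).f i j))) fun t ht => by
      rw [errorMatrix_mulVec]
      refine hasDerivWithinAt_pi.2 ?_
      rintro (k | k | k)
      · refine (hs.hasDerivWithinAt_velErr hc ht).congr_deriv ?_
        simp [vhRhs_eq]
      · exact hs.hasDerivWithinAt_zeta hc ht
      · have h := hasDerivWithinAt_pi.1 ((hs.observer t ht i j hc).2.2.2.sub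
          (hs.plant t ht i j hc).2.2.2) k
        refine h.congr_deriv ?_
        simp [fhRhs, mu4, velErr, Matrix.mulVec_sub]
        ring
  rw [tendsto_pi_nhds] at this
  exact ⟨this (Sum.inl ()), this (Sum.inr (Sum.inl ()))⟩

/-- The acceleration error as a function of the velocity and the solution of the linear system. -/
theorem accelErr_eq (s : State P) (i j : ℕ) :
    s.wh i j - s.w i j = zeta s i j + velErr s i j * P.B1 i j (s.v i j)
      - P.c₂ * velErr s i j ^ 2 + P.B2 i j * velErr s i (j - 1)
      + P.B3 i j * velErr s i (j + 1) := by
  have h := P.D1_sub i j (s.v i j) (velErr s i j)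
  rw [show s.v i j + velErr s i j = s.vh i j by simp [velErr]] at h
  simp only [zeta, h]
  ring

theorem tendsto_mul_zero_of_bounded {f g : ℝ → ℝ} (hf : Tendsto f atTop (𝓝 0))
    (hg : ∃ B, ∀ t, 0 ≤ t → |g t| ≤ B) : Tendsto (fun t => f t * g t) atTop (𝓝 0) := by
  obtain ⟨B, hB⟩ := hg
  refine hf.zero_mul_isBoundedUnder_le ⟨B, ?_⟩
  rw [eventually_map]
  filter_upwards [eventually_ge_atTop 0] with t ht
  exact hB t ht

theorem IsClosedLoopSolution.tendsto_coupling (hs : IsClosedLoopSolution D K R s u)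
    (hK : ∀ i j, P.IsCarriage i j → IsHurwitz (P.A i j + K.col i j * P.out i j))
    (hc : P.IsCarriage i j) :
    Tendsto (fun t => P.B2 i j * velErr (s t) i (j - 1)) atTop (𝓝 0) ∧
      Tendsto (fun t => P.B3 i j * velErr (s t) i (j + 1)) atTop (𝓝 0) :=
  ⟨tendsto_const_mul_of_eq_zero_or (Plant.B2_eq_zero_or hc) fun h =>
      (hs.tendsto_err h (hK _ _ h)).1,
    tendsto_const_mul_of_eq_zero_or (Plant.B3_eq_zero_or hc) fun h =>
      (hs.tendsto_err h (hK _ _ h)).1⟩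

/-- In `accelErr_eq` the only term that is not already vanishing is the velocity error times `B1 v`;
as `B1` is affine, a bounded velocity suffices. -/
theorem IsClosedLoopSolution.tendsto_accelErr (hs : IsClosedLoopSolution D K R s u)
    (hK : ∀ i j, P.IsCarriage i j → IsHurwitz (P.A i j + K.col i j * P.out i j))
    (hc : P.IsCarriage i j) (hv : ∃ B, ∀ t, 0 ≤ t → |(s t).v i j| ≤ B) :
    Tendsto (fun t => (s t).wh i j - (s t).w i j) atTop (𝓝 0) := by
  obtain ⟨h1, h2⟩ := hs.tendsto_err hc (hK _ _ hc)
  obtain ⟨h3, h4⟩ := hs.tendsto_coupling hK hc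
  have h5 : Tendsto (fun t => velErr (s t) i j * P.B1 i j ((s t).v i j)) atTop (𝓝 0) := by
    simp only [P.B1_eq i j ((s _).v i j), mul_sub]
    have := tendsto_mul_zero_of_bounded h1 hv
    have h6 := (h1.mul_const (P.B1 i j 0)).sub (this.mul_const (2 * P.c₂))
    simp only [zero_mul, sub_zero] at h6
    exact h6.congr fun t => by ring
  simp only [accelErr_eq]
  simpa using (((h2.add h5).sub ((h1.pow 2).const_mul P.c₂)).add h3).add h4

end Solution

/-! ### The non-head carriages -/

theorem deriv_eq_of_affine {f : ℝ → ℝ} {a b : ℝ} (h : ∀ y, f y = a * y + b) (x : ℝ) :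
    deriv f x = a := by
  have hf : f = fun y => a * y + b := funext h
  rw [hf]
  simp

section Backstepping

variable {P : Plant} (K : Gains P) (i j : ℕ)

/-- The total damping coefficient of `z2`. -/
def zDamping : ℝ := K.l₂ i j + 1 + (K.l₁ i j + 1) ^ 2

theorem z2_eq (xj xp vj vp : ℝ) :
    z2 K i j xj xp vj vp = vj - vp + (K.l₁ i j + 1) * z1 P xj xp := by
  simp only [z2, alpha1]
  ring

/-- The partial derivatives of `alpha1` are the constants `-(l₁ + 1)`, `l₁ + 1` and `1`, so the
nonlinear damping terms merge with the linear one into `zDamping`. -/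
theorem alpha2_eq (xj xp vj vp wp : ℝ) : alpha2 K i j xj xp vj vp wp =
    -zDamping K i j * z2 K i j xj xp vj vp - z1 P xj xp - (K.l₁ i j + 1) * (vj - vp) + wp := by
  have h1 : deriv (fun y => alpha1 K i j y xp vp) xj = -(K.l₁ i j + 1) :=
    deriv_eq_of_affine (b := vp - (K.l₁ i j + 1) * (-xp + P.dp))
      (fun y => by simp only [alpha1, z1]; ring) _
  have h2 : deriv (fun y => alpha1 K i j xj y vp) xp = K.l₁ i j + 1 :=
    deriv_eq_of_affine (b := vp - (K.l₁ i j + 1) * (xj + P.dp))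
      (fun y => by simp only [alpha1, z1]; ring) _
  have h3 : deriv (fun y => alpha1 K i j xj xp y) vp = 1 :=
    deriv_eq_of_affine (b := -(K.l₁ i j + 1) * z1 P xj xp)
      (fun y => by simp only [alpha1]; ring) _
  simp only [alpha2, h1, h2, h3, zDamping]
  ring

theorem alpha3_eq (s : State P) (up : ℝ) : alpha3 K i j s up =
    -K.l₃ i j * z3 K i j (s.xh i j) (s.xh i (j - 1)) (s.vh i j) (s.vh i (j - 1)) (s.wh i j)
        (s.wh i (j - 1))
      - z2 K i j (s.xh i j) (s.xh i (j - 1)) (s.vh i j) (s.vh i (j - 1))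
      - (zDamping K i j * (K.l₁ i j + 1) + 1) * (xhRhs K s i j - xhRhs K s i (j - 1))
      - (zDamping K i j + (K.l₁ i j + 1)) * (vhRhs K s i j - vhRhs K s i (j - 1))
      + whRhs K s up i (j - 1) := by
  set a := K.l₁ i j + 1 with ha
  set c := zDamping K i j with hc
  have key : ∀ xj xp vj vp wp : ℝ, alpha2 K i j xj xp vj vp wp =
      -(c * a + 1) * (xj - xp + P.dp) - (c + a) * (vj - vp) + wp := by
    intro xj xp vj vp wp
    rw [alpha2_eq, z2_eq, z1]
    ring
  have h1 : ∀ xj xp vj vp wp, deriv (fun y => alpha2 K i j y xp vj vp wp) xj = -(c * a + 1) :=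
    fun xj xp vj vp wp => deriv_eq_of_affine
      (b := -(c * a + 1) * (-xp + P.dp) - (c + a) * (vj - vp) + wp)
      (fun y => by rw [key]; ring) _
  have h2 : ∀ xj xp vj vp wp, deriv (fun y => alpha2 K i j xj y vj vp wp) xp = c * a + 1 :=
    fun xj xp vj vp wp => deriv_eq_of_affine
      (b := -(c * a + 1) * (xj + P.dp) - (c + a) * (vj - vp) + wp)
      (fun y => by rw [key]; ring) _
  have h3 : ∀ xj xp vj vp wp, deriv (fun y => alpha2 K i j xj xp y vp wp) vj = -(c + a) :=
    fun xj xp vj vp wp => deriv_eq_of_affine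
      (b := -(c * a + 1) * (xj - xp + P.dp) - (c + a) * (-vp) + wp)
      (fun y => by rw [key]; ring) _
  have h4 : ∀ xj xp vj vp wp, deriv (fun y => alpha2 K i j xj xp vj y wp) vp = c + a :=
    fun xj xp vj vp wp => deriv_eq_of_affine
      (b := -(c * a + 1) * (xj - xp + P.dp) - (c + a) * vj + wp)
      (fun y => by rw [key]; ring) _
  have h5 : ∀ xj xp vj vp wp, deriv (fun y => alpha2 K i j xj xp vj vp y) wp = 1 :=
    fun xj xp vj vp wp => deriv_eq_of_affine
      (b := -(c * a + 1) * (xj - xp + P.dp) - (c + a) * (vj - vp))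
      (fun y => by rw [key]; ring) _
  simp only [alpha3, h1, h2, h3, h4, h5]
  ring

/-- With the input `followerControl`, the estimated acceleration obeys `ẇh = alpha3`. -/
theorem whRhs_followerControl (s : State P) (up : ℝ) :
    whRhs K s (followerControl K i j s up) i j = alpha3 K i j s up := by
  simp only [whRhs, followerControl]
  ring

end Backstepping

/-- In the derivative of `y₁² + y₂² + y₃²` the products `y₁ y₂` and `y₂ y₃` cancel. The term with
`ε₁` is quadratic in the state, so it cannot count as a disturbance; it is absorbed by the damping
once `ε₁` is small. -/
theorem backstepping_tendsto_zero {y₁ y₂ y₃ δ ε₀ ε₁ : ℝ → ℝ} {a c l : ℝ} (ha : 1 ≤ a) (hc : 1 ≤ c)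
    (hl : 0 < l)
    (h₁ : ∀ t, 0 ≤ t → HasDerivWithinAt y₁ (y₂ t - a * y₁ t + δ t) (Ici 0) t)
    (h₂ : ∀ t, 0 ≤ t → HasDerivWithinAt y₂
      (y₃ t - c * y₂ t - y₁ t + ε₀ t + ε₁ t * (y₂ t - a * y₁ t)) (Ici 0) t)
    (h₃ : ∀ t, 0 ≤ t → HasDerivWithinAt y₃ (-l * y₃ t - y₂ t) (Ici 0) t)
    (hδ : Tendsto δ atTop (𝓝 0)) (hε₀ : Tendsto ε₀ atTop (𝓝 0)) (hε₁ : Tendsto ε₁ atTop (𝓝 0)) :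
    Tendsto y₁ atTop (𝓝 0) ∧ Tendsto y₂ atTop (𝓝 0) := by
  have hE : Tendsto (fun t => y₁ t ^ 2 + y₂ t ^ 2 + y₃ t ^ 2) atTop (𝓝 0) := by
    refine tendsto_zero_of_deriv_le (c := min (1 / 2) (2 * l)) (by positivity)
      (η := fun t => δ t ^ 2 + 2 * ε₀ t ^ 2)
      (fun t ht => (((h₁ t ht).pow 2).add ((h₂ t ht).pow 2)).add ((h₃ t ht).pow 2))
      (fun t _ => by positivity) ?_ (by simpa using (hδ.pow 2).add ((hε₀.pow 2).const_mul 2))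
    -- The threshold comes from `|2 q (q - a p)| ≤ (2 + a) (p² + q²)`: the term then costs at most
    -- `(p² + q²) / 2`.
    have hsmall : ∀ᶠ t in atTop, |ε₁ t| < 1 / (2 * (2 + a)) := by
      have : Tendsto (fun t => |ε₁ t|) atTop (𝓝 0) := by simpa using hε₁.abs
      exact this.eventually_lt_const (by positivity)
    filter_upwards [hsmall] with t ht
    rw [lt_div_iff₀ (by positivity)] at ht
    generalize y₁ t = p at *
    generalize y₂ t = q at *
    generalize y₃ t = r at *
    generalize δ t = d at *
    generalize ε₀ t = e at *
    generalize ε₁ t = f at *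
    have A1 : 2 * (p * d) ≤ p ^ 2 + d ^ 2 := by linarith [sq_nonneg (p - d)]
    have A2 : 2 * (q * e) ≤ q ^ 2 / 2 + 2 * e ^ 2 := by linarith [sq_nonneg (q - 2 * e)]
    have A3 : 2 * (f * (q * (q - a * p))) ≤ (p ^ 2 + q ^ 2) / 2 := by
      have h1 : |2 * (q * (q - a * p))| ≤ (2 + a) * (p ^ 2 + q ^ 2) := by
        rw [abs_le]
        constructor <;>
          nlinarith [mul_nonneg (show 0 ≤ a by linarith) (sq_nonneg (p - q)),
            mul_nonneg (show 0 ≤ a by linarith) (sq_nonneg (p + q)), sq_nonneg p, sq_nonneg q]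
      have h2 : f * (2 * (q * (q - a * p))) ≤ |f| * ((2 + a) * (p ^ 2 + q ^ 2)) :=
        (le_abs_self _).trans (by
          rw [abs_mul]
          exact mul_le_mul_of_nonneg_left h1 (abs_nonneg _))
      have h3 := mul_le_mul_of_nonneg_right ht.le (show 0 ≤ p ^ 2 + q ^ 2 by positivity)
      linarith
    have A4 := mul_le_mul_of_nonneg_right ha (sq_nonneg p)
    have A5 := mul_le_mul_of_nonneg_right hc (sq_nonneg q)
    have A6 := mul_le_mul_of_nonneg_right (min_le_left (1 / 2) (2 * l)) (sq_nonneg p)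
    have A7 := mul_le_mul_of_nonneg_right (min_le_left (1 / 2) (2 * l)) (sq_nonneg q)
    have A8 := mul_le_mul_of_nonneg_right (min_le_right (1 / 2) (2 * l)) (sq_nonneg r)
    push_cast
    norm_num
    linarith [sq_nonneg q]
  have hle : ∀ {f : ℝ → ℝ}, (∀ t, f t ^ 2 ≤ y₁ t ^ 2 + y₂ t ^ 2 + y₃ t ^ 2) →
      Tendsto f atTop (𝓝 0) := fun hf =>
    tendsto_zero_of_sq (squeeze_zero (fun t => sq_nonneg _) hf hE)
  exact ⟨hle fun t => by nlinarith [sq_nonneg (y₂ t), sq_nonneg (y₃ t)],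
    hle fun t => by nlinarith [sq_nonneg (y₁ t), sq_nonneg (y₃ t)]⟩

section Solution

variable {P : Plant} {D : Spec} {K : Gains P} {R : Reference} {s : ℝ → State P}
  {u : ℝ → ℕ → ℕ → ℝ} {i j : ℕ}

theorem bounded_of_tendsto_sub {f g : ℝ → ℝ}
    (hg : ContinuousOn g (Ici 0)) (h : Tendsto (fun t => f t - g t) atTop (𝓝 0))
    (hb : ∃ B, ∀ t, 0 ≤ t → |f t| ≤ B) : ∃ B, ∀ t, 0 ≤ t → |g t| ≤ B := by
  obtain ⟨B, hB⟩ := hb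
  obtain ⟨T, hT⟩ := ((h.abs.congr fun t => rfl).eventually_lt_const
    (show |(0 : ℝ)| < 1 by simp)).exists_forall_of_atTop
  obtain ⟨C, hC⟩ := isCompact_Icc.exists_bound_of_continuousOn
    (hg.mono (fun t ht => ht.1 : Icc 0 T ⊆ Ici (0 : ℝ)))
  refine ⟨max C (B + 1), fun t ht => ?_⟩
  rcases le_total t T with h1 | h1
  · exact (hC t ⟨ht, h1⟩).trans (le_max_left _ _)
  · have h2 := hT t h1
    have h3 := hB t ht
    refine le_trans ?_ (le_max_right _ _)
    rw [abs_lt] at h2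
    rw [abs_le] at h3 ⊢
    constructor <;> linarith [h2.1, h2.2, h3.1, h3.2]

theorem IsClosedLoopSolution.continuousOn_v (hs : IsClosedLoopSolution D K R s u)
    (hc : P.IsCarriage i j) : ContinuousOn (fun t => (s t).v i j) (Ici 0) := fun t ht =>
  (hs.plant t ht i j hc).2.1.continuousWithinAt

theorem IsClosedLoopSolution.tendsto_follower (hs : IsClosedLoopSolution D K R s u)
    (hK : ∀ i j, P.IsCarriage i j → IsHurwitz (P.A i j + K.col i j * P.out i j))
    (hk : ∀ i j, P.IsCarriage i j → 0 < K.k₁ i j)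
    (hc : P.IsCarriage i j) (hj : 2 ≤ j)
    (hl : 0 < K.l₁ i j ∧ 0 < K.l₂ i j ∧ 0 < K.l₃ i j)
    (hv : ∃ B, ∀ t, 0 ≤ t → |(s t).v i (j - 1)| ≤ B) :
    Tendsto (fun t => (s t).x i (j - 1) - (s t).x i j) atTop (𝓝 P.dp) ∧
      Tendsto (fun t => (s t).v i (j - 1) - (s t).v i j) atTop (𝓝 0) := by
  have hp : P.IsCarriage i (j - 1) := ⟨hc.1, by omega, (Nat.sub_le _ _).trans hc.2.2⟩
  obtain ⟨hl1, hl2, hl3⟩ := hl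
  obtain ⟨ev, ez⟩ := hs.tendsto_err hc (hK _ _ hc)
  obtain ⟨evp, ezp⟩ := hs.tendsto_err hp (hK _ _ hp)
  have ex := hs.tendsto_posErr hc (hk _ _ hc)
  have exp := hs.tendsto_posErr hp (hk _ _ hp)
  have ewp := hs.tendsto_accelErr hK hp hv
  obtain ⟨e2, e3⟩ := hs.tendsto_coupling hK hc
  set a := K.l₁ i j + 1 with ha
  set c := zDamping K i j with hcc
  -- These are `z1`, `z2`, `z3` with the partial derivatives evaluated.
  let y₁ : ℝ → ℝ := fun t => z1 P ((s t).xh i j) ((s t).xh i (j - 1))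
  let y₂ : ℝ → ℝ := fun t => (s t).vh i j - (s t).vh i (j - 1) + a * y₁ t
  let y₃ : ℝ → ℝ := fun t => (s t).wh i j - (s t).wh i (j - 1) + c * y₂ t + y₁ t
    + a * ((s t).vh i j - (s t).vh i (j - 1))
  let δ : ℝ → ℝ := fun t => -velErr (s t) i j + velErr (s t) i (j - 1)
    - K.k₁ i j * ((s t).xh i j - (s t).x i j)
    + K.k₁ i (j - 1) * ((s t).xh i (j - 1) - (s t).x i (j - 1))
  -- `mu2` contains `2 c₂ velErr * v i j`, and the carriage's own velocity is not yet known to be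
  -- bounded. It is written as `(y₂ - a y₁)`, plus the predecessor's velocity, plus velocity errors:
  -- the first part gives `ε₁`, the rest goes into `ε₀`.
  let ε₁ : ℝ → ℝ := fun t => 2 * P.c₂ * velErr (s t) i j
  let ε₀ : ℝ → ℝ := fun t => a * δ t - mu2 K (s t) i (j - 1)
    + K.k₂ i j * velErr (s t) i j - velErr (s t) i j * P.B1 i j 0
    + 2 * P.c₂ * (velErr (s t) i j * (s t).v i (j - 1)
      + velErr (s t) i j * (velErr (s t) i (j - 1) - velErr (s t) i j))
    + P.c₂ * velErr (s t) i j ^ 2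
    - P.B2 i j * velErr (s t) i (j - 1) - P.B3 i j * velErr (s t) i (j + 1)
  have hδ : Tendsto δ atTop (𝓝 0) := by
    simpa using ((ev.neg.add evp).sub (ex.const_mul (K.k₁ i j))).add
      (exp.const_mul (K.k₁ i (j - 1)))
  have hε₁ : Tendsto ε₁ atTop (𝓝 0) := by simpa using ev.const_mul (2 * P.c₂)
  have hμp : Tendsto (fun t => mu2 K (s t) i (j - 1)) atTop (𝓝 0) := by
    simp only [mu2_eq]
    simpa using (ezp.sub ewp).add (evp.const_mul (K.k₂ i (j - 1)))
  have hε₀ : Tendsto ε₀ atTop (𝓝 0) := by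
    have h1 := tendsto_mul_zero_of_bounded ev hv
    simpa using ((((((((hδ.const_mul a).sub hμp).add (ev.const_mul (K.k₂ i j))).sub
      (ev.mul_const (P.B1 i j 0))).add ((h1.add (ev.mul (evp.sub ev))).const_mul (2 * P.c₂))).add
      ((ev.pow 2).const_mul P.c₂)).sub e2).sub e3)
  have d₁ : ∀ t, 0 ≤ t → HasDerivWithinAt y₁ (xhRhs K (s t) i j - xhRhs K (s t) i (j - 1))
      (Ici 0) t := fun t ht =>
    ((hs.observer t ht i j hc).1.sub (hs.observer t ht i (j - 1) hp).1).add_const P.dp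
  have dv : ∀ t, 0 ≤ t → HasDerivWithinAt (fun t => (s t).vh i j - (s t).vh i (j - 1))
      (vhRhs K (s t) i j - vhRhs K (s t) i (j - 1)) (Ici 0) t := fun t ht =>
    (hs.observer t ht i j hc).2.1.sub (hs.observer t ht i (j - 1) hp).2.1
  have d₂ := fun t ht => (dv t ht).add ((d₁ t ht).const_mul a)
  have d₃ := fun t ht => ((((hs.observer t ht i j hc).2.2.1.sub
    (hs.observer t ht i (j - 1) hp).2.2.1).add ((d₂ t ht).const_mul c)).add (d₁ t ht)).add
      ((dv t ht).const_mul a)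
  have hy₁ : ∀ t, xhRhs K (s t) i j - xhRhs K (s t) i (j - 1) = y₂ t - a * y₁ t + δ t := by
    intro t
    simp only [xhRhs_eq, y₂, δ, velErr]
    ring
  obtain ⟨hz1, hz2⟩ := backstepping_tendsto_zero (y₁ := y₁) (y₂ := y₂) (y₃ := y₃) (δ := δ)
    (ε₀ := ε₀) (ε₁ := ε₁) (a := a) (c := c) (l := K.l₃ i j) (by linarith)
    (by rw [hcc, zDamping]; nlinarith [sq_nonneg (K.l₁ i j + 1)]) hl3
    (fun t ht => by rw [← hy₁]; exact d₁ t ht)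
    (fun t ht => by
      refine (d₂ t ht).congr_deriv ?_
      rw [hy₁]
      have hμ := mu2_eq K (s t) i j
      rw [accelErr_eq, P.B1_eq, show (s t).v i j = (y₂ t - a * y₁ t) + (s t).v i (j - 1)
        + (velErr (s t) i (j - 1) - velErr (s t) i j) by simp only [y₂, velErr]; ring] at hμ
      simp only [vhRhs, hμ, ε₀, ε₁, y₃]
      have : (s t).vh i j - (s t).vh i (j - 1) = y₂ t - a * y₁ t := by simp only [y₂]; ring
      rw [this]
      ring)
    (fun t ht => by
      refine (d₃ t ht).congr_deriv ?_
      have hu := hs.control t ht i j hc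
      rw [if_neg (by omega)] at hu
      rw [hu, whRhs_followerControl, alpha3_eq, z3, alpha2_eq, z2_eq]
      simp only [y₂, y₃, y₁]
      ring)
    hδ hε₀ hε₁
  constructor
  · have := ((ex.sub exp).sub hz1).add_const P.dp
    simp only [sub_zero, zero_add] at this
    refine this.congr fun t => ?_
    simp only [y₁, z1]
    ring
  · have := ((ev.sub evp).sub hz2).add (hz1.const_mul a)
    simp only [sub_zero, mul_zero, add_zero] at this
    refine this.congr fun t => ?_
    simp only [y₂, velErr]
    ring

end Solution

/-! ### The head carriages and the requirements -/

section Control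

variable {P : Plant} (D : Spec) (K : Gains P) (R : Reference) (i : ℕ)

theorem whRhs_eq_add (s : State P) (u : ℝ) (j : ℕ) :
    whRhs K s u i j = whRhs K s 0 i j + u := by
  simp only [whRhs]
  ring

theorem headControl_eq (s : State P) (u : ℕ → ℕ → ℝ) (t : ℝ) :
    headControl D K R i s u t = feedforward K R i s u t - whRhs K s 0 i 1
      - headRhs D K i (xTilde D R i s t) (vTilde R i s t) (whTilde R i s t) := by
  have hB : P.B2 i 1 = 0 := by simp [Plant.B2]
  simp only [headControl, headRhs, whRhs, qTilde, hB]
  ring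

theorem feedforward_eq (hi : i ≠ 1) (s : State P) (u : ℕ → ℕ → ℝ) (t : ℝ) :
    feedforward K R i s u t =
      whRhs K s (u (i - 1) (P.M (i - 1))) (i - 1) (P.M (i - 1)) := by
  have hB : P.B3 (i - 1) (P.M (i - 1)) = 0 := by simp [Plant.B3]
  simp only [feedforward, if_neg hi, whRhs, hB]
  ring

/-- The acceleration error of the tail carriage in front of train `i`. -/
def frontErr (s : State P) : ℝ :=
  if i = 1 then 0
  else s.wh (i - 1) (P.M (i - 1)) - s.w (i - 1) (P.M (i - 1))

end Control

theorem HeadGains.of_lt {P : Plant} {D : Spec} {K : Gains P} {i : ℕ}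
    (hds : D.γ₂ < D.ds) (hγ₁ : D.ds < D.γ₁)
    (hell₁ : 0 < K.ell₁ i ∧ K.ell₁ i < min (D.σ₂ / D.ρ₁) (D.σ₁ / D.ρ₂))
    (hell : 2 < K.ell₂ i ∧ 2 + K.ell₂ i ^ 2 / 2 < K.ell₃ i ∧ 1 / 2 < K.ell₄ i) :
    HeadGains D K i := by
  have h1 : 0 < D.ρ₁ := sub_pos.2 hγ₁
  have h2 : 0 < D.ρ₂ := sub_pos.2 hds
  have h3 := (lt_div_iff₀ h1).1 (hell₁.2.trans_le (min_le_left _ _))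
  have h4 := (lt_div_iff₀ h2).1 (hell₁.2.trans_le (min_le_right _ _))
  refine ⟨h1, h2, ?_, ?_, hell₁.1, by linarith [hell.1], ?_, hell.2.2.le⟩
  · simp only [TrainCruise.varrho₁]; linarith
  · simp only [TrainCruise.varrho₂]; linarith
  · linarith [hell.2.1, sq_nonneg (K.ell₂ i)]

section Solution

variable {P : Plant} {D : Spec} {K : Gains P} {R : Reference} {s : ℝ → State P}
  {u : ℝ → ℕ → ℕ → ℝ} {i : ℕ}

theorem Plant.isCarriage_head (hM : ∀ i, P.IsTrain i → 1 ≤ P.M i) (hi : P.IsTrain i) :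
    P.IsCarriage i 1 := ⟨hi, le_rfl, hM i hi⟩

theorem Plant.isCarriage_tail (hM : ∀ i, P.IsTrain i → 1 ≤ P.M i) (hi : P.IsTrain i) :
    P.IsCarriage i (P.M i) := ⟨hi, hM i hi, le_rfl⟩

theorem Plant.IsTrain.pred (hi : P.IsTrain i) (h1 : i ≠ 1) : P.IsTrain (i - 1) := by
  obtain ⟨h2, h3⟩ := hi
  exact ⟨by omega, by omega⟩

theorem IsClosedLoopSolution.hasDerivWithinAt_front (hs : IsClosedLoopSolution D K R s u)
    (hR : R.IsTrajectory) (hM : ∀ i, P.IsTrain i → 1 ≤ P.M i) (hi : P.IsTrain i) {t : ℝ}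
    (ht : 0 ≤ t) :
    HasDerivWithinAt (fun τ => xFront R i (s τ) τ) (vFront R i (s t) t) (Ici 0) t ∧
    HasDerivWithinAt (fun τ => vFront R i (s τ) τ) (whFront R i (s t) t - frontErr i (s t))
      (Ici 0) t ∧
    HasDerivWithinAt (fun τ => whFront R i (s τ) τ) (feedforward K R i (s t) (u t) t)
      (Ici 0) t := by
  by_cases h1 : i = 1
  · simp only [xFront, vFront, whFront, frontErr, feedforward, if_pos h1, sub_zero]
    exact hR t ht
  · have hc := Plant.isCarriage_tail hM (hi.pred h1)
    rw [feedforward_eq K R i h1]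
    simp only [xFront, vFront, whFront, frontErr, if_neg h1, sub_sub_cancel]
    exact ⟨(hs.plant t ht _ _ hc).1, (hs.plant t ht _ _ hc).2.1, (hs.observer t ht _ _ hc).2.2.1⟩

theorem IsClosedLoopSolution.isHeadTrajectoryAt (hs : IsClosedLoopSolution D K R s u)
    (hR : R.IsTrajectory) (hM : ∀ i, P.IsTrain i → 1 ≤ P.M i) (hi : P.IsTrain i) {t : ℝ}
    (ht : 0 ≤ t) :
    IsHeadTrajectoryAt D K i (fun τ => xTilde D R i (s τ) τ) (fun τ => vTilde R i (s τ) τ)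
      (fun τ => whTilde R i (s τ) τ)
      (fun τ => ((s τ).wh i 1 - (s τ).w i 1) - frontErr i (s τ)) t := by
  have hc := Plant.isCarriage_head hM hi
  obtain ⟨hx, hv, hw⟩ := hs.hasDerivWithinAt_front hR hM hi ht
  refine ⟨(hx.sub (hs.plant t ht _ _ hc).1).sub_const _,
    (hv.sub (hs.plant t ht _ _ hc).2.1).congr_deriv ?_,
    (hw.sub (hs.observer t ht _ _ hc).2.2.1).congr_deriv ?_⟩
  · simp only [whTilde]
    ring
  · rw [hs.control t ht _ _ hc, if_pos rfl, whRhs_eq_add, headControl_eq]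
    ring

theorem IsClosedLoopSolution.continuousOn_disturbance (hs : IsClosedLoopSolution D K R s u)
    (hM : ∀ i, P.IsTrain i → 1 ≤ P.M i) (hi : P.IsTrain i) :
    ContinuousOn (fun τ => ((s τ).wh i 1 - (s τ).w i 1) - frontErr i (s τ)) (Ici 0) := by
  have hcar : ∀ {i j}, P.IsCarriage i j →
      ContinuousOn (fun τ => (s τ).wh i j - (s τ).w i j) (Ici 0) := fun hc t ht =>
    (hs.observer t ht _ _ hc).2.2.1.continuousWithinAt.sub
      (hs.plant t ht _ _ hc).2.2.1.continuousWithinAt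
  refine (hcar (Plant.isCarriage_head hM hi)).sub ?_
  by_cases h1 : i = 1
  · simp only [frontErr, if_pos h1]
    exact continuousOn_const
  · simp only [frontErr, if_neg h1]
    exact hcar (Plant.isCarriage_tail hM (hi.pred h1))

theorem IsClosedLoopSolution.mem_headRegion (hs : IsClosedLoopSolution D K R s u)
    (hR : R.IsTrajectory) (hM : ∀ i, P.IsTrain i → 1 ≤ P.M i) (hi : P.IsTrain i)
    (H : HeadGains D K i) (h0 : IsAdmissible D K R (s 0)) :
    ∀ t, 0 ≤ t → (xTilde D R i (s t) t, vTilde R i (s t) t, whTilde R i (s t) t)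
      ∈ headRegion D K i :=
  H.forall_mem_headRegion (h0 i hi) (hs.continuousOn_disturbance hM hi)
    fun _ ht => hs.isHeadTrajectoryAt hR hM hi ht

/-- All velocities are bounded, by induction along the platoon. -/
theorem IsClosedLoopSolution.bounded_v (hs : IsClosedLoopSolution D K R s u)
    (hR : R.IsTrajectory) (hM : ∀ i, P.IsTrain i → 1 ≤ P.M i)
    (hRv : ∃ V : ℝ, ∀ t : ℝ, 0 ≤ t → |R.v t| ≤ V)
    (hK : ∀ i j, P.IsCarriage i j → IsHurwitz (P.A i j + K.col i j * P.out i j))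
    (hk : ∀ i j, P.IsCarriage i j → 0 < K.k₁ i j)
    (hl : ∀ i j, P.IsCarriage i j → 2 ≤ j → 0 < K.l₁ i j ∧ 0 < K.l₂ i j ∧ 0 < K.l₃ i j)
    (H : ∀ i, P.IsTrain i → HeadGains D K i) (h0 : IsAdmissible D K R (s 0)) :
    ∀ i j, P.IsCarriage i j → ∃ B, ∀ t, 0 ≤ t → |(s t).v i j| ≤ B := by
  intro i
  induction i with
  | zero => exact fun j hc => absurd hc.1.1 (by omega)
  | succ n ihn =>
    intro j
    induction j with
    | zero => exact fun hc => absurd hc.2.1 (by omega)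
    | succ m ihm =>
      intro hc
      rcases Nat.eq_zero_or_pos m with rfl | hm
      · have hfront : ∃ B, ∀ t, 0 ≤ t → |vFront R (n + 1) (s t) t| ≤ B := by
          by_cases hn : n + 1 = 1
          · simpa only [vFront, if_pos hn] using hRv
          · simp only [vFront, if_neg hn, Nat.add_sub_cancel]
            exact ihn _ (Plant.isCarriage_tail hM (hc.1.pred hn))
        obtain ⟨B, hB⟩ := hfront
        -- A head differs from the carriage in front by a velocity in `(-σ₂, σ₁)`; only confinement,
        -- not convergence, is used here.
        refine ⟨B + (|D.σ₁| + |D.σ₂|), fun t ht => ?_⟩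
        have h1 := (H _ hc.1).velocity_mem (hs.mem_headRegion hR hM hc.1 (H _ hc.1) h0 t ht)
        have h2 := abs_le.1 (hB t ht)
        rw [abs_le]
        simp only [vTilde] at h1
        constructor <;> linarith [h1.1, h1.2, h2.1, h2.2, le_abs_self D.σ₁, le_abs_self D.σ₂,
          abs_nonneg D.σ₁, abs_nonneg D.σ₂]
      · have hp : P.IsCarriage (n + 1) m := ⟨hc.1, hm, (Nat.le_succ m).trans hc.2.2⟩
        exact bounded_of_tendsto_sub (hs.continuousOn_v hc)
          (hs.tendsto_follower hK hk hc (by omega) (hl _ _ hc (by omega)) (ihm hp)).2 (ihm hp)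

theorem IsClosedLoopSolution.requirements (hs : IsClosedLoopSolution D K R s u)
    (hR : R.IsTrajectory) (hM : ∀ i, P.IsTrain i → 1 ≤ P.M i)
    (hRv : ∃ V : ℝ, ∀ t : ℝ, 0 ≤ t → |R.v t| ≤ V)
    (hK : ∀ i j, P.IsCarriage i j → IsHurwitz (P.A i j + K.col i j * P.out i j))
    (hk : ∀ i j, P.IsCarriage i j → 0 < K.k₁ i j)
    (hl : ∀ i j, P.IsCarriage i j → 2 ≤ j → 0 < K.l₁ i j ∧ 0 < K.l₂ i j ∧ 0 < K.l₃ i j)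
    (H : ∀ i, P.IsTrain i → HeadGains D K i) (h0 : IsAdmissible D K R (s 0)) :
    RequirementOne s ∧ RequirementTwo D R s ∧ RequirementThree D R s := by
  have hv := hs.bounded_v hR hM hRv hK hk hl H h0
  have hlim : ∀ i, P.IsTrain i → Tendsto (fun t => xTilde D R i (s t) t) atTop (𝓝 0) ∧
      Tendsto (fun t => vTilde R i (s t) t) atTop (𝓝 0) := by
    intro i hi
    refine (H i hi).tendsto_zero (hs.mem_headRegion hR hM hi (H i hi) h0)
      (fun t ht => hs.isHeadTrajectoryAt hR hM hi ht) ?_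
    have hc := Plant.isCarriage_head hM hi
    have h1 := hs.tendsto_accelErr hK hc (hv _ _ hc)
    have h2 : Tendsto (fun t => frontErr i (s t)) atTop (𝓝 0) := by
      by_cases h1 : i = 1
      · simp only [frontErr, if_pos h1]
        exact tendsto_const_nhds
      · simp only [frontErr, if_neg h1]
        have hc' := Plant.isCarriage_tail hM (hi.pred h1)
        exact hs.tendsto_accelErr hK hc' (hv _ _ hc')
    simpa using h1.sub h2
  refine ⟨fun i j hc hj => ?_, fun i hi => ⟨fun t ht => ?_, ?_⟩, fun i hi => ⟨fun t ht => ?_, ?_⟩⟩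
  · have hp : P.IsCarriage i (j - 1) := ⟨hc.1, by omega, (Nat.sub_le _ _).trans hc.2.2⟩
    exact hs.tendsto_follower hK hk hc hj (hl _ _ hc hj) (hv _ _ hp)
  · have := (hs.mem_headRegion hR hM hi (H i hi) h0 t ht).1
    simp only [xTilde, Spec.ρ₁, Spec.ρ₂, mem_Ioo] at this
    constructor <;> linarith [this.1, this.2]
  · simpa [xTilde] using (hlim i hi).1.add_const D.ds
  · exact (H i hi).velocity_mem (hs.mem_headRegion hR hM hi (H i hi) h0 t ht)
  · exact (hlim i hi).2

end Solution

/-! ### Construction of a solution -/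

/-- The shape of a non-head carriage's motion relative to its predecessor; the time-dependent
coefficients of `V` come from the acceleration error. -/
theorem exists_linear_chain (a₁ a₂ a₃ : ℝ) {g h r k : ℝ → ℝ} (hg : ContinuousOn g (Ici 0))
    (hh : ContinuousOn h (Ici 0)) (hr : ContinuousOn r (Ici 0)) (hk : ContinuousOn k (Ici 0))
    (x₀ v₀ w₀ : ℝ) :
    ∃ X V W : ℝ → ℝ, X 0 = x₀ ∧ V 0 = v₀ ∧ W 0 = w₀ ∧ ∀ t, 0 ≤ t →
      HasDerivWithinAt X (V t) (Ici 0) t ∧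
      HasDerivWithinAt V (W t + (g t + h t * V t)) (Ici 0) t ∧
      HasDerivWithinAt W (a₁ * X t + a₂ * V t + a₃ * W t + (r t + k t * V t)) (Ici 0) t := by
  let F : (ℝ × ℝ × ℝ × ℝ) × (ℝ × ℝ × ℝ) → ℝ × ℝ × ℝ := fun q =>
    (q.2.2.1, q.2.2.2 + (q.1.1 + q.1.2.1 * q.2.2.1),
      a₁ * q.2.1 + a₂ * q.2.2.1 + a₃ * q.2.2.2 + (q.1.2.2.1 + q.1.2.2.2 * q.2.2.1))
  have hF : ContDiff ℝ 1 F := by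
    refine ContDiff.prodMk (by fun_prop) (ContDiff.prodMk (by fun_prop) (by fun_prop))
  have hp : ContinuousOn (fun t => (g t, h t, r t, k t)) (Ici 0) :=
    hg.prodMk (hh.prodMk (hr.prodMk hk))
  obtain ⟨y, hy0, hy⟩ := exists_global_solution_of_linear_growth hF hp (fun T _ => by
    obtain ⟨c, hc⟩ := isCompact_Icc.exists_bound_of_continuousOn
      (hp.mono (fun t ht => ht.1 : Icc 0 T ⊆ Ici (0 : ℝ)))
    refine ⟨1 + |c| + (|a₁| + |a₂| + |a₃|), |c|, by positivity, by positivity,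
      fun t ht y => ?_⟩
    have h0 : ‖(g t, h t, r t, k t)‖ ≤ |c| := (hc t ht).trans (le_abs_self c)
    simp only [norm_prod_le_iff, Real.norm_eq_abs] at h0
    obtain ⟨b1, b2, b3, b4⟩ := h0
    have y1 : |y.1| ≤ ‖y‖ := norm_fst_le y
    have y2 : |y.2.1| ≤ ‖y‖ := (norm_fst_le y.2).trans (norm_snd_le y)
    have y3 : |y.2.2| ≤ ‖y‖ := (norm_snd_le y.2).trans (norm_snd_le y)
    generalize ‖y‖ = Y at *
    have hY : 0 ≤ Y := (abs_nonneg _).trans y1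
    have m : ∀ {a b A : ℝ}, |a| ≤ A → |b| ≤ Y → |a * b| ≤ A * Y := fun {a b A} h1 h2 => by
      rw [abs_mul]
      exact mul_le_mul h1 h2 (abs_nonneg _) ((abs_nonneg _).trans h1)
    have m1 := m (le_refl |a₁|) y1
    have m2 := m (le_refl |a₂|) y2
    have m3 := m (le_refl |a₃|) y3
    have m4 := m b2 y2
    have m5 := m b4 y2
    have p1 : 0 ≤ |c| * Y := by positivity
    have p2 : 0 ≤ (|a₁| + |a₂| + |a₃|) * Y := by positivity
    have p3 := abs_nonneg c
    simp only [F, norm_prod_le_iff, Real.norm_eq_abs]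
    refine ⟨?_, ?_, ?_⟩
    · linarith
    · have := (abs_add_le y.2.2 (g t + h t * y.2.1)).trans
        (add_le_add le_rfl (abs_add_le (g t) (h t * y.2.1)))
      linarith
    · have e1 := abs_add_le (a₁ * y.1 + a₂ * y.2.1 + a₃ * y.2.2) (r t + k t * y.2.1)
      have e2 := abs_add_le (r t) (k t * y.2.1)
      have e3 := abs_add_le (a₁ * y.1 + a₂ * y.2.1) (a₃ * y.2.2)
      have e4 := abs_add_le (a₁ * y.1) (a₂ * y.2.1)
      linarith) (x₀, v₀, w₀)
  refine ⟨fun t => (y t).1, fun t => (y t).2.1, fun t => (y t).2.2, by simp [hy0], by simp [hy0],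
    by simp [hy0], fun t ht => ?_⟩
  have h1 := (ContinuousLinearMap.fst ℝ ℝ (ℝ × ℝ)).hasFDerivAt.comp_hasDerivWithinAt t (hy t ht)
  have h2 := (ContinuousLinearMap.snd ℝ ℝ (ℝ × ℝ)).hasFDerivAt.comp_hasDerivWithinAt t (hy t ht)
  exact ⟨h1, (ContinuousLinearMap.fst ℝ ℝ ℝ).hasFDerivAt.comp_hasDerivWithinAt t h2,
    (ContinuousLinearMap.snd ℝ ℝ ℝ).hasFDerivAt.comp_hasDerivWithinAt t h2⟩

/-- Faults and observer errors as functions of time, solving their linear equations. -/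
structure ErrorData {P : Plant} (K : Gains P) (s₀ : State P) where
  f : (i j : ℕ) → ℝ → Fin (P.n i j) → ℝ
  ex : ℕ → ℕ → ℝ → ℝ
  ev : ℕ → ℕ → ℝ → ℝ
  ez : ℕ → ℕ → ℝ → ℝ
  ef : (i j : ℕ) → ℝ → Fin (P.n i j) → ℝ
  f_zero : ∀ i j, f i j 0 = s₀.f i j
  ex_zero : ∀ i j, ex i j 0 = s₀.xh i j - s₀.x i j
  ev_zero : ∀ i j, ev i j 0 = velErr s₀ i j
  ez_zero : ∀ i j, ez i j 0 = zeta s₀ i j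
  ef_zero : ∀ i j, ef i j 0 = s₀.fh i j - s₀.f i j
  hf : ∀ i j t, HasDerivAt (f i j) (P.S i j *ᵥ f i j t) t
  hex : ∀ i j t, HasDerivAt (ex i j) (-K.k₁ i j * ex i j t) t
  hev : ∀ i j t, HasDerivAt (ev i j) (ez i j t + K.k₂ i j * ev i j t) t
  hez : ∀ i j t, HasDerivAt (ez i j) (P.C i j ⬝ᵥ ef i j t + K.k₃ i j * ev i j t) t
  hef : ∀ i j t, HasDerivAt (ef i j) (P.S i j *ᵥ ef i j t + ev i j t • K.k₄ i j) t

theorem nonempty_errorData {P : Plant} (K : Gains P) (s₀ : State P) :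
    Nonempty (ErrorData K s₀) := by
  choose f hf0 hf using fun i j => exists_linear_solution (P.S i j) (s₀.f i j)
  choose e he0 he using fun i j => exists_linear_solution (P.A i j + K.col i j * P.out i j)
    (Sum.elim (fun _ => velErr s₀ i j) (Sum.elim (fun _ => zeta s₀ i j)
      (s₀.fh i j - s₀.f i j)))
  have hsplit : ∀ i j t, e i j t = Sum.elim (fun _ => e i j t (.inl ()))
      (Sum.elim (fun _ => e i j t (.inr (.inl ()))) fun k => e i j t (.inr (.inr k))) := by
    intro i j t
    ext (k | k | k) <;> rfl
  have hd : ∀ i j t k, HasDerivAt (fun t => e i j t k)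
      (Sum.elim (fun _ => e i j t (.inr (.inl ())) + K.k₂ i j * e i j t (.inl ()))
        (Sum.elim (fun _ => (P.C i j ⬝ᵥ fun k => e i j t (.inr (.inr k)))
            + K.k₃ i j * e i j t (.inl ()))
          (P.S i j *ᵥ (fun k => e i j t (.inr (.inr k))) + e i j t (.inl ()) • K.k₄ i j)) k) t := by
    intro i j t k
    have := he i j t
    rw [hsplit i j t, errorMatrix_mulVec] at this
    exact hasDerivAt_pi.1 this k
  exact ⟨{
    f := f
    ex := fun i j t => Real.exp (-K.k₁ i j * t) * (s₀.xh i j - s₀.x i j)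
    ev := fun i j t => e i j t (.inl ())
    ez := fun i j t => e i j t (.inr (.inl ()))
    ef := fun i j t k => e i j t (.inr (.inr k))
    f_zero := hf0
    ex_zero := fun i j => by simp
    ev_zero := fun i j => by simp [he0]
    ez_zero := fun i j => by simp [he0]
    ef_zero := fun i j => by ext k; simp [he0]
    hf := hf
    hex := fun i j t => by
      refine ((((hasDerivAt_id t).const_mul (-K.k₁ i j)).exp).mul_const _).congr_deriv ?_
      simp only [id_eq]
      ring
    hev := fun i j t => hd i j t (.inl ())
    hez := fun i j t => hd i j t (.inr (.inl ()))
    hef := fun i j t => hasDerivAt_pi.2 fun k => hd i j t (.inr (.inr k)) }⟩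

namespace ErrorData

variable {P : Plant} {K : Gains P} {s₀ : State P} (e : ErrorData K s₀)

/-- The acceleration error of carriage `(i, j)` at time `t` if its velocity is `v`. -/
def accelErr (i j : ℕ) (t v : ℝ) : ℝ :=
  e.ez i j t + e.ev i j t * P.B1 i j v - P.c₂ * e.ev i j t ^ 2
    + P.B2 i j * e.ev i (j - 1) t + P.B3 i j * e.ev i (j + 1) t

/-- The slope of `accelErr` as a function of the velocity. -/
def accelSlope (i j : ℕ) (t : ℝ) : ℝ := -(2 * P.c₂ * e.ev i j t)

theorem accelErr_eq (i j : ℕ) (t v : ℝ) :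
    e.accelErr i j t v = e.accelErr i j t 0 + e.accelSlope i j t * v := by
  simp only [accelErr, accelSlope, P.B1_eq i j v]
  ring

theorem continuous_ex (i j : ℕ) : Continuous (e.ex i j) :=
  continuous_iff_continuousAt.2 fun t => (e.hex i j t).continuousAt

theorem continuous_ev (i j : ℕ) : Continuous (e.ev i j) :=
  continuous_iff_continuousAt.2 fun t => (e.hev i j t).continuousAt

theorem continuous_ez (i j : ℕ) : Continuous (e.ez i j) :=
  continuous_iff_continuousAt.2 fun t => (e.hez i j t).continuousAt

theorem continuous_accelErr_zero (i j : ℕ) : Continuous fun t => e.accelErr i j t 0 := by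
  have := e.continuous_ev
  have := e.continuous_ez
  unfold accelErr
  fun_prop

theorem continuous_accelSlope (i j : ℕ) : Continuous (e.accelSlope i j) := by
  have := e.continuous_ev
  unfold accelSlope
  fun_prop

end ErrorData

/-- The motion of one carriage: position, velocity, estimated acceleration, acceleration error,
and derivative of the estimated acceleration. -/
structure Motion where
  x : ℝ → ℝ
  v : ℝ → ℝ
  wh : ℝ → ℝ
  ew : ℝ → ℝ
  whd : ℝ → ℝ

/-- The equations that a motion satisfies. -/
structure Motion.IsMotion (n : Motion) : Prop where
  x : ∀ t, 0 ≤ t → HasDerivWithinAt n.x (n.v t) (Ici 0) t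
  v : ∀ t, 0 ≤ t → HasDerivWithinAt n.v (n.wh t - n.ew t) (Ici 0) t
  wh : ∀ t, 0 ≤ t → HasDerivWithinAt n.wh (n.whd t) (Ici 0) t
  ew : ContinuousOn n.ew (Ici 0)

namespace ErrorData

variable {P : Plant} {K : Gains P} {s₀ : State P} (e : ErrorData K s₀)

/-- `n` starts at the initial state of carriage `(i, j)` and has the right acceleration error. -/
structure Starts (i j : ℕ) (n : Motion) : Prop where
  x : n.x 0 = s₀.x i j
  v : n.v 0 = s₀.v i j
  wh : n.wh 0 = s₀.wh i j
  ew : ∀ t, n.ew t = e.accelErr i j t (n.v t)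

/-- The derivative of the estimated acceleration of the non-head carriage `(i, j)` with motion `n`
whose predecessor has motion `p`. -/
def followerWhd (i j : ℕ) (p n : Motion) (t : ℝ) : ℝ :=
  -K.l₃ i j * z3 K i j (n.x t + e.ex i j t) (p.x t + e.ex i (j - 1) t) (n.v t + e.ev i j t)
      (p.v t + e.ev i (j - 1) t) (n.wh t) (p.wh t)
    - z2 K i j (n.x t + e.ex i j t) (p.x t + e.ex i (j - 1) t) (n.v t + e.ev i j t)
      (p.v t + e.ev i (j - 1) t)
    - (zDamping K i j * (K.l₁ i j + 1) + 1) * (n.v t - K.k₁ i j * e.ex i j t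
      - (p.v t - K.k₁ i (j - 1) * e.ex i (j - 1) t))
    - (zDamping K i j + (K.l₁ i j + 1)) *
      (n.wh t - n.ew t + (e.ez i j t + K.k₂ i j * e.ev i j t)
        - (p.wh t - p.ew t + (e.ez i (j - 1) t + K.k₂ i (j - 1) * e.ev i (j - 1) t)))
    + p.whd t

theorem exists_of_relative (i j : ℕ) {p : Motion} (hp : p.IsMotion) (x₀ : ℝ) {X V W w' : ℝ → ℝ}
    (hX0 : X 0 = p.x 0 - s₀.x i j - x₀) (hV0 : V 0 = p.v 0 - s₀.v i j)
    (hW0 : W 0 = p.wh 0 - s₀.wh i j)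
    (hX : ∀ t, 0 ≤ t → HasDerivWithinAt X (V t) (Ici 0) t)
    (hV : ∀ t, 0 ≤ t → HasDerivWithinAt V
      (W t + (e.accelErr i j t 0 + e.accelSlope i j t * p.v t - p.ew t
        + -e.accelSlope i j t * V t)) (Ici 0) t)
    (hW : ∀ t, 0 ≤ t → HasDerivWithinAt W (w' t) (Ici 0) t) :
    ∃ n : Motion, e.Starts i j n ∧ n.IsMotion ∧ (∀ t, X t = p.x t - n.x t - x₀) ∧
      (∀ t, V t = p.v t - n.v t) ∧ (∀ t, W t = p.wh t - n.wh t) ∧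
      ∀ t, n.whd t = p.whd t - w' t := by
  have hvd : ∀ t, 0 ≤ t → HasDerivWithinAt (fun t => p.v t - V t)
      (p.wh t - W t - e.accelErr i j t (p.v t - V t)) (Ici 0) t := fun t ht => by
    refine ((hp.v t ht).sub (hV t ht)).congr_deriv ?_
    rw [e.accelErr_eq i j t (p.v t - V t)]
    ring
  refine ⟨⟨fun t => p.x t - x₀ - X t, fun t => p.v t - V t, fun t => p.wh t - W t,
    fun t => e.accelErr i j t (p.v t - V t), fun t => p.whd t - w' t⟩,
    ⟨by simp [hX0], by simp [hV0], by simp [hW0], fun t => rfl⟩,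
    ⟨fun t ht => ((hp.x t ht).sub_const _).sub (hX t ht), hvd,
      fun t ht => (hp.wh t ht).sub (hW t ht), ?_⟩,
    fun t => by ring, fun t => by ring, fun t => by ring, fun t => rfl⟩
  simp only [e.accelErr_eq i j _ (_ - _)]
  exact (e.continuous_accelErr_zero i j).continuousOn.add
    ((e.continuous_accelSlope i j).continuousOn.mul
      fun t ht => (hvd t ht).continuousWithinAt)

theorem continuousOn_relative (i j : ℕ) {p : Motion} (hp : p.IsMotion) :
    ContinuousOn (fun t => e.accelErr i j t 0 + e.accelSlope i j t * p.v t - p.ew t) (Ici 0) :=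
  ((e.continuous_accelErr_zero i j).continuousOn.add
    ((e.continuous_accelSlope i j).continuousOn.mul
      fun t ht => (hp.v t ht).continuousWithinAt)).sub hp.ew

theorem exists_head {D : Spec} {i : ℕ} (H : HeadGains D K i) {p : Motion} (hp : p.IsMotion)
    (h0 : (p.x 0 - s₀.x i 1 - D.ds, p.v 0 - s₀.v i 1, p.wh 0 - s₀.wh i 1) ∈ headRegion D K i) :
    ∃ n : Motion, e.Starts i 1 n ∧ n.IsMotion ∧ ∀ t, n.whd t = p.whd t
      - headRhs D K i (p.x t - n.x t - D.ds) (p.v t - n.v t) (p.wh t - n.wh t) := by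
  obtain ⟨X, V, W, hX0, hV0, hW0, h⟩ := H.exists_trajectory (e.continuousOn_relative i 1 hp)
    (e.continuous_accelSlope i 1).neg.continuousOn h0
  obtain ⟨n, h1, h2, h3, h4, h5, h6⟩ := e.exists_of_relative i 1 hp D.ds hX0 hV0 hW0
    (fun t ht => (h t ht).x) (fun t ht => (h t ht).v) (fun t ht => (h t ht).w)
  exact ⟨n, h1, h2, fun t => by rw [h6, h3, h4, h5]⟩

theorem exists_follower (i j : ℕ) {p : Motion} (hp : p.IsMotion) :
    ∃ n : Motion, e.Starts i j n ∧ n.IsMotion ∧ ∀ t, n.whd t = e.followerWhd i j p n t := by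
  set a := K.l₁ i j + 1 with ha
  set c := zDamping K i j with hc
  set l := K.l₃ i j with hl
  let g : ℝ → ℝ := fun t => e.accelErr i j t 0 + e.accelSlope i j t * p.v t - p.ew t
  let s₁ : ℝ → ℝ := fun t => e.ex i j t - e.ex i (j - 1) t + P.dp
  let s₂ : ℝ → ℝ := fun t => e.ev i j t - e.ev i (j - 1) t
  let r₁ : ℝ → ℝ := fun t => -(K.k₁ i j * e.ex i j t) + K.k₁ i (j - 1) * e.ex i (j - 1) t
  let r₂ : ℝ → ℝ := fun t => e.ez i j t + K.k₂ i j * e.ev i j t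
    - (e.ez i (j - 1) t + K.k₂ i (j - 1) * e.ev i (j - 1) t)
  have hg : ContinuousOn g (Ici 0) := e.continuousOn_relative i j hp
  have hr : ContinuousOn (fun t => l * (c * (s₂ t + a * s₁ t) + s₁ t + a * s₂ t) + s₂ t + a * s₁ t
      + (c * a + 1) * r₁ t + (c + a) * (r₂ t - g t)) (Ici 0) := by
    have := e.continuous_ex
    have := e.continuous_ev
    have := e.continuous_ez
    fun_prop
  -- The coefficients are those of `p.whd - followerWhd` after substituting `n = p - (X, V, W)`;
  -- `s₁`, `s₂`, `r₁`, `r₂` and `g` collect what does not depend on `X, V, W`.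
  obtain ⟨X, V, W, hX0, hV0, hW0, h⟩ := exists_linear_chain (-(l * (c * a + 1)) - a)
    (-(l * (c + a)) - 1 - (c * a + 1)) (-l - (c + a)) hg
    (e.continuous_accelSlope i j).neg.continuousOn hr
    ((e.continuous_accelSlope i j).const_smul (c + a)).continuousOn
    (p.x 0 - s₀.x i j - 0) (p.v 0 - s₀.v i j) (p.wh 0 - s₀.wh i j)
  obtain ⟨n, h1, h2, h3, h4, h5, h6⟩ := e.exists_of_relative i j hp 0 hX0 hV0 hW0
    (fun t ht => (h t ht).1) (fun t ht => (h t ht).2.1) (fun t ht => (h t ht).2.2)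
  refine ⟨n, h1, h2, fun t => ?_⟩
  rw [h6, h3, h4, h5, followerWhd, z3, alpha2_eq, z2_eq, z1, h1.ew t, e.accelErr_eq]
  simp only [Pi.smul_apply, smul_eq_mul, g, s₁, s₂, r₁, r₂]
  ring

end ErrorData

/-- The motion of the reference. -/
def Reference.motion (R : Reference) : Motion := ⟨R.x, R.v, R.w, fun _ => 0, R.u⟩

theorem Reference.IsTrajectory.isMotion {R : Reference} (hR : R.IsTrajectory) :
    R.motion.IsMotion :=
  ⟨fun t ht => (hR t ht).1, fun t ht => by simpa [Reference.motion] using (hR t ht).2.1,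
    fun t ht => (hR t ht).2.2, continuousOn_const⟩

/-! ### Recursion of the motions along the platoon -/

section Recursion

variable (P : Plant) (R : Reference) (step : ℕ → ℕ → Motion → Motion)

/-- The motions of the carriages of train `i`, given the motion in front of it. -/
def trainMotion (i : ℕ) (front : Motion) : ℕ → Motion
  | 0 => step i 0 front
  | 1 => step i 1 front
  | j + 2 => step i (j + 2) (trainMotion i front (j + 1))

/-- The motion in front of train `i`. -/
def frontMotion : ℕ → Motion
  | 0 => R.motion
  | i + 1 => if i = 0 then R.motion else trainMotion step i (frontMotion i) (P.M i)

/-- The motion of carriage `(i, j)`. -/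
def carriageMotion (i j : ℕ) : Motion := trainMotion step i (frontMotion P R step i) j

theorem frontMotion_one : frontMotion P R step 1 = R.motion := by simp [frontMotion]

theorem frontMotion_of_ne_one {i : ℕ} (hi : 1 ≤ i) (h1 : i ≠ 1) :
    frontMotion P R step i = carriageMotion P R step (i - 1) (P.M (i - 1)) := by
  obtain ⟨k, rfl⟩ : ∃ k, i = k + 1 := ⟨i - 1, by omega⟩
  simp [frontMotion, carriageMotion, show k ≠ 0 by omega]

theorem carriageMotion_of_two_le {i j : ℕ} (hj : 2 ≤ j) :
    carriageMotion P R step i j = step i j (carriageMotion P R step i (j - 1)) := by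
  obtain ⟨k, rfl⟩ : ∃ k, j = k + 2 := ⟨j - 2, by omega⟩
  rfl

end Recursion

namespace ErrorData

variable {P : Plant} {K : Gains P} {s₀ : State P} (e : ErrorData K s₀)

theorem exists_step (D : Spec) (i j : ℕ) (p : Motion) : ∃ n : Motion, e.Starts i j n ∧
    (p.IsMotion → j = 1 → HeadGains D K i →
      (p.x 0 - s₀.x i 1 - D.ds, p.v 0 - s₀.v i 1, p.wh 0 - s₀.wh i 1) ∈ headRegion D K i →
      n.IsMotion ∧ ∀ t, n.whd t = p.whd t
        - headRhs D K i (p.x t - n.x t - D.ds) (p.v t - n.v t) (p.wh t - n.wh t)) ∧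
    (p.IsMotion → j ≠ 1 → n.IsMotion ∧ ∀ t, n.whd t = e.followerWhd i j p n t) := by
  have hjunk : ∃ n : Motion, e.Starts i j n :=
    ⟨⟨fun _ => s₀.x i j, fun _ => s₀.v i j, fun _ => s₀.wh i j,
      fun t => e.accelErr i j t (s₀.v i j), fun _ => 0⟩, rfl, rfl, rfl, fun _ => rfl⟩
  by_cases hp : p.IsMotion
  · by_cases hj : j = 1
    · subst hj
      by_cases h : HeadGains D K i ∧ (p.x 0 - s₀.x i 1 - D.ds, p.v 0 - s₀.v i 1,
          p.wh 0 - s₀.wh i 1) ∈ headRegion D K i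
      · obtain ⟨n, h1, h2⟩ := e.exists_head h.1 hp h.2
        exact ⟨n, h1, fun _ _ _ _ => h2, fun _ hn => absurd rfl hn⟩
      · obtain ⟨n, hn⟩ := hjunk
        exact ⟨n, hn, fun _ _ h1 h2 => absurd ⟨h1, h2⟩ h, fun _ hn => absurd rfl hn⟩
    · obtain ⟨n, h1, h2⟩ := e.exists_follower i j hp
      exact ⟨n, h1, fun _ h => absurd h hj, fun _ _ => h2⟩
  · obtain ⟨n, hn⟩ := hjunk
    exact ⟨n, hn, fun h => absurd h hp, fun h => absurd h hp⟩

/-- The state assembled from the motions of the carriages and the observer errors. -/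
def state (m : ℕ → ℕ → Motion) (t : ℝ) : State P where
  x i j := (m i j).x t
  v i j := (m i j).v t
  w i j := (m i j).wh t - (m i j).ew t
  f i j := e.f i j t
  xh i j := (m i j).x t + e.ex i j t
  vh i j := (m i j).v t + e.ev i j t
  wh i j := (m i j).wh t
  fh i j := e.f i j t + e.ef i j t

/-- The inputs that produce the motions. -/
def input (m : ℕ → ℕ → Motion) (t : ℝ) (i j : ℕ) : ℝ :=
  (m i j).whd t - whRhs K (e.state m t) 0 i j

variable {m : ℕ → ℕ → Motion}

theorem whRhs_input (t : ℝ) (i j : ℕ) :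
    whRhs K (e.state m t) (e.input m t i j) i j = (m i j).whd t := by
  rw [whRhs_eq_add, input]
  ring

theorem velErr_state (t : ℝ) (i j : ℕ) : velErr (e.state m t) i j = e.ev i j t := by
  simp [velErr, state]

theorem zeta_state (hm : ∀ i j, e.Starts i j (m i j)) (t : ℝ) (i j : ℕ) :
    zeta (e.state m t) i j = e.ez i j t := by
  have h := TrainCruise.accelErr_eq (e.state m t) i j
  have h2 : (e.state m t).wh i j - (e.state m t).w i j = e.accelErr i j t ((m i j).v t) := by
    simp [state, (hm i j).ew t]
  have h3 : (e.state m t).v i j = (m i j).v t := rfl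
  rw [h2, accelErr] at h
  simp only [velErr_state, h3] at h
  linarith

theorem state_zero (hm : ∀ i j, e.Starts i j (m i j)) : e.state m 0 = s₀ := by
  have hw : ∀ i j, (m i j).wh 0 - (m i j).ew 0 = s₀.w i j := by
    intro i j
    have h := TrainCruise.accelErr_eq s₀ i j
    rw [(hm i j).ew, (hm i j).wh, (hm i j).v, accelErr, e.ez_zero, e.ev_zero, e.ev_zero, e.ev_zero]
    linarith
  cases s₀
  simp only [state, State.mk.injEq]
  refine ⟨?_, ?_, ?_, ?_, ?_, ?_, ?_, ?_⟩ <;> funext i j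
  · exact (hm i j).x
  · exact (hm i j).v
  · exact hw i j
  · exact e.f_zero i j
  · rw [(hm i j).x, e.ex_zero]; ring
  · rw [(hm i j).v, e.ev_zero, velErr]; ring
  · exact (hm i j).wh
  · rw [e.f_zero, e.ef_zero]; simp

theorem hasDerivWithinAt_state (hm : ∀ i j, e.Starts i j (m i j)) {i j : ℕ}
    (hn : (m i j).IsMotion) {t : ℝ} (ht : 0 ≤ t) :
    (HasDerivWithinAt (fun τ => (e.state m τ).x i j) ((e.state m t).v i j) (Ici 0) t ∧
      HasDerivWithinAt (fun τ => (e.state m τ).v i j) ((e.state m t).w i j) (Ici 0) t ∧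
      HasDerivWithinAt (fun τ => (e.state m τ).w i j)
        (wRhs (e.state m t) (e.input m t i j) i j) (Ici 0) t ∧
      HasDerivWithinAt (fun τ => (e.state m τ).f i j) (P.S i j *ᵥ (e.state m t).f i j)
        (Ici 0) t) ∧
    HasDerivWithinAt (fun τ => (e.state m τ).xh i j) (xhRhs K (e.state m t) i j) (Ici 0) t ∧
    HasDerivWithinAt (fun τ => (e.state m τ).vh i j) (vhRhs K (e.state m t) i j) (Ici 0) t ∧
    HasDerivWithinAt (fun τ => (e.state m τ).wh i j)
      (whRhs K (e.state m t) (e.input m t i j) i j) (Ici 0) t ∧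
    HasDerivWithinAt (fun τ => (e.state m τ).fh i j) (fhRhs K (e.state m t) i j) (Ici 0) t := by
  have hx := hn.x t ht
  have hv : HasDerivWithinAt (fun τ => (e.state m τ).v i j) ((e.state m t).w i j) (Ici 0) t :=
    hn.v t ht
  have hwh : HasDerivWithinAt (fun τ => (e.state m τ).wh i j)
      (whRhs K (e.state m t) (e.input m t i j) i j) (Ici 0) t := by
    rw [whRhs_input]
    exact hn.wh t ht
  have hev : ∀ j', HasDerivWithinAt (fun τ => velErr (e.state m τ) i j')
      (vhRhs K (e.state m t) i j' - (e.state m t).w i j') (Ici 0) t := by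
    intro j'
    simp only [velErr_state, vhRhs_eq, zeta_state e hm, add_sub_cancel_left]
    exact (e.hev i j' t).hasDerivWithinAt
  have hvh : HasDerivWithinAt (fun τ => (e.state m τ).vh i j) (vhRhs K (e.state m t) i j)
      (Ici 0) t := by
    refine ((hv.add (hev j)).congr_deriv (by ring)).congr_of_eventuallyEq
      (Eventually.of_forall fun τ => ?_) ?_ <;> simp [velErr]
  refine ⟨⟨hx, hv, ?_, (e.hf i j t).hasDerivWithinAt⟩, ?_, hvh, hwh, ?_⟩
  · have hz : HasDerivWithinAt (fun τ => zeta (e.state m τ) i j)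
        (P.C i j ⬝ᵥ ((e.state m t).fh i j - (e.state m t).f i j)
          + K.k₃ i j * velErr (e.state m t) i j) (Ici 0) t := by
      simp only [zeta_state e hm, velErr_state]
      refine (e.hez i j t).hasDerivWithinAt.congr_deriv ?_
      simp [state]
    rw [← zetaRhs_eq K _ (e.input m t i j)] at hz
    have h := (((hwh.add (((P.hasDerivAt_D1 i j _).comp_hasDerivWithinAt t hv).sub
      ((P.hasDerivAt_D1 i j _).comp_hasDerivWithinAt t hvh))).sub
      ((hev (j - 1)).const_mul (P.B2 i j))).sub ((hev (j + 1)).const_mul (P.B3 i j))).sub hz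
    refine (h.congr_deriv (by ring)).congr_of_eventuallyEq
      (Eventually.of_forall fun τ => ?_) ?_ <;>
    · simp only [zeta, Pi.add_apply, Pi.sub_apply, Function.comp_apply]
      ring
  · refine (hx.add (e.hex i j t).hasDerivWithinAt).congr_deriv ?_
    rw [xhRhs_eq]
    simp only [state]
    ring
  · refine ((e.hf i j t).add (e.hef i j t)).hasDerivWithinAt.congr_deriv ?_
    rw [fhRhs, mu4]
    simp only [state, Matrix.mulVec_add, add_sub_cancel_left]
    abel

end ErrorData

/-- The closed loop has a solution from every admissible initial state. -/
theorem exists_closedLoopSolution {P : Plant} {D : Spec} {K : Gains P} {R : Reference}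
    (hR : R.IsTrajectory) (hM : ∀ i, P.IsTrain i → 1 ≤ P.M i)
    (H : ∀ i, P.IsTrain i → HeadGains D K i) {s₀ : State P} (h0 : IsAdmissible D K R s₀) :
    ∃ (s : ℝ → State P) (u : ℝ → ℕ → ℕ → ℝ), s 0 = s₀ ∧ IsClosedLoopSolution D K R s u := by
  obtain ⟨e⟩ := nonempty_errorData K s₀
  choose step hstart hhead hfollow using e.exists_step D
  set m := carriageMotion P R step with hmdef
  set front := frontMotion P R step with hfdef
  -- Needed at every index, also where there is no carriage: the initial state is prescribed there
  -- too, and `zeta` refers to both neighbours.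
  have hm : ∀ i j, e.Starts i j (m i j) := by
    intro i j
    rcases j with _ | _ | j
    · exact hstart _ _ _
    · exact hstart _ _ _
    · exact hstart _ _ _
  have hs0 : e.state m 0 = s₀ := e.state_zero hm
  have hxF : ∀ i, P.IsTrain i → ∀ t, xFront R i (e.state m t) t = (front i).x t ∧
      vFront R i (e.state m t) t = (front i).v t ∧
      whFront R i (e.state m t) t = (front i).wh t ∧
      feedforward K R i (e.state m t) (e.input m t) t = (front i).whd t := by
    intro i hi t
    by_cases h1 : i = 1
    · subst h1
      simp [xFront, vFront, whFront, feedforward, hfdef, frontMotion_one, Reference.motion]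
    · rw [feedforward_eq K R i h1, e.whRhs_input, hfdef, frontMotion_of_ne_one P R step hi.1 h1]
      simp only [xFront, vFront, whFront, if_neg h1]
      exact ⟨rfl, rfl, rfl, rfl⟩
  have hregion : ∀ i, P.IsTrain i → ((front i).x 0 - s₀.x i 1 - D.ds, (front i).v 0 - s₀.v i 1,
      (front i).wh 0 - s₀.wh i 1) ∈ headRegion D K i := by
    intro i hi
    obtain ⟨h1, h2, h3, -⟩ := hxF i hi 0
    have h := h0 i hi
    rw [hs0] at h1 h2 h3
    rw [← h1, ← h2, ← h3]
    exact h
  -- The recursion yields genuine motions by induction over trains and, within a train, over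
  -- carriages; admissibility of the initial state enters only at the heads.
  have hmotion : ∀ i, P.IsTrain i → (front i).IsMotion ∧
      ∀ j, P.IsCarriage i j → (m i j).IsMotion := by
    intro i
    induction i with
    | zero => exact fun hi => absurd hi.1 (by omega)
    | succ n ih =>
      intro hi
      have hfront : (front (n + 1)).IsMotion := by
        by_cases hn : n + 1 = 1
        · rw [hn, hfdef, frontMotion_one]
          exact hR.isMotion
        · rw [hfdef, frontMotion_of_ne_one P R step hi.1 hn]
          exact (ih (hi.pred hn)).2 _ (Plant.isCarriage_tail hM (hi.pred hn))
      refine ⟨hfront, fun j => ?_⟩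
      induction j with
      | zero => exact fun hc => absurd hc.2.1 (by omega)
      | succ k ihk =>
        intro hc
        rcases Nat.eq_zero_or_pos k with rfl | hk
        · exact (hhead _ _ _ hfront rfl (H _ hi) (hregion _ hi)).1
        · rw [hmdef, carriageMotion_of_two_le P R step (by omega)]
          exact (hfollow _ _ _ (ihk ⟨hi, hk, (Nat.le_succ k).trans hc.2.2⟩) (by omega)).1
  refine ⟨e.state m, e.input m, hs0, fun t _ i j hc => ?_, fun t ht i j hc =>
    (e.hasDerivWithinAt_state hm ((hmotion i hc.1).2 j hc) ht).1, fun t ht i j hc =>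
    (e.hasDerivWithinAt_state hm ((hmotion i hc.1).2 j hc) ht).2⟩
  split_ifs with hj
  · subst hj
    obtain ⟨h1, h2, h3, h4⟩ := hxF i hc.1 t
    have h5 := (hhead _ _ _ (hmotion i hc.1).1 rfl (H _ hc.1) (hregion _ hc.1)).2 t
    rw [headControl_eq, h4]
    simp only [xTilde, gap, vTilde, whTilde, h1, h2, h3]
    change (m i 1).whd t - _ = _
    rw [show (m i 1).whd t = _ from h5]
    change _ = (front i).whd t - _ - headRhs D K i ((front i).x t - (m i 1).x t - D.ds)
      ((front i).v t - (m i 1).v t) ((front i).wh t - (m i 1).wh t)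
    change (front i).whd t - headRhs D K i ((front i).x t - (m i 1).x t - D.ds)
      ((front i).v t - (m i 1).v t) ((front i).wh t - (m i 1).wh t) - _ = _
    ring
  · have hj2 : 2 ≤ j := by have := hc.2.1; omega
    have hp : P.IsCarriage i (j - 1) := ⟨hc.1, by omega, (Nat.sub_le _ _).trans hc.2.2⟩
    have h5 := (hfollow i j _ ((hmotion i hc.1).2 _ hp) hj).2 t
    rw [hmdef, ← carriageMotion_of_two_le P R step hj2, ← hmdef] at h5
    have h6 := whRhs_followerControl K i j (e.state m t) (e.input m t i (j - 1))
    rw [whRhs_eq_add, alpha3_eq, e.whRhs_input, xhRhs_eq, xhRhs_eq, vhRhs_eq, vhRhs_eq,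
      e.zeta_state hm, e.zeta_state hm, e.velErr_state, e.velErr_state] at h6
    rw [ErrorData.input, h5, ErrorData.followerWhd]
    simp only [ErrorData.state, add_sub_cancel_left] at h6 ⊢
    linarith

end TrainCruise

end

theorem theorem2 (P : TrainCruise.Plant) (D : TrainCruise.Spec) (K : TrainCruise.Gains P)
    (R : TrainCruise.Reference)
    (hN : 1 ≤ P.N) (hM : ∀ i, P.IsTrain i → 1 ≤ P.M i)
    (hm : ∀ i j, P.IsCarriage i j → 0 < P.m i j)
    (hγ₂ : 0 < D.γ₂) (hds : D.γ₂ < D.ds) (hγ₁ : D.ds < D.γ₁)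
    (hσ₁ : 0 < D.σ₁) (hσ₂ : 0 < D.σ₂)
    (hR : R.IsTrajectory) (hRv : ∃ V : ℝ, ∀ t : ℝ, 0 ≤ t → |R.v t| ≤ V)
    (hk₁ : ∀ i j, P.IsCarriage i j → 0 < K.k₁ i j)
    (hK : ∀ i j, P.IsCarriage i j →
      TrainCruise.IsHurwitz (P.A i j + K.col i j * P.out i j))
    (hl : ∀ i j, P.IsCarriage i j → 2 ≤ j → 0 < K.l₁ i j ∧ 0 < K.l₂ i j ∧ 0 < K.l₃ i j)
    (hell₁ : ∀ i, P.IsTrain i → 0 < K.ell₁ i ∧ K.ell₁ i < min (D.σ₂ / D.ρ₁) (D.σ₁ / D.ρ₂))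
    (hell : ∀ i, P.IsTrain i →
      2 < K.ell₂ i ∧ 2 + K.ell₂ i ^ 2 / 2 < K.ell₃ i ∧ 1 / 2 < K.ell₄ i) :
    (∀ s₀ : TrainCruise.State P, TrainCruise.IsAdmissible D K R s₀ →
      ∃ (s : ℝ → TrainCruise.State P) (u : ℝ → ℕ → ℕ → ℝ),
        s 0 = s₀ ∧ TrainCruise.IsClosedLoopSolution D K R s u) ∧
    (∀ (s : ℝ → TrainCruise.State P) (u : ℝ → ℕ → ℕ → ℝ),
      TrainCruise.IsClosedLoopSolution D K R s u → TrainCruise.IsAdmissible D K R (s 0) →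
        TrainCruise.RequirementOne s ∧ TrainCruise.RequirementTwo D R s ∧
          TrainCruise.RequirementThree D R s) := by
  have H : ∀ i, P.IsTrain i → TrainCruise.HeadGains D K i := fun i hi =>
    .of_lt hds hγ₁ (hell₁ i hi) (hell i hi)
  exact ⟨fun _ h0 => TrainCruise.exists_closedLoopSolution hR hM H h0,
    fun _ _ hs h0 => hs.requirements hR hM hRv hK hk₁ hl H h0⟩
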